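/- **Conventions.** All structures are finite with non-empty universe, over relational vocabularies. A graph $(V,E)$ has a non-empty finite vertex set, no loops and undirected edges, and is viewed as an $\{E\}$-structure. *FP+C.* A structure $A$ is equipped with the number sort $N(A)=\{0,\dots,|U(A)|\}$. Structure variables range over $U(A)$, number variables over $N(A)$, and relational variables over relations $R\subseteq W_1\times\dots\times W_k$ with each $W_i\in\{U(A),N(A)\}$. Formulas of fixed-point logic with counting $\mathrm{FP{+}C}$ are built by the rules of first-order logic together with atoms $p\le q$ for number variables, atoms $X\bar u$, counting formulas $\#\bar u\,\psi=\bar p$ (the number of tuples $\bar a$ satisfying $\psi$ equals $\sum_i p_i(|U(A)|+1)^{i-1}$), and inflationary fixed points $[\mathrm{ifp}\,X\leftarrow\bar u\mid\psi]\,\bar u'$ (the tuple $\bar u'$ lies in the limit of $F_0=\emptyset$, $F_{i+1}=F_i\cup\{\bar a\mid \psi(F_i,\bar a)\}$). *Transductions.* A parameterized $\mathrm{FP{+}C}[\tau_1,\tau_2]$-transduction $\Theta(\bar x)$ with individual (structure or number) parameter variables $\bar x$ consists of $\mathrm{FP{+}C}[\tau_1]$-formulas $\theta_{\rm dom}(\bar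 x)$, $\theta_U(\bar x,\bar u)$, $\theta_\approx(\bar x,\bar u,\bar u')$ and $\theta_R(\bar x,\bar u_1,\dots,\bar u_{\mathrm{ar}(R)})$ for $R\in\tau_2$, where $\bar u,\bar u',\bar u_i$ are tuples of individual variables of the same length and sorts. The pair $(A,\bar p)$ is in its domain if $A\models\theta_{\rm dom}[\bar p]$ and $\theta_U$ defines a non-empty set of tuples. In that case, with $\approx$ the equivalence relation on all tuples generated by the relation defined by $\theta_\approx$, the $\tau_2$-structure $\Theta[A,\bar p]$ has as universe the set of $\approx$-classes of the tuples satisfying $\theta_U$, and its relation $R$ is the set of tuples of classes of those tuples that satisfy $\theta_R$ and all of whose components satisfy $\theta_U$. *Canonization.* Let $\le$ be a symbol not in $\tau$. An ordered copy of a $\tau$-structure $A$ is a $\tau\cup\{\le\}$-structure whose $\tau$-reduct is isomorphic to $A$ and in which $\le$ is a linear order on the universe. A parameterized $\mathrm{FP{+}C}[\tau,\tau\cup\{\le\}]$-transduction $\Theta(\bar x)$ canonizes $A$ if $(A,\bar p)$ is in its domain for at least one $\bar p$, and $\Theta[A,\bar p]$ is an ordered copy of $A$ for every $\bar p$ with $(A,\bar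 p)$ in its domain. A class of $\tau$-structures admits $\mathrm{FP{+}C}$-definable parameterized canonization if one such $\Theta(\bar x)$ canonizes all its members; it admits $\mathrm{FP{+}C}$-definable canonization if this holds for some $\Theta$ without parameters (empty $\bar x$). *Prime graphs.* A module of a graph $(V,E)$ is a non-empty set $W\subseteq V$ such that every vertex outside $W$ is adjacent to all or to none of the vertices in $W$. A graph is prime if its only modules are $V$ and the singletons. *LO-colored graphs.* An LO-colored graph consists of a graph $(V,E)$ (its underlying graph), a non-empty finite set $M$ disjoint from $V$, a linear order $\trianglelefteq$ on $M$, and a relation $L\subseteq V\times M^2$ (so each vertex $v$ is colored by the binary relation $L_v=\{(d,d')\mid (v,d,d')\in L\}$ on $M$). It is viewed as a $\{V,E,M,\trianglelefteq,L\}$-structure with universe $V\mathop{\dot\cup}M$. **Theorem (Modular Decomposition Theorem).** Let $\mathcal C$ be a class of graphs that is closed under induced subgraphs (on non-empty vertex sets). Let $\mathcal C^*_{\rm prim}$ be the class of all LO-colored graphs whose underlying graph is a prime graph in $\mathcal C$ with at least $4$ vertices. If $\mathcal C^*_{\rm prim}$ admits $\mathrm{FP{+}C}$-definable parameterized canonization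 (in particular, if it admits $\mathrm{FP{+}C}$-definable canonization), then $\mathcal C$ admits $\mathrm{FP{+}C}$-definable canonization (without parameters). -/

import Mathlib

namespace FPC

open FirstOrder FirstOrder.Language

/-! ### Finite structures -/

/-- A finite structure with non-empty universe over the vocabulary `τ`. -/
structure FinStruct (τ : FirstOrder.Language.{0, 0}) where
  carrier : Type
  [finite : Finite carrier]
  [nonempty : Nonempty carrier]
  [str : τ.Structure carrier]

attribute [instance] FinStruct.finite FinStruct.nonempty FinStruct.str

/-- The number sort `N(A) = {0, …, |U(A)|}` of a structure with universe `A`. -/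
abbrev Num (A : Type) : Type := Fin (Nat.card A + 1)

/-- Two-sorted tuples over `A`: `k` elements of the universe and `l` elements of the number sort.
The way in which the two sorts are interleaved in a tuple is immaterial, so the components of the
two sorts are listed separately. -/
abbrev Tup (A : Type) (k l : ℕ) : Type := (Fin k → A) × (Fin l → Num A)

/-! ### Syntax of fixed-point logic with counting -/

/-- The supply `R` of relational variables, enlarged by one fresh variable `new` whose type is
`(k, l)`; it ranges over relations between `k`-tuples of elements and `l`-tuples of numbers. -/
inductive RelCons (R : ℕ → ℕ → Type) (k l : ℕ) : ℕ → ℕ → Type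
  | new : RelCons R k l k l
  | old {k' l' : ℕ} (X : R k' l') : RelCons R k l k' l'

/-- No relational variables. -/
abbrev noRel : ℕ → ℕ → Type := fun _ _ => Empty

/-- `Formula τ S N R` is the type of formulas of FP+C over the relational vocabulary `τ` whose free
variables are among the structure variables `S`, the number variables `N`, and the relational
variables `R k l` (of type `(k, l)`).

A binder for a tuple of `k` structure variables and `l` number variables adds `Fin k` to `S` and
`Fin l` to `N`. Equality of numbers is `p ≤ q ∧ q ≤ p`.

* `count ψ p` is `# ū ψ = p̄`;
* `app X x p` is the atomic formula `X x̄ p̄`;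
* `ifp ψ x p` is `[ifp X, ū. ψ] x̄ p̄`. -/
inductive Formula (τ : FirstOrder.Language.{0, 0}) : (S N : Type) → (R : ℕ → ℕ → Type) → Type 1
  | rel {S N : Type} {R : ℕ → ℕ → Type} {n : ℕ} (P : τ.Relations n) (x : Fin n → S) :
      Formula τ S N R
  | eq {S N : Type} {R : ℕ → ℕ → Type} (x y : S) : Formula τ S N R
  | le {S N : Type} {R : ℕ → ℕ → Type} (p q : N) : Formula τ S N R
  | not {S N : Type} {R : ℕ → ℕ → Type} (φ : Formula τ S N R) : Formula τ S N R
  | and {S N : Type} {R : ℕ → ℕ → Type} (φ ψ : Formula τ S N R) : Formula τ S N R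
  | ex {S N : Type} {R : ℕ → ℕ → Type} {k l : ℕ}
      (φ : Formula τ (S ⊕ Fin k) (N ⊕ Fin l) R) : Formula τ S N R
  | count {S N : Type} {R : ℕ → ℕ → Type} {k l m : ℕ}
      (ψ : Formula τ (S ⊕ Fin k) (N ⊕ Fin l) R) (p : Fin m → N) : Formula τ S N R
  | app {S N : Type} {R : ℕ → ℕ → Type} {k l : ℕ} (X : R k l) (x : Fin k → S) (p : Fin l → N) :
      Formula τ S N R
  | ifp {S N : Type} {R : ℕ → ℕ → Type} {k l : ℕ}
      (ψ : Formula τ (S ⊕ Fin k) (N ⊕ Fin l) (RelCons R k l)) (x : Fin k → S) (p : Fin l → N) :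
      Formula τ S N R

/-! ### Semantics -/

/-- The number `⟨n₁, …, nₘ⟩_A = ∑ nᵢ (|U(A)| + 1) ^ (i - 1)` coded by a tuple of numbers. -/
noncomputable def numVal (A : Type) {m : ℕ} (p : Fin m → Num A) : ℕ :=
  ∑ i : Fin m, (p i : ℕ) * (Nat.card A + 1) ^ (i : ℕ)

/-- Assignments of relations to relational variables. -/
abbrev RelAssign (A : Type) (R : ℕ → ℕ → Type) : Type :=
  ∀ k l : ℕ, R k l → Set (Tup A k l)

/-- Extend an assignment by the value `P` of the fresh relational variable. -/
def RelAssign.cons {A : Type} {R : ℕ → ℕ → Type} {k l : ℕ} (r : RelAssign A R)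
    (P : Set (Tup A k l)) : RelAssign A (RelCons R k l)
  | _, _, .new => P
  | _, _, .old X => r _ _ X

/-- The empty assignment. -/
def RelAssign.none (A : Type) : RelAssign A noRel := fun _ _ X => X.elim

/-- The stages `F₀ = ∅`, `Fᵢ₊₁ = Fᵢ ∪ F Fᵢ` of the inflationary iteration of `F`. -/
def inflStage {T : Type} (F : Set T → Set T) : ℕ → Set T
  | 0 => ∅
  | i + 1 => inflStage F i ∪ F (inflStage F i)

/-- The inflationary fixed point of `F`. The stages increase; over a finite set they become
constant, and then their union is the stage at which this happens, see `inflFix_eq`. -/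
def inflFix {T : Type} (F : Set T → Set T) : Set T := ⋃ i, inflStage F i

theorem inflFix_eq {T : Type} (F : Set T → Set T) (m : ℕ)
    (h : inflStage F m = inflStage F (m + 1)) : inflFix F = inflStage F m := by
  have mono : Monotone (inflStage F) :=
    monotone_nat_of_le_succ fun i => Set.subset_union_left
  have const : ∀ j, inflStage F (m + j) = inflStage F m := by
    intro j
    induction j with
    | zero => rfl
    | succ j ih =>
      change inflStage F (m + j) ∪ F (inflStage F (m + j)) = _
      rw [ih]
      exact h.symm
  apply Set.Subset.antisymm
  · refine Set.iUnion_subset fun i => ?_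
    rw [← const i]
    exact mono (Nat.le_add_left i m)
  · exact Set.subset_iUnion (inflStage F) m

/-- Truth of a formula in the structure `A` under an assignment. -/
def Formula.Realize {τ : FirstOrder.Language.{0, 0}} {A : Type} [τ.Structure A] :
    {S N : Type} → {R : ℕ → ℕ → Type} → Formula τ S N R →
      (S → A) → (N → Num A) → RelAssign A R → Prop
  | _, _, _, .rel P x, s, _, _ => Structure.RelMap P (fun i => s (x i))
  | _, _, _, .eq x y, s, _, _ => s x = s y
  | _, _, _, .le p q, _, n, _ => n p ≤ n q
  | _, _, _, .not φ, s, n, r => ¬ φ.Realize s n r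
  | _, _, _, .and φ ψ, s, n, r => φ.Realize s n r ∧ ψ.Realize s n r
  | _, _, _, .ex (k := k) (l := l) φ, s, n, r =>
      ∃ a : Tup A k l, φ.Realize (Sum.elim s a.1) (Sum.elim n a.2) r
  | _, _, _, .count (k := k) (l := l) ψ p, s, n, r =>
      Set.ncard {a : Tup A k l | ψ.Realize (Sum.elim s a.1) (Sum.elim n a.2) r} =
        numVal A (fun i => n (p i))
  | _, _, _, .app X x p, s, n, r => ((fun i => s (x i), fun i => n (p i)) : Tup A _ _) ∈ r _ _ X
  | _, _, _, .ifp (k := k) (l := l) ψ x p, s, n, r =>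
      ((fun i => s (x i), fun i => n (p i)) : Tup A k l) ∈
        inflFix fun P : Set (Tup A k l) =>
          {a : Tup A k l | ψ.Realize (Sum.elim s a.1) (Sum.elim n a.2) (r.cons P)}

/-! ### Transductions -/

/-- Parameterized FP+C`[τ₁, τ₂]`-transductions, with structure variables `S`, number variables `N`
and relational variables `R` as parameters. The domain variables are a tuple `ū` of `k` structure
variables and `l` number variables; an `n`-tuple `ū₁, …, ūₙ` of such tuples is indexed by
`Fin n × Fin k` and `Fin n × Fin l`. -/
structure Transduction (τ₁ τ₂ : FirstOrder.Language.{0, 0}) (S N : Type) (R : ℕ → ℕ → Type) where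
  k : ℕ
  l : ℕ
  dom : Formula τ₁ S N R
  univ : Formula τ₁ (S ⊕ Fin k) (N ⊕ Fin l) R
  equiv : Formula τ₁ (S ⊕ Fin 2 × Fin k) (N ⊕ Fin 2 × Fin l) R
  rel : ∀ {n : ℕ}, τ₂.Relations n → Formula τ₁ (S ⊕ Fin n × Fin k) (N ⊕ Fin n × Fin l) R

namespace Transduction

variable {τ₁ τ₂ : FirstOrder.Language.{0, 0}} {S N : Type} {R : ℕ → ℕ → Type}

section

variable (Θ : Transduction τ₁ τ₂ S N R) (A : FinStruct τ₁)
  (s : S → A.carrier) (n : N → Num A.carrier) (r : RelAssign A.carrier R)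

/-- The relation defined by a formula with `m` tuples of domain variables. -/
def holds {m : ℕ} (φ : Formula τ₁ (S ⊕ Fin m × Fin Θ.k) (N ⊕ Fin m × Fin Θ.l) R)
    (t : Fin m → Tup A.carrier Θ.k Θ.l) : Prop :=
  φ.Realize (Sum.elim s fun ij => (t ij.1).1 ij.2) (Sum.elim n fun ij => (t ij.1).2 ij.2) r

/-- The set of tuples defined by the universe formula. -/
def univSet : Set (Tup A.carrier Θ.k Θ.l) :=
  {t | Θ.univ.Realize (Sum.elim s t.1) (Sum.elim n t.2) r}

/-- The parameters belong to the domain of the transduction. -/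
def InDom : Prop := Θ.dom.Realize s n r ∧ (Θ.univSet A s n r).Nonempty

/-- The equivalence relation on all tuples generated by the formula `equiv`. -/
def setoid : Setoid (Tup A.carrier Θ.k Θ.l) :=
  Relation.EqvGen.setoid fun t t' => Θ.holds A s n r Θ.equiv ![t, t']

/-- The classes of the tuples in `univSet`. -/
def Universe : Type :=
  Quotient ((Θ.setoid A s n r).comap (Subtype.val : Θ.univSet A s n r → _))

/-- The class of a tuple in `univSet`. -/
def cls (t : Θ.univSet A s n r) : Θ.Universe A s n r := Quotient.mk _ t

/-- A relation holds of a tuple of classes if it holds of some representatives in `univSet`. -/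
instance [τ₂.IsRelational] : τ₂.Structure (Θ.Universe A s n r) where
  funMap f := isEmptyElim f
  RelMap {m} P q := ∃ t : Fin m → Θ.univSet A s n r,
    (∀ i, Θ.cls A s n r (t i) = q i) ∧ Θ.holds A s n r (Θ.rel P) fun i => (t i).1

/-- The structure `Θ[A, P̄]` defined by the transduction from `A` and parameters in its domain. -/
def apply [τ₂.IsRelational] (h : Θ.InDom A s n r) : FinStruct τ₂ :=
  haveI : Finite (Θ.Universe A s n r) := inferInstanceAs (Finite (Quotient _))
  haveI : Nonempty (Θ.Universe A s n r) := h.2.elim fun t ht => ⟨Θ.cls A s n r ⟨t, ht⟩⟩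
  { carrier := Θ.Universe A s n r }

end

end Transduction

/-! ### Canonization -/

/-- The vocabulary `τ ∪ {≤}`. -/
abbrev withOrder (τ : FirstOrder.Language.{0, 0}) : FirstOrder.Language.{0, 0} := τ.sum FirstOrder.Language.order

/-- `B` is an ordered copy of `A`: its relation `≤` is a linear order on the universe of `B`, and
its `τ`-reduct is isomorphic to `A`. -/
def IsOrderedCopy {τ : FirstOrder.Language.{0, 0}} (B : FinStruct (withOrder τ)) (A : FinStruct τ) : Prop :=
  IsLinearOrder B.carrier
      (fun a b => Structure.RelMap (leSymb : (withOrder τ).Relations 2) ![a, b]) ∧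
    letI := (LHom.sumInl : τ →ᴸ withOrder τ).reduct B.carrier
    Nonempty (B.carrier ≃[τ] A.carrier)

/-- FP+C`[τ, τ ∪ {≤}]`-transductions with a tuple of individual variables as parameters,
namely `a` structure variables and `b` number variables. -/
abbrev OrdTransduction (τ : FirstOrder.Language.{0, 0}) (a b : ℕ) : Type 1 :=
  Transduction τ (withOrder τ) (Fin a) (Fin b) noRel

/-- `Θ` canonizes `A`: some parameters lie in the domain of `Θ`, and `Θ[A, p̄]` is an ordered copy
of `A` for all parameters `p̄` in the domain. -/
def Canonizes {τ : FirstOrder.Language.{0, 0}} [τ.IsRelational] {a b : ℕ} (Θ : OrdTransduction τ a b)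
    (A : FinStruct τ) : Prop :=
  (∃ p : Tup A.carrier a b, Θ.InDom A p.1 p.2 (RelAssign.none _)) ∧
    ∀ (p : Tup A.carrier a b) (h : Θ.InDom A p.1 p.2 (RelAssign.none _)),
      IsOrderedCopy (Θ.apply A p.1 p.2 (RelAssign.none _) h) A

/-- The class `K` admits FP+C-definable parameterized canonization. -/
def AdmitsParameterizedCanonization {τ : FirstOrder.Language.{0, 0}} [τ.IsRelational]
    (K : Set (FinStruct τ)) : Prop :=
  ∃ (a b : ℕ) (Θ : OrdTransduction τ a b), ∀ A ∈ K, Canonizes Θ A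

/-- The class `K` admits FP+C-definable canonization (without parameters). -/
def AdmitsCanonization {τ : FirstOrder.Language.{0, 0}} [τ.IsRelational] (K : Set (FinStruct τ)) : Prop :=
  ∃ Θ : OrdTransduction τ 0 0, ∀ A ∈ K, Canonizes Θ A

/-! ### Graphs and modules -/

/-- A graph: a non-empty finite set of vertices with a set of edges. -/
structure FinGraph where
  V : Type
  [finite : Finite V]
  [nonempty : Nonempty V]
  graph : SimpleGraph V

attribute [instance] FinGraph.finite FinGraph.nonempty

/-- The subgraph of `G` induced by a non-empty set of vertices. -/
def FinGraph.induce (G : FinGraph) (W : Set G.V) (hW : W.Nonempty) : FinGraph :=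
  haveI : Nonempty W := hW.to_subtype
  { V := W, graph := G.graph.induce W }

/-- A graph as a structure over the vocabulary `{E}`. -/
def FinGraph.toStruct (G : FinGraph) : FinStruct FirstOrder.Language.graph :=
  { carrier := G.V, str := G.graph.structure }

/-- The graph class `C` is closed under induced subgraphs. -/
def ClosedUnderInducedSubgraphs (C : Set FinGraph) : Prop :=
  ∀ G ∈ C, ∀ (W : Set G.V) (hW : W.Nonempty), G.induce W hW ∈ C

/-- `M` is a module of `G`: every vertex outside `M` is adjacent to all or to no vertices in `M`. -/
def IsModule {V : Type} (G : SimpleGraph V) (M : Set V) : Prop :=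
  M.Nonempty ∧ ∀ v ∉ M, ∀ w ∈ M, ∀ w' ∈ M, G.Adj v w ↔ G.Adj v w'

/-- A graph is prime if all its modules are trivial. -/
def IsPrime {V : Type} (G : SimpleGraph V) : Prop :=
  ∀ M : Set V, IsModule G M → M = Set.univ ∨ ∃ v, M = {v}

/-! ### LO-colored graphs -/

/-- An LO-colored graph: a graph, a non-empty finite linearly ordered set `M` of basic color
elements, and a color relation assigning to each vertex `v` the binary relation `L v` on `M`. -/
structure LOColoredGraph where
  underlying : FinGraph
  M : Type
  [finite : Finite M]
  [nonempty : Nonempty M]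
  [linearOrder : LinearOrder M]
  L : underlying.V → M → M → Prop

attribute [instance] LOColoredGraph.finite LOColoredGraph.nonempty LOColoredGraph.linearOrder

/-- The relation symbols `V, E, M, ⊴, L` of the vocabulary of LO-colored graphs. -/
inductive LORel : ℕ → Type
  | V : LORel 1
  | E : LORel 2
  | M : LORel 1
  | le : LORel 2
  | L : LORel 3

/-- The vocabulary `{V, E, M, ⊴, L}` of LO-colored graphs. -/
def loLang : FirstOrder.Language.{0, 0} := ⟨fun _ => Empty, LORel⟩

instance : loLang.IsRelational := fun _ => inferInstanceAs (IsEmpty Empty)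

/-- The structure of an LO-colored graph, whose universe is the disjoint union of the set of
vertices and the set `M` of basic color elements. -/
def LOColoredGraph.toStruct (H : LOColoredGraph) : FinStruct loLang where
  carrier := H.underlying.V ⊕ H.M
  str :=
    { funMap := fun f => isEmptyElim f
      RelMap := fun P x => match P, x with
        | LORel.V, x => ∃ v, x 0 = Sum.inl v
        | LORel.E, x => ∃ v w, x 0 = Sum.inl v ∧ x 1 = Sum.inl w ∧ H.underlying.graph.Adj v w
        | LORel.M, x => ∃ d, x 0 = Sum.inr d
        | LORel.le, x => ∃ d d', x 0 = Sum.inr d ∧ x 1 = Sum.inr d' ∧ d ≤ d'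
        | LORel.L, x => ∃ v d d', x 0 = Sum.inl v ∧ x 1 = Sum.inr d ∧ x 2 = Sum.inr d' ∧ H.L v d d' }

/-- The graph class `C` as a class of structures. -/
def graphClass (C : Set FinGraph) : Set (FinStruct FirstOrder.Language.graph) := FinGraph.toStruct '' C

/-- The class of all LO-colored graphs whose underlying graph is a prime graph in `C` with at least
four vertices, as a class of structures. -/
def primeLOClass (C : Set FinGraph) : Set (FinStruct loLang) :=
  LOColoredGraph.toStruct ''
    {H | H.underlying ∈ C ∧ IsPrime H.underlying.graph ∧ 4 ≤ Nat.card H.underlying.V}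

end FPC

namespace FPC

open FirstOrder FirstOrder.Language

set_option linter.unusedVariables false
set_option linter.unusedSectionVars false

/-! ### FP+C-definability relative to contexts and presented sets. -/

section

variable {τ : FirstOrder.Language.{0, 0}}

/-! ### Renaming of variables -/

/-! Combinatorics. A vertex set `W` with at least two vertices is split into children: the
components of `G[W]` if it is disconnected, those of the complement if that is disconnected, and the
maximal proper modules otherwise. In the last case overlapping proper modules have a proper union
(`IsModOn.union_proper`), so lying in a common proper module is an equivalence relation. Children
are smaller than `W` (`exists_not_childRel`), and two children are joined by all edges or by none
(`childRel.adj_congr`). Hence `G[W]` is determined by its children and by the quotient, the graph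
induced on one representative of each child. The quotient is edgeless, complete, or prime with at
least four vertices (`IsTransversal.isPrime`, `IsTransversal.four_le`); as an induced subgraph of
`G` it stays in the class.

Codes. A canonical copy of `G[W]` is a relation on the numbers below `|W|` (`IsCode`), with loops
added so that the diagonal records the size. Codes are linearly ordered lexicographically and can
serve as colors. If the quotient is edgeless or complete, only the multiset of the codes of the
children matters, and sorting them gives a code of `W` (`isCode_flatCode`). If it is prime, coloring
each representative by the code of its child gives an LO-colored graph whose color elements are the
numbers. The given transduction turns it into an ordered copy, from which a code is read off; taking
the least code over all parameters removes the parameters (`isCode_primeCode`). Iterating this step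
up the decomposition tree `|V|` times yields a code of `G`, which is an ordered copy on numbers.

Definability. Predicates, functions and natural numbers depending on the points of a context are
shown to be definable by closure properties (`Def`, `Term`, `NTerm`). Derived sets, such as the
children or the universe of an interpreted structure, are presented by tuples (`Srt`), where one
element may have many representing tuples. Three facts carry the argument: presented elements can be
counted although FP+C counts only tuples (`NTerm.ncard`); formulas over an interpreted structure
translate back (`Formula.pull`); and any uniformly definable operator can be iterated by an
inflationary fixed point (`DRel₂.iterate`). -/

/-- Rename the old relational variables. -/
def RelCons.map {R R' : ℕ → ℕ → Type} {k l : ℕ} (ρ : ∀ k l, R k l → R' k l) :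
    ∀ k' l', RelCons R k l k' l' → RelCons R' k l k' l'
  | _, _, .new => .new
  | _, _, .old X => .old (ρ _ _ X)

/-- Rename the free variables of a formula. -/
def Formula.rename : {S N : Type} → {R : ℕ → ℕ → Type} → Formula τ S N R →
    {S' N' : Type} → {R' : ℕ → ℕ → Type} → (S → S') → (N → N') → (∀ k l, R k l → R' k l) →
      Formula τ S' N' R'
  | _, _, _, .rel P x, _, _, _, f, _, _ => .rel P (f ∘ x)
  | _, _, _, .eq x y, _, _, _, f, _, _ => .eq (f x) (f y)
  | _, _, _, .le p q, _, _, _, _, g, _ => .le (g p) (g q)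
  | _, _, _, .not φ, _, _, _, f, g, ρ => .not (φ.rename f g ρ)
  | _, _, _, .and φ ψ, _, _, _, f, g, ρ => .and (φ.rename f g ρ) (ψ.rename f g ρ)
  | _, _, _, .ex (k := k) (l := l) φ, _, _, _, f, g, ρ =>
      .ex (k := k) (l := l) (φ.rename (Sum.map f id) (Sum.map g id) ρ)
  | _, _, _, .count (k := k) (l := l) ψ p, _, _, _, f, g, ρ =>
      .count (k := k) (l := l) (ψ.rename (Sum.map f id) (Sum.map g id) ρ) (g ∘ p)
  | _, _, _, .app X x p, _, _, _, f, g, ρ => .app (ρ _ _ X) (f ∘ x) (g ∘ p)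
  | _, _, _, .ifp (k := k) (l := l) ψ x p, _, _, _, f, g, ρ =>
      .ifp (k := k) (l := l) (ψ.rename (Sum.map f id) (Sum.map g id) (RelCons.map ρ)) (f ∘ x) (g ∘ p)

theorem RelAssign.cons_map {A : Type} {R R' : ℕ → ℕ → Type} {k l : ℕ}
    (ρ : ∀ k l, R k l → R' k l) (r : RelAssign A R') (P : Set (Tup A k l)) :
    (fun k' l' X => r.cons P k' l' (RelCons.map ρ k' l' X)) =
      RelAssign.cons (fun k l X => r k l (ρ k l X)) P := by
  funext k' l' X
  cases X <;> rfl

theorem Formula.realize_rename {A : Type} [τ.Structure A] {S N : Type} {R : ℕ → ℕ → Type}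
    (φ : Formula τ S N R) {S' N' : Type} {R' : ℕ → ℕ → Type} (f : S → S') (g : N → N')
    (ρ : ∀ k l, R k l → R' k l) (s : S' → A) (n : N' → Num A) (r : RelAssign A R') :
    (φ.rename f g ρ).Realize s n r ↔
      φ.Realize (s ∘ f) (n ∘ g) (fun k l X => r k l (ρ k l X)) := by
  induction φ generalizing S' N' R' with
  | rel P x => rfl
  | eq x y => rfl
  | le p q => rfl
  | not φ ih => exact not_congr (ih f g ρ s n r)
  | and φ ψ ih₁ ih₂ => exact and_congr (ih₁ f g ρ s n r) (ih₂ f g ρ s n r)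
  | ex φ ih => simp [Formula.rename, Formula.Realize, ih, Sum.elim_comp_map]
  | count ψ p ih => simp [Formula.rename, Formula.Realize, ih, Sum.elim_comp_map]
  | app X x p => rfl
  | ifp ψ x p ih =>
    simp [Formula.rename, Formula.Realize, ih, Sum.elim_comp_map, RelAssign.cons_map]

/-- Finite conjunction. -/
theorem Formula.exists_conj {S N : Type} {R : ℕ → ℕ → Type} {ι : Type} [Fintype ι]
    (φ : ι → Formula τ S N R) : ∃ χ : Formula τ S N R, ∀ (A : FinStruct τ) (s : S → A.carrier)
      (n : N → Num A.carrier) (r : RelAssign A.carrier R),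
      χ.Realize s n r ↔ ∀ i, (φ i).Realize s n r := by
  have key : ∀ l : List ι, ∃ χ : Formula τ S N R, ∀ (A : FinStruct τ) (s : S → A.carrier)
      (n : N → Num A.carrier) (r : RelAssign A.carrier R),
      χ.Realize s n r ↔ ∀ i ∈ l, (φ i).Realize s n r := by
    intro l
    induction l with
    | nil =>
      -- The syntax has no constant for truth; `∃ p, p ≤ p` over the never empty number sort serves
      -- instead.
      refine ⟨.ex (k := 0) (l := 1) (.le (.inr 0) (.inr 0)), fun A s n r => ?_⟩
      simp [Formula.Realize]
    | cons a l ih =>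
      obtain ⟨χ, h⟩ := ih
      exact ⟨.and (φ a) χ, fun A s n r => by simp [Formula.Realize, h]⟩
  obtain ⟨χ, h⟩ := key Finset.univ.toList
  exact ⟨χ, fun A s n r => by simp [h]⟩

/-- Quantification over tuples indexed by arbitrary finite types. -/
noncomputable def Formula.exT {S N K L : Type} {R : ℕ → ℕ → Type} [Fintype K] [Fintype L]
    (φ : Formula τ (S ⊕ K) (N ⊕ L) R) : Formula τ S N R :=
  .ex (φ.rename (Sum.map id (Fintype.equivFin K)) (Sum.map id (Fintype.equivFin L))
    fun _ _ X => X)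

theorem Formula.realize_exT {A : Type} [τ.Structure A] {S N K L : Type} {R : ℕ → ℕ → Type}
    [Fintype K] [Fintype L] (φ : Formula τ (S ⊕ K) (N ⊕ L) R) (s : S → A) (n : N → Num A)
    (r : RelAssign A R) :
    φ.exT.Realize s n r ↔ ∃ (t : K → A) (u : L → Num A),
      φ.Realize (Sum.elim s t) (Sum.elim n u) r := by
  simp only [Formula.exT, Formula.Realize, Formula.realize_rename, Sum.elim_comp_map,
    Function.comp_id]
  constructor
  · rintro ⟨a, h⟩
    exact ⟨_, _, h⟩
  · rintro ⟨t, u, h⟩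
    refine ⟨(t ∘ (Fintype.equivFin K).symm, u ∘ (Fintype.equivFin L).symm), ?_⟩
    simpa [Function.comp_assoc] using h

/-! ### Families of structures with assignments -/

/-- A family of structures, with values of some variables. -/
structure Base (τ : FirstOrder.Language.{0, 0}) where
  I : Type 1
  A : I → FinStruct τ
  S : Type
  N : Type
  R : ℕ → ℕ → Type
  s : ∀ b, S → (A b).carrier
  n : ∀ b, N → Num (A b).carrier
  r : ∀ b, RelAssign (A b).carrier R

/-- Contexts over the base `𝔅`. The points of a context over `b` are the elements of `J b`; each is
represented by assignments to the variables of the context, among which are the variables of `𝔅`. -/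
structure Ctx (𝔅 : Base τ) (J : 𝔅.I → Type) where
  S : Type
  N : Type
  R : ℕ → ℕ → Type
  rep : ∀ b, (S → (𝔅.A b).carrier) → (N → Num (𝔅.A b).carrier) →
    RelAssign (𝔅.A b).carrier R → J b → Prop
  inS : 𝔅.S → S
  inN : 𝔅.N → N
  inR : ∀ k l, 𝔅.R k l → R k l
  compat : ∀ b s n r j, rep b s n r j → s ∘ inS = 𝔅.s b ∧ n ∘ inN = 𝔅.n b ∧
    (fun k l X => r k l (inR k l X)) = 𝔅.r b

/-- A presentation of the finite sets `X b` by tuples of elements and numbers of `𝔅.A b`. -/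
class Srt (𝔅 : Base τ) (X : 𝔅.I → Type) where
  K : Type
  L : Type
  [fK : Fintype K]
  [fL : Fintype L]
  rep : ∀ b, (K → (𝔅.A b).carrier) → (L → Num (𝔅.A b).carrier) → X b → Prop
  func : ∀ {b t u x x'}, rep b t u x → rep b t u x' → x = x'
  surj : ∀ b x, ∃ t u, rep b t u x
  ker : ∃ κ : Formula τ (𝔅.S ⊕ (K ⊕ K)) (𝔅.N ⊕ (L ⊕ L)) 𝔅.R, ∀ b t u t' u',
    κ.Realize (Sum.elim (𝔅.s b) (Sum.elim t t')) (Sum.elim (𝔅.n b) (Sum.elim u u')) (𝔅.r b) ↔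
      ∃ x, rep b t u x ∧ rep b t' u' x

attribute [reducible, instance] Srt.fK Srt.fL

variable {𝔅 : Base τ} {J J' J'' : 𝔅.I → Type}

theorem Srt.finite (X : 𝔅.I → Type) [Srt 𝔅 X] (b : 𝔅.I) : Finite (X b) := by
  choose t u h using Srt.surj (𝔅 := 𝔅) (X := X) b
  refine Finite.of_injective (fun x => (t x, u x)) fun x y hxy => ?_
  simp only [Prod.mk.injEq] at hxy
  have hx := h x
  rw [hxy.1, hxy.2] at hx
  exact Srt.func hx (h y)

/-- The context without further variables. -/
abbrev Ctx.nil (𝔅 : Base τ) : Ctx 𝔅 (fun _ => Unit) where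
  S := 𝔅.S
  N := 𝔅.N
  R := 𝔅.R
  rep b s n r _ := s = 𝔅.s b ∧ n = 𝔅.n b ∧ r = 𝔅.r b
  inS := id
  inN := id
  inR _ _ X := X
  compat _ _ _ _ _ h := h

/-- Extension of a context by a variable for elements of `X`. -/
abbrev Ctx.ext (Δ : Ctx 𝔅 J) (X : 𝔅.I → Type) [Srt 𝔅 X] : Ctx 𝔅 (fun b => J b × X b) where
  S := Δ.S ⊕ Srt.K (𝔅 := 𝔅) X
  N := Δ.N ⊕ Srt.L (𝔅 := 𝔅) X
  R := Δ.R
  rep b s n r j := Δ.rep b (s ∘ Sum.inl) (n ∘ Sum.inl) r j.1 ∧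
    Srt.rep b (s ∘ Sum.inr) (n ∘ Sum.inr) j.2
  inS x := .inl (Δ.inS x)
  inN x := .inl (Δ.inN x)
  inR := Δ.inR
  compat _ _ _ _ _ h := Δ.compat _ _ _ _ _ h.1

/-- The set of tuples which represent an element of `Q`. -/
def Srt.pullSet {X : 𝔅.I → Type} [Srt 𝔅 X] {b : 𝔅.I} (Q : Set (X b)) :
    Set (Tup (𝔅.A b).carrier (Fintype.card (Srt.K (𝔅 := 𝔅) X)) (Fintype.card (Srt.L (𝔅 := 𝔅) X))) :=
  {t | ∃ x ∈ Q, Srt.rep b (t.1 ∘ Fintype.equivFin _) (t.2 ∘ Fintype.equivFin _) x}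

/-- Extension of a context by a variable for subsets of `X`. -/
abbrev Ctx.extRel (Δ : Ctx 𝔅 J) (X : 𝔅.I → Type) [Srt 𝔅 X] :
    Ctx 𝔅 (fun b => J b × Set (X b)) where
  S := Δ.S
  N := Δ.N
  R := RelCons Δ.R (Fintype.card (Srt.K (𝔅 := 𝔅) X)) (Fintype.card (Srt.L (𝔅 := 𝔅) X))
  rep b s n r j := Δ.rep b s n (fun k l Y => r k l (.old Y)) j.1 ∧
    r _ _ .new = Srt.pullSet j.2
  inS := Δ.inS
  inN := Δ.inN
  inR k l Y := .old (Δ.inR k l Y)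
  compat _ _ _ _ _ h := Δ.compat _ _ _ _ _ h.1

/-- The points of `Δ`, together with their representations, as a base. -/
abbrev Ctx.toBase (Δ : Ctx 𝔅 J) : Base τ where
  I := Σ' (b : 𝔅.I) (s : Δ.S → (𝔅.A b).carrier) (n : Δ.N → Num (𝔅.A b).carrier)
    (r : RelAssign (𝔅.A b).carrier Δ.R) (j : J b), PLift (Δ.rep b s n r j)
  A b := 𝔅.A b.1
  S := Δ.S
  N := Δ.N
  R := Δ.R
  s b := b.2.1
  n b := b.2.2.1
  r b := b.2.2.2.1

/-- The point of `Δ` underlying a point of `Δ.toBase`. -/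
def Ctx.pt (Δ : Ctx 𝔅 J) (b : Δ.toBase.I) : J b.1 := b.2.2.2.2.1

theorem Ctx.pt_rep (Δ : Ctx 𝔅 J) (b : Δ.toBase.I) :
    Δ.rep b.1 (Δ.toBase.s b) (Δ.toBase.n b) (Δ.toBase.r b) (Δ.pt b) := b.2.2.2.2.2.down

/-- `P` is defined by a formula in the variables of `Δ`. -/
def Def (Δ : Ctx 𝔅 J) (P : ∀ b, J b → Prop) : Prop :=
  ∃ φ : Formula τ Δ.S Δ.N Δ.R, ∀ b s n r j, Δ.rep b s n r j → (φ.Realize s n r ↔ P b j)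

/-- `f` is given by a renaming of variables. -/
def Mor (Δ : Ctx 𝔅 J') (Γ : Ctx 𝔅 J) (f : ∀ b, J' b → J b) : Prop :=
  ∃ (σ : Γ.S → Δ.S) (ν : Γ.N → Δ.N) (ρ : ∀ k l, Γ.R k l → Δ.R k l), ∀ b s n r j,
    Δ.rep b s n r j → Γ.rep b (s ∘ σ) (n ∘ ν) (fun k l X => r k l (ρ k l X)) (f b j)

section Closure

variable {Δ : Ctx 𝔅 J} {Γ : Ctx 𝔅 J'} {P Q : ∀ b, J b → Prop}

theorem Def.congr (h : Def Δ P) (e : ∀ b j, P b j ↔ Q b j) : Def Δ Q := by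
  obtain ⟨φ, h⟩ := h
  exact ⟨φ, fun b s n r j hj => (h b s n r j hj).trans (e b j)⟩

theorem Def.not (h : Def Δ P) : Def Δ (fun b j => ¬ P b j) := by
  obtain ⟨φ, h⟩ := h
  exact ⟨.not φ, fun b s n r j hj => not_congr (h b s n r j hj)⟩

theorem Def.and (h : Def Δ P) (h' : Def Δ Q) : Def Δ (fun b j => P b j ∧ Q b j) := by
  obtain ⟨φ, h⟩ := h
  obtain ⟨ψ, h'⟩ := h'
  exact ⟨.and φ ψ, fun b s n r j hj => and_congr (h b s n r j hj) (h' b s n r j hj)⟩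

theorem Def.or (h : Def Δ P) (h' : Def Δ Q) : Def Δ (fun b j => P b j ∨ Q b j) :=
  (h.not.and h'.not).not.congr fun b j => by tauto

theorem Def.imp (h : Def Δ P) (h' : Def Δ Q) : Def Δ (fun b j => P b j → Q b j) :=
  (h.and h'.not).not.congr fun b j => by tauto

theorem Def.iff (h : Def Δ P) (h' : Def Δ Q) : Def Δ (fun b j => P b j ↔ Q b j) :=
  ((h.imp h').and (h'.imp h)).congr fun b j => by tauto

theorem Def.finAll {ι : Type} [Fintype ι] {P : ι → ∀ b, J b → Prop} (h : ∀ i, Def Δ (P i)) :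
    Def Δ (fun b j => ∀ i, P i b j) := by
  choose φ h using h
  obtain ⟨χ, hχ⟩ := Formula.exists_conj φ
  exact ⟨χ, fun b s n r j hj => (hχ _ s n r).trans (forall_congr' fun i => h i b s n r j hj)⟩

theorem Def.finEx {ι : Type} [Fintype ι] {P : ι → ∀ b, J b → Prop} (h : ∀ i, Def Δ (P i)) :
    Def Δ (fun b j => ∃ i, P i b j) :=
  (Def.finAll fun i => (h i).not).not.congr fun b j => by simp

theorem Def.const (p : Prop) : Def Δ (fun _ _ => p) := by
  by_cases hp : p
  · exact (Def.finAll (ι := Fin 0) (P := fun i _ _ => i.elim0) fun i => i.elim0).congr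
      fun b j => by simp [hp]
  · exact (Def.finEx (ι := Fin 0) (P := fun i _ _ => i.elim0) fun i => i.elim0).congr
      fun b j => by simp [hp]

theorem Def.comp {P : ∀ b, J' b → Prop} {f : ∀ b, J b → J' b} (h : Def Γ P) (hf : Mor Δ Γ f) :
    Def Δ (fun b j => P b (f b j)) := by
  obtain ⟨φ, h⟩ := h
  obtain ⟨σ, ν, ρ, hf⟩ := hf
  exact ⟨φ.rename σ ν ρ, fun b s n r j hj =>
    (φ.realize_rename σ ν ρ s n r).trans (h _ _ _ _ _ (hf b s n r j hj))⟩

theorem Mor.comp {Θ : Ctx 𝔅 J''} {f : ∀ b, J b → J' b} {g : ∀ b, J' b → J'' b}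
    (hg : Mor Γ Θ g) (hf : Mor Δ Γ f) : Mor Δ Θ (fun b j => g b (f b j)) := by
  obtain ⟨σ, ν, ρ, hf⟩ := hf
  obtain ⟨σ', ν', ρ', hg⟩ := hg
  exact ⟨σ ∘ σ', ν ∘ ν', fun k l X => ρ k l (ρ' k l X), fun b s n r j hj =>
    hg _ _ _ _ _ (hf _ _ _ _ _ hj)⟩

theorem Mor.fst (X : 𝔅.I → Type) [Srt 𝔅 X] : Mor (Δ.ext X) Δ (fun _ j => j.1) :=
  ⟨Sum.inl, Sum.inl, fun _ _ X => X, fun _ _ _ _ _ h => h.1⟩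

theorem Mor.fstRel (X : 𝔅.I → Type) [Srt 𝔅 X] : Mor (Δ.extRel X) Δ (fun _ j => j.1) :=
  ⟨id, id, fun _ _ X => .old X, fun _ _ _ _ _ h => h.1⟩

theorem Mor.nil : Mor Δ (Ctx.nil 𝔅) (fun _ _ => ()) :=
  ⟨Δ.inS, Δ.inN, Δ.inR, fun b s n r j h => Δ.compat b s n r j h⟩

theorem Mor.lift {f : ∀ b, J b → J' b} (hf : Mor Δ Γ f) (X : 𝔅.I → Type) [Srt 𝔅 X] :
    Mor (Δ.ext X) (Γ.ext X) (fun b j => (f b j.1, j.2)) := by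
  obtain ⟨σ, ν, ρ, hf⟩ := hf
  exact ⟨Sum.map σ id, Sum.map ν id, ρ, fun b s n r j h => ⟨hf _ _ _ _ _ h.1, h.2⟩⟩

section Sorts

variable {X : 𝔅.I → Type} [Srt 𝔅 X]

/-- Different tuples may represent the same element, so equality is expressed by the kernel formula
and not componentwise. -/
theorem Def.eqVar : Def ((Δ.ext X).ext X) (fun _ j => j.1.2 = j.2) := by
  obtain ⟨κ, h⟩ := Srt.ker (𝔅 := 𝔅) (X := X)
  refine ⟨κ.rename (Sum.elim (fun x => .inl (.inl (Δ.inS x)))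
      (Sum.elim (fun x => .inl (.inr x)) .inr))
    (Sum.elim (fun x => .inl (.inl (Δ.inN x))) (Sum.elim (fun x => .inl (.inr x)) .inr))
    Δ.inR, fun b s n r j hj => ?_⟩
  obtain ⟨⟨hj, h₁⟩, h₂⟩ := hj
  obtain ⟨hs, hn, hr⟩ := Δ.compat _ _ _ _ _ hj
  have hs' : s ∘ (Sum.elim (fun x => .inl (.inl (Δ.inS x)))
      (Sum.elim (fun x => .inl (.inr x)) .inr)) = Sum.elim (𝔅.s b)
        (Sum.elim ((s ∘ Sum.inl) ∘ Sum.inr) (s ∘ Sum.inr)) := by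
    rw [← hs]; ext (x | x | x) <;> rfl
  have hn' : n ∘ (Sum.elim (fun x => .inl (.inl (Δ.inN x)))
      (Sum.elim (fun x => .inl (.inr x)) .inr)) = Sum.elim (𝔅.n b)
        (Sum.elim ((n ∘ Sum.inl) ∘ Sum.inr) (n ∘ Sum.inr)) := by
    rw [← hn]; funext x; rcases x with (x | x | x) <;> rfl
  rw [Formula.realize_rename, hs', hn', hr, h]
  constructor
  · rintro ⟨x, hx, hx'⟩
    exact (Srt.func h₁ hx).trans (Srt.func h₂ hx').symm
  · intro e
    exact ⟨j.2, e ▸ h₁, h₂⟩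

/-- The kernel formula on the diagonal: a tuple represents something iff it represents the same
element as itself. -/
theorem Def.exists_dom (Δ : Ctx 𝔅 J) (X : 𝔅.I → Type) [Srt 𝔅 X] :
    ∃ δ : Formula τ (Δ.S ⊕ Srt.K (𝔅 := 𝔅) X) (Δ.N ⊕ Srt.L (𝔅 := 𝔅) X) Δ.R, ∀ b s n r j, Δ.rep b s n r j →
      ∀ t u, δ.Realize (Sum.elim s t) (Sum.elim n u) r ↔ ∃ x : X b, Srt.rep b t u x := by
  obtain ⟨κ, h⟩ := Srt.ker (𝔅 := 𝔅) (X := X)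
  refine ⟨κ.rename (Sum.elim (fun x => .inl (Δ.inS x)) (Sum.elim .inr .inr))
    (Sum.elim (fun x => .inl (Δ.inN x)) (Sum.elim .inr .inr)) Δ.inR,
    fun b s n r j hj t u => ?_⟩
  obtain ⟨hs, hn, hr⟩ := Δ.compat _ _ _ _ _ hj
  have hs' : Sum.elim s t ∘ (Sum.elim (fun x => .inl (Δ.inS x)) (Sum.elim .inr .inr)) =
      Sum.elim (𝔅.s b) (Sum.elim t t) := by
    rw [← hs]; ext (x | x | x) <;> rfl
  have hn' : Sum.elim n u ∘ (Sum.elim (fun x => .inl (Δ.inN x)) (Sum.elim .inr .inr)) =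
      Sum.elim (𝔅.n b) (Sum.elim u u) := by
    rw [← hn]; funext x; rcases x with (x | x | x) <;> rfl
  rw [Formula.realize_rename, hs', hn', hr, h]
  simp

theorem Def.ex {P : ∀ b, J b → X b → Prop} (h : Def (Δ.ext X) (fun b j => P b j.1 j.2)) :
    Def Δ (fun b j => ∃ x : X b, P b j x) := by
  obtain ⟨φ, h⟩ := h
  obtain ⟨δ, hδ⟩ := Def.exists_dom Δ X
  refine ⟨(Formula.and δ φ).exT, fun b s n r j hj => ?_⟩
  rw [Formula.realize_exT]
  constructor
  · rintro ⟨t, u, h₁, h₂⟩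
    obtain ⟨x, hx⟩ := (hδ b s n r j hj t u).1 h₁
    exact ⟨x, (h b (Sum.elim s t) (Sum.elim n u) r (j, x) ⟨hj, hx⟩).1 h₂⟩
  · rintro ⟨x, hx⟩
    obtain ⟨t, u, hr⟩ := Srt.surj (𝔅 := 𝔅) b x
    exact ⟨t, u, (hδ b s n r j hj t u).2 ⟨x, hr⟩, (h b (Sum.elim s t) (Sum.elim n u) r (j, x) ⟨hj, hr⟩).2 hx⟩

theorem Def.all {P : ∀ b, J b → X b → Prop} (h : Def (Δ.ext X) (fun b j => P b j.1 j.2)) :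
    Def Δ (fun b j => ∀ x : X b, P b j x) :=
  (Def.ex (P := fun b j x => ¬ P b j x) h.not).not.congr fun b j => by simp

/-- `a` is a definable function. -/
def Term (Δ : Ctx 𝔅 J) {X : 𝔅.I → Type} [Srt 𝔅 X] (a : ∀ b, J b → X b) : Prop :=
  Def (Δ.ext X) (fun b j => j.2 = a b j.1)

theorem Term.graph {a : ∀ b, J b → X b} (ha : Term Δ a) :
    Def (Δ.ext X) (fun b j => j.2 = a b j.1) := ha

/-- There are no function symbols; a definable value is substituted by quantifying over the unique
element that equals it. -/
theorem Def.inst {P : ∀ b, J b × X b → Prop} {a : ∀ b, J b → X b} (h : Def (Δ.ext X) P)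
    (ha : Term Δ a) : Def Δ (fun b j => P b (j, a b j)) :=
  (Def.ex (P := fun b j x => x = a b j ∧ P b (j, x)) (Def.and ha h)).congr fun b j => by simp

theorem Term.comp {a : ∀ b, J' b → X b} {f : ∀ b, J b → J' b} (ha : Term Γ a) (hf : Mor Δ Γ f) :
    Term Δ (fun b j => a b (f b j)) :=
  Def.comp ha (hf.lift X)

section

variable {Y Z W : 𝔅.I → Type} [Srt 𝔅 Y] [Srt 𝔅 Z] [Srt 𝔅 W] {a : ∀ b, J b → X b}

theorem Term.w (ha : Term Δ a) : Term (Δ.ext Y) (fun b j => a b j.1) := ha.comp (Mor.fst Y)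

theorem Term.wR (ha : Term Δ a) : Term (Δ.extRel Y) (fun b j => a b j.1) :=
  ha.comp (Mor.fstRel Y)

theorem Term.var0 : Term (Δ.ext X) (fun _ j => j.2) :=
  Def.eqVar.congr fun _ _ => eq_comm

theorem Term.var1 : Term ((Δ.ext X).ext Y) (fun _ j => j.1.2) := Term.var0.w

theorem Term.var2 : Term (((Δ.ext X).ext Y).ext Z) (fun _ j => j.1.1.2) := Term.var1.w

theorem Term.var3 : Term ((((Δ.ext X).ext Y).ext Z).ext W) (fun _ j => j.1.1.1.2) := Term.var2.w

end

theorem Def.eq {a a' : ∀ b, J b → X b} (ha : Term Δ a) (ha' : Term Δ a') :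
    Def Δ (fun b j => a b j = a' b j) :=
  (Def.inst (P := fun b j => j.2 = a' b j.1) ha' ha).congr fun _ _ => Iff.rfl

theorem Term.eq {a a' : ∀ b, J b → X b} (ha : Term Δ a) (ha' : Term Δ a') :
    Def Δ (fun b j => a b j = a' b j) :=
  Def.eq ha ha'

/-- `Q` is a definable set. -/
def SetTerm (Δ : Ctx 𝔅 J) {X : 𝔅.I → Type} [Srt 𝔅 X] (Q : ∀ b, J b → Set (X b)) : Prop :=
  Def (Δ.ext X) (fun b j => j.2 ∈ Q b j.1)

theorem Def.mem {Q : ∀ b, J b → Set (X b)} {a : ∀ b, J b → X b} (hQ : SetTerm Δ Q)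
    (ha : Term Δ a) : Def Δ (fun b j => a b j ∈ Q b j) :=
  Def.inst (P := fun b j => j.2 ∈ Q b j.1) hQ ha

theorem SetTerm.w {Y : 𝔅.I → Type} [Srt 𝔅 Y] {Q : ∀ b, J b → Set (X b)} (hQ : SetTerm Δ Q) :
    SetTerm (Δ.ext Y) (fun b j => Q b j.1) :=
  Def.comp (Γ := Δ.ext X) (P := fun b j => j.2 ∈ Q b j.1) hQ ((Mor.fst Y).lift X)

theorem SetTerm.wR {Y : 𝔅.I → Type} [Srt 𝔅 Y] {Q : ∀ b, J b → Set (X b)} (hQ : SetTerm Δ Q) :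
    SetTerm (Δ.extRel Y) (fun b j => Q b j.1) :=
  Def.comp (Γ := Δ.ext X) (P := fun b j => j.2 ∈ Q b j.1) hQ ((Mor.fstRel Y).lift X)

theorem SetTerm.var : SetTerm (Δ.extRel X) (fun _ j => j.2) := by
  refine ⟨.app .new (fun i => .inr ((Fintype.equivFin _).symm i))
    (fun i => .inr ((Fintype.equivFin _).symm i)), fun b s n r j hj => ?_⟩
  obtain ⟨⟨-, h₁⟩, h₂⟩ := hj
  simp only [Formula.Realize]
  rw [h₁]
  have e₁ : (fun i => s (.inr ((Fintype.equivFin (Srt.K (𝔅 := 𝔅) X)).symm i))) ∘ Fintype.equivFin _ =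
    s ∘ Sum.inr := by funext i; simp
  have e₂ : (fun i => n (.inr ((Fintype.equivFin (Srt.L (𝔅 := 𝔅) X)).symm i))) ∘ Fintype.equivFin _ =
    n ∘ Sum.inr := by funext i; simp
  constructor
  · rintro ⟨x, hx, hr⟩
    rw [e₁, e₂] at hr
    rwa [Srt.func h₂ hr]
  · intro hx
    refine ⟨j.2, hx, ?_⟩
    rw [e₁, e₂]
    exact h₂

end Sorts

end Closure

/-! ### Inflationary fixed points -/

/-- The stages correspond under `g` one by one. It is applied with `g` sending a set of elements to
the set of tuples representing them. -/
theorem inflFix_map {T T' : Type} (g : Set T' → Set T) (h₀ : g ∅ = ∅)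
    (hU : ∀ P Q, g (P ∪ Q) = g P ∪ g Q) (hI : ∀ P : ℕ → Set T', g (⋃ i, P i) = ⋃ i, g (P i))
    (F : Set T → Set T) (F' : Set T' → Set T') (hF : ∀ P, F (g P) = g (F' P)) :
    inflFix F = g (inflFix F') := by
  rw [inflFix, inflFix, hI]
  refine Set.iUnion_congr fun i => ?_
  induction i with
  | zero => exact h₀.symm
  | succ i ih => rw [inflStage, inflStage, hU, ih, hF]

theorem inflStage_mono {T : Type} (F : Set T → Set T) : Monotone (inflStage F) :=
  monotone_nat_of_le_succ fun _ => Set.subset_union_left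

theorem exists_inflFix_eq_stage {T : Type} [Finite T] (F : Set T → Set T) :
    ∃ m, inflFix F = inflStage F m ∧ inflStage F m = inflStage F (m + 1) := by
  obtain ⟨m, hm⟩ := WellFoundedGT.monotone_chain_condition ⟨_, inflStage_mono F⟩
  have := hm (m + 1) (Nat.le_succ m)
  exact ⟨m, inflFix_eq F m this, this⟩

theorem apply_inflFix_subset {T : Type} [Finite T] (F : Set T → Set T) :
    F (inflFix F) ⊆ inflFix F := by
  obtain ⟨m, h, h'⟩ := exists_inflFix_eq_stage F
  rw [h]
  conv_rhs => rw [h']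
  exact Set.subset_union_right

theorem inflFix_subset {T : Type} (F : Set T → Set T) (Q : Set T)
    (h : ∀ P ⊆ Q, F P ⊆ Q) : inflFix F ⊆ Q := by
  refine Set.iUnion_subset fun i => ?_
  induction i with
  | zero => exact Set.empty_subset _
  | succ i ih => exact Set.union_subset ih (h _ ih)

/-- The syntactic fixed point runs over tuples. Each of its stages consists of all tuples
representing the elements of the corresponding stage of `F`, so the two limits correspond. -/
theorem Def.ifp {Δ : Ctx 𝔅 J} {X : 𝔅.I → Type} [Srt 𝔅 X] {F : ∀ b, J b → Set (X b) → Set (X b)}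
    (h : Def ((Δ.extRel X).ext X) (fun b j => j.2 ∈ F b j.1.1 j.1.2)) :
    SetTerm Δ (fun b j => inflFix (F b j)) := by
  obtain ⟨φ, h⟩ := h
  obtain ⟨δ, hδ⟩ := Def.exists_dom (Δ.extRel X) X
  let eK := Fintype.equivFin (Srt.K (𝔅 := 𝔅) X)
  let eL := Fintype.equivFin (Srt.L (𝔅 := 𝔅) X)
  -- The conjunct `δ` keeps out tuples that represent nothing; on these `φ` is uncontrolled.
  let χ := (Formula.and δ φ).rename (Sum.map id eK) (Sum.map id eL) fun _ _ X => X
  refine ⟨.ifp (χ.rename (Sum.map Sum.inl id) (Sum.map Sum.inl id) fun _ _ X => X)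
    (fun i => .inr (eK.symm i)) (fun i => .inr (eL.symm i)), fun b s n r j hj => ?_⟩
  obtain ⟨h₁, h₂⟩ := hj
  have e₁ : (fun i => s (.inr (eK.symm i))) ∘ eK = s ∘ Sum.inr := by funext i; simp
  have e₂ : (fun i => n (.inr (eL.symm i))) ∘ eL = n ∘ Sum.inr := by funext i; simp
  have key := inflFix_map (T' := X b) (Srt.pullSet (X := X))
    (by ext; simp [Srt.pullSet]) (by intros; ext; simp [Srt.pullSet, or_and_right, exists_or])
    (by intros; ext; simp only [Srt.pullSet, Set.mem_iUnion, Set.mem_ofPred_eq]; tauto)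
    (fun P => {a | (χ.rename (Sum.map Sum.inl id) (Sum.map Sum.inl id) fun _ _ X => X).Realize
      (Sum.elim s a.1) (Sum.elim n a.2) (RelAssign.cons r P)}) (F b j.1) (by
      intro P
      ext a
      simp only [Formula.realize_rename, χ, Sum.elim_comp_map, Function.comp_id, Set.mem_ofPred_eq]
      have hrep : (Δ.extRel X).rep b (s ∘ Sum.inl) (n ∘ Sum.inl)
        (RelAssign.cons r (Srt.pullSet P)) (j.1, P) := ⟨h₁, rfl⟩
      simp only [Formula.Realize]
      constructor
      · rintro ⟨ha, ha'⟩
        obtain ⟨x, hx⟩ := (hδ b _ _ _ _ hrep _ _).1 ha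
        exact ⟨x, (h b (Sum.elim (s ∘ Sum.inl) (a.1 ∘ eK)) (Sum.elim (n ∘ Sum.inl) (a.2 ∘ eL)) _
          ((j.1, P), x) ⟨hrep, hx⟩).1 ha', hx⟩
      · rintro ⟨x, hx, hx'⟩
        exact ⟨(hδ b _ _ _ _ hrep _ _).2 ⟨x, hx'⟩, (h b (Sum.elim (s ∘ Sum.inl) (a.1 ∘ eK))
          (Sum.elim (n ∘ Sum.inl) (a.2 ∘ eL)) _ ((j.1, P), x) ⟨hrep, hx'⟩).2 hx⟩)
  simp only [Formula.Realize]
  rw [key]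
  constructor
  · rintro ⟨x, hx, hr⟩
    rw [e₁, e₂] at hr
    rwa [Srt.func h₂ hr]
  · intro hx
    refine ⟨j.2, hx, ?_⟩
    rw [e₁, e₂]
    exact h₂

/-! ### Change of base -/

section Rebase

variable {Δ : Ctx 𝔅 J}

/-- A presented set may depend only on the base point. If a set depends on variables of `Δ`, those
variables are first turned into constants of the base `Δ.toBase`; this lemma brings the resulting
formula back. -/
theorem Def.of_toBase {P : ∀ b, J b → Prop}
    (h : Def (Ctx.nil Δ.toBase) (fun b _ => P b.1 (Δ.pt b))) : Def Δ P := by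
  obtain ⟨φ, h⟩ := h
  exact ⟨φ, fun b s n r j hj => h ⟨b, s, n, r, j, ⟨hj⟩⟩ s n r () ⟨rfl, rfl, rfl⟩⟩

/-- A presentation over `𝔅` is one over `Δ.toBase`. -/
abbrev Srt.toBase (Δ : Ctx 𝔅 J) (X : 𝔅.I → Type) [Srt 𝔅 X] : Srt Δ.toBase (fun b => X b.1) where
  K := Srt.K (𝔅 := 𝔅) X
  L := Srt.L (𝔅 := 𝔅) X
  rep b := Srt.rep b.1
  func := Srt.func
  surj b := Srt.surj b.1
  ker := by
    obtain ⟨κ, h⟩ := Srt.ker (𝔅 := 𝔅) (X := X)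
    refine ⟨κ.rename (Sum.map Δ.inS id) (Sum.map Δ.inN id) Δ.inR, fun b t u t' u' => ?_⟩
    obtain ⟨hs, hn, hr⟩ := Δ.compat _ _ _ _ _ (Δ.pt_rep b)
    rw [Formula.realize_rename, Sum.elim_comp_map, Sum.elim_comp_map, hs, hn, hr, ← h]
    rfl

theorem Def.toBase_ext {X : 𝔅.I → Type} [Srt 𝔅 X] {P : ∀ b, J b × X b → Prop}
    (h : Def (Δ.ext X) P) {J' : Δ.toBase.I → Type} (Γ : Ctx Δ.toBase J') :
    @Def _ Δ.toBase _ (@Ctx.ext _ _ _ Γ (fun b => X b.1) (Srt.toBase Δ X))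
      (fun b j => P b.1 (Δ.pt b, j.2)) := by
  let := Srt.toBase Δ X
  have : Def ((Ctx.nil Δ.toBase).ext (fun b => X b.1)) (fun b j => P b.1 (Δ.pt b, j.2)) := by
    obtain ⟨φ, h⟩ := h
    refine ⟨φ, fun b s n r j hj => ?_⟩
    obtain ⟨⟨h₁, h₂, rfl⟩, h'⟩ := hj
    refine h b.1 s n _ (Δ.pt b, j.2) ⟨?_, h'⟩
    simp only [h₁, h₂]
    exact Δ.pt_rep b
  exact this.comp (Mor.nil.lift _)

theorem Term.toBase {X : 𝔅.I → Type} [Srt 𝔅 X] {a : ∀ b, J b → X b}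
    (h : Term Δ a) {J' : Δ.toBase.I → Type} (Γ : Ctx Δ.toBase J') :
    @Term _ Δ.toBase _ Γ (fun b => X b.1) (Srt.toBase Δ X) (fun b _ => a b.1 (Δ.pt b)) :=
  Def.toBase_ext (P := fun b j => j.2 = a b j.1) h Γ

theorem SetTerm.toBase {X : 𝔅.I → Type} [Srt 𝔅 X] {Q : ∀ b, J b → Set (X b)}
    (h : SetTerm Δ Q) {J' : Δ.toBase.I → Type} (Γ : Ctx Δ.toBase J') :
    @SetTerm _ Δ.toBase _ Γ (fun b => X b.1) (Srt.toBase Δ X) (fun b _ => Q b.1 (Δ.pt b)) :=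
  Def.toBase_ext (P := fun b j => j.2 ∈ Q b j.1) h Γ

end Rebase

end

/-! ### Definable functions, numbers and arithmetic. -/

section

variable {τ : FirstOrder.Language.{0, 0}} {𝔅 : Base τ} {J J' J'' : 𝔅.I → Type}

/-! ### Basic presentations -/

instance Srt.univ (𝔅 : Base τ) : Srt 𝔅 (fun b => (𝔅.A b).carrier) where
  K := Unit
  L := Empty
  rep _ t _ x := t () = x
  func h h' := h.symm.trans h'
  surj _ x := ⟨fun _ => x, Empty.elim, rfl⟩
  ker := ⟨.eq (.inr (.inl ())) (.inr (.inr ())), fun b t u t' u' => by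
    simp [Formula.Realize, eq_comm]⟩

instance Srt.num (𝔅 : Base τ) : Srt 𝔅 (fun b => Num (𝔅.A b).carrier) where
  K := Empty
  L := Unit
  rep _ _ u x := u () = x
  func h h' := h.symm.trans h'
  surj _ x := ⟨Empty.elim, fun _ => x, rfl⟩
  ker := ⟨.and (.le (.inr (.inl ())) (.inr (.inr ()))) (.le (.inr (.inr ())) (.inr (.inl ()))),
    fun b t u t' u' => by
      simp only [Formula.Realize, Sum.elim_inr, Sum.elim_inl, ← le_antisymm_iff]
      exact ⟨fun h => ⟨_, rfl, h.symm⟩, fun ⟨_, h, h'⟩ => h.trans h'.symm⟩⟩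

instance Srt.prod {X Y : 𝔅.I → Type} [Srt 𝔅 X] [Srt 𝔅 Y] : Srt 𝔅 (fun b => X b × Y b) where
  K := Srt.K (𝔅 := 𝔅) X ⊕ Srt.K (𝔅 := 𝔅) Y
  L := Srt.L (𝔅 := 𝔅) X ⊕ Srt.L (𝔅 := 𝔅) Y
  rep b t u x := Srt.rep b (t ∘ Sum.inl) (u ∘ Sum.inl) x.1 ∧
    Srt.rep b (t ∘ Sum.inr) (u ∘ Sum.inr) x.2
  func h h' := Prod.ext (Srt.func h.1 h'.1) (Srt.func h.2 h'.2)
  surj b x := by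
    obtain ⟨t, u, h⟩ := Srt.surj (𝔅 := 𝔅) b x.1
    obtain ⟨t', u', h'⟩ := Srt.surj (𝔅 := 𝔅) b x.2
    exact ⟨Sum.elim t t', Sum.elim u u', h, h'⟩
  ker := by
    obtain ⟨κ, h⟩ := Srt.ker (𝔅 := 𝔅) (X := X)
    obtain ⟨κ', h'⟩ := Srt.ker (𝔅 := 𝔅) (X := Y)
    refine ⟨.and (κ.rename (Sum.map id (Sum.map Sum.inl Sum.inl))
      (Sum.map id (Sum.map Sum.inl Sum.inl)) fun _ _ X => X)
      (κ'.rename (Sum.map id (Sum.map Sum.inr Sum.inr))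
      (Sum.map id (Sum.map Sum.inr Sum.inr)) fun _ _ X => X), fun b t u t' u' => ?_⟩
    simp only [Formula.Realize, Formula.realize_rename, Sum.elim_comp_map, Function.comp_id, h, h']
    constructor
    · rintro ⟨⟨x, h₁, h₂⟩, y, h₃, h₄⟩
      exact ⟨(x, y), ⟨h₁, h₃⟩, h₂, h₄⟩
    · rintro ⟨x, ⟨h₁, h₃⟩, h₂, h₄⟩
      exact ⟨⟨_, h₁, h₂⟩, _, h₃, h₄⟩

instance Srt.pow {ι : Type} [Fintype ι] {X : 𝔅.I → Type} [Srt 𝔅 X] :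
    Srt 𝔅 (fun b => ι → X b) where
  K := ι × Srt.K (𝔅 := 𝔅) X
  L := ι × Srt.L (𝔅 := 𝔅) X
  rep b t u x := ∀ i, Srt.rep b (fun k => t (i, k)) (fun l => u (i, l)) (x i)
  func h h' := funext fun i => Srt.func (h i) (h' i)
  surj b x := by
    choose t u h using fun i => Srt.surj (𝔅 := 𝔅) b (x i)
    exact ⟨fun p => t p.1 p.2, fun p => u p.1 p.2, h⟩
  ker := by
    obtain ⟨κ, h⟩ := Srt.ker (𝔅 := 𝔅) (X := X)
    obtain ⟨χ, hχ⟩ := Formula.exists_conj fun i : ι =>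
      κ.rename (Sum.map id (Sum.map (Prod.mk i) (Prod.mk i)))
        (Sum.map id (Sum.map (Prod.mk i) (Prod.mk i))) fun _ _ X => X
    refine ⟨χ, fun b t u t' u' => ?_⟩
    rw [hχ]
    simp only [Formula.realize_rename, Sum.elim_comp_map, Function.comp_id, h]
    constructor
    · intro H
      choose x hx using H
      exact ⟨x, fun i => (hx i).1, fun i => (hx i).2⟩
    · rintro ⟨x, h₁, h₂⟩ i
      exact ⟨x i, h₁ i, h₂ i⟩

/-- Presentations in which every element has only one representation. -/
class RawSrt (𝔅 : Base τ) (X : 𝔅.I → Type) [Srt 𝔅 X] : Prop where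
  uniq : ∀ {b t u t' u'} {x : X b}, Srt.rep b t u x → Srt.rep b t' u' x → t = t' ∧ u = u'

instance : RawSrt 𝔅 (fun b => (𝔅.A b).carrier) where
  uniq h h' := ⟨funext fun _ => Eq.trans h (Eq.symm h'), funext fun i => i.elim⟩

instance : RawSrt 𝔅 (fun b => Num (𝔅.A b).carrier) where
  uniq h h' := ⟨funext fun i => i.elim, funext fun _ => Eq.trans h (Eq.symm h')⟩

instance {X Y : 𝔅.I → Type} [Srt 𝔅 X] [Srt 𝔅 Y] [RawSrt 𝔅 X] [RawSrt 𝔅 Y] :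
    RawSrt 𝔅 (fun b => X b × Y b) where
  uniq {b t u t' u' x} h h' := by
    obtain ⟨h₁, h₂⟩ := RawSrt.uniq h.1 h'.1
    obtain ⟨h₃, h₄⟩ := RawSrt.uniq h.2 h'.2
    constructor
    · funext i
      rcases i with i | i
      exacts [congrFun h₁ i, congrFun h₃ i]
    · funext i
      rcases i with i | i
      exacts [congrFun h₂ i, congrFun h₄ i]

instance {ι : Type} [Fintype ι] {X : 𝔅.I → Type} [Srt 𝔅 X] [RawSrt 𝔅 X] :
    RawSrt 𝔅 (fun b => ι → X b) where
  uniq {b t u t' u' x} h h' :=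
    ⟨funext fun p => congrFun (RawSrt.uniq (h p.1) (h' p.1)).1 p.2,
      funext fun p => congrFun (RawSrt.uniq (h p.1) (h' p.1)).2 p.2⟩

/-! ### Definable functions into products -/

section Terms

variable {Δ : Ctx 𝔅 J} {X Y Z : 𝔅.I → Type} [Srt 𝔅 X] [Srt 𝔅 Y] [Srt 𝔅 Z]

theorem Def.inst₂ {P : ∀ b, (J b × X b) × Y b → Prop} {a : ∀ b, J b → X b} {c : ∀ b, J b → Y b}
    (h : Def ((Δ.ext X).ext Y) P) (ha : Term Δ a) (hc : Term Δ c) :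
    Def Δ (fun b j => P b ((j, a b j), c b j)) :=
  Def.inst (Def.inst h hc.w) ha

theorem Term.inst {f : ∀ b, J b × Z b → X b} {a : ∀ b, J b → Z b} (hf : Term (Δ.ext Z) f)
    (ha : Term Δ a) : Term Δ (fun b j => f b (j, a b j)) := by
  have hm : Mor ((Δ.ext X).ext Z) ((Δ.ext Z).ext X) (fun b j => ((j.1.1, j.2), j.1.2)) :=
    ⟨Sum.elim (Sum.elim (fun x => .inl (.inl x)) .inr) (fun x => .inl (.inr x)),
      Sum.elim (Sum.elim (fun x => .inl (.inl x)) .inr) (fun x => .inl (.inr x)),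
      fun _ _ X => X, fun b s n r j h => ⟨⟨h.1.1, h.2⟩, h.1.2⟩⟩
  exact Def.inst (hf.graph.comp hm) ha.w

theorem Mor.extFst : Mor (Δ.ext (fun b => X b × Y b)) (Δ.ext X) (fun _ j => (j.1, j.2.1)) :=
  ⟨Sum.map id Sum.inl, Sum.map id Sum.inl, fun _ _ X => X, fun _ _ _ _ _ h => ⟨h.1, h.2.1⟩⟩

theorem Mor.extSnd : Mor (Δ.ext (fun b => X b × Y b)) (Δ.ext Y) (fun _ j => (j.1, j.2.2)) :=
  ⟨Sum.map id Sum.inr, Sum.map id Sum.inr, fun _ _ X => X, fun _ _ _ _ _ h => ⟨h.1, h.2.2⟩⟩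

theorem Term.pair {a : ∀ b, J b → X b} {c : ∀ b, J b → Y b} (ha : Term Δ a) (hc : Term Δ c) :
    Term Δ (fun b j => (a b j, c b j)) :=
  (Def.and (ha.graph.comp Mor.extFst)
    (hc.graph.comp Mor.extSnd)).congr fun b j => by
      rw [Prod.ext_iff]

theorem Term.fst {a : ∀ b, J b → X b × Y b} (ha : Term Δ a) : Term Δ (fun b j => (a b j).1) :=
  Term.inst (f := fun b (j : J b × X b × Y b) => j.2.1)
    (Term.comp (Γ := Δ.ext X) Term.var0 Mor.extFst) ha

theorem Term.snd {a : ∀ b, J b → X b × Y b} (ha : Term Δ a) : Term Δ (fun b j => (a b j).2) :=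
  Term.inst (f := fun b (j : J b × X b × Y b) => j.2.2)
    (Term.comp (Γ := Δ.ext Y) Term.var0 Mor.extSnd) ha

variable {ι : Type} [Fintype ι]

theorem Mor.extProj (i : ι) :
    Mor (Δ.ext (fun b => ι → X b)) (Δ.ext X) (fun _ j => (j.1, j.2 i)) :=
  ⟨Sum.map id (Prod.mk i), Sum.map id (Prod.mk i), fun _ _ X => X,
    fun _ _ _ _ _ h => ⟨h.1, h.2 i⟩⟩

theorem Term.proj {a : ∀ b, J b → ι → X b} (ha : Term Δ a) (i : ι) :
    Term Δ (fun b j => a b j i) :=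
  Term.inst (f := fun b (j : J b × (ι → X b)) => j.2 i)
    (Term.comp (Γ := Δ.ext X) Term.var0 (Mor.extProj i)) ha

theorem Term.pi {a : ∀ b, J b → ι → X b} (ha : ∀ i, Term Δ (fun b j => a b j i)) : Term Δ a :=
  (Def.finAll fun i => (ha i).graph.comp
    (Mor.extProj i)).congr fun b j => by rw [funext_iff]

/-! ### Atomic relations -/

theorem Def.rel {n : ℕ} (P : τ.Relations n) {a : ∀ b, J b → Fin n → (𝔅.A b).carrier}
    (ha : ∀ i, Term Δ (fun b j => a b j i)) :
    Def Δ (fun b j => Structure.RelMap P (a b j)) := by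
  have : Def (Δ.ext (fun b => Fin n → (𝔅.A b).carrier)) (fun b j => Structure.RelMap P j.2) := by
    refine ⟨.rel P fun i => .inr (i, ()), fun b s n r j h => ?_⟩
    have := funext h.2
    simp only [Formula.Realize]
    rw [← this]
    rfl
  exact Def.inst this (Term.pi ha)

variable {p q : ∀ b, J b → Num (𝔅.A b).carrier}

theorem Def.le (hp : Term Δ p) (hq : Term Δ q) : Def Δ (fun b j => p b j ≤ q b j) := by
  have : Def ((Δ.ext (fun b => Num (𝔅.A b).carrier)).ext (fun b => Num (𝔅.A b).carrier))
      (fun b j => j.1.2 ≤ j.2) := by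
    refine ⟨.le (.inl (.inr ())) (.inr ()), fun b s n r j h => ?_⟩
    simp only [Formula.Realize]
    rw [← h.2, ← h.1.2]
    rfl
  exact Def.inst₂ this hp hq

theorem Def.lt (hp : Term Δ p) (hq : Term Δ q) : Def Δ (fun b j => p b j < q b j) :=
  (Def.le hq hp).not.congr fun _ _ => not_le

theorem Term.zero : Term Δ (fun b _ => (0 : Num (𝔅.A b).carrier)) :=
  (Def.all (P := fun b j x => j.2 ≤ x) (Def.le Term.var1 Term.var0)).congr fun b j =>
    ⟨fun h => le_antisymm (h 0) (Fin.zero_le _), fun h x => h ▸ Fin.zero_le x⟩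

theorem Term.last : Term Δ (fun b _ => Fin.last (Nat.card (𝔅.A b).carrier)) :=
  (Def.all (P := fun b j x => x ≤ j.2) (Def.le Term.var0 Term.var1)).congr fun b j =>
    ⟨fun h => le_antisymm (Fin.le_last _) (h _), fun h x => h ▸ Fin.le_last x⟩

end Terms

/-! ### Tuples of numbers as numbers -/

section NumVal

variable {A : Type}

theorem numVal_eq {m : ℕ} (p : Fin m → Num A) : numVal A p = (finFunctionFinEquiv p : ℕ) := by
  rw [finFunctionFinEquiv_apply]
  rfl

theorem numVal_lt {m : ℕ} (p : Fin m → Num A) : numVal A p < (Nat.card A + 1) ^ m := by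
  rw [numVal_eq]
  exact (finFunctionFinEquiv p).isLt

theorem numVal_injective {m : ℕ} : Function.Injective (numVal A (m := m)) := by
  intro p q h
  rw [numVal_eq, numVal_eq] at h
  exact finFunctionFinEquiv.injective (Fin.ext h)

theorem exists_numVal {m N : ℕ} (h : N < (Nat.card A + 1) ^ m) :
    ∃ p : Fin m → Num A, numVal A p = N :=
  ⟨finFunctionFinEquiv.symm ⟨N, h⟩, by rw [numVal_eq, Equiv.apply_symm_apply]⟩

theorem ncard_numVal_lt {m N : ℕ} (h : N ≤ (Nat.card A + 1) ^ m) :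
    Set.ncard {p : Fin m → Num A | numVal A p < N} = N := by
  rw [← Set.ncard_image_of_injective _ numVal_injective]
  have : numVal A '' {p : Fin m → Num A | numVal A p < N} = ↑(Finset.range N) := by
    ext x
    simp only [Set.mem_image, Set.mem_ofPred_eq, Finset.coe_range, Set.mem_Iio]
    constructor
    · rintro ⟨p, hp, rfl⟩
      exact hp
    · intro hx
      obtain ⟨p, rfl⟩ := exists_numVal (hx.trans_le h)
      exact ⟨p, hx, rfl⟩
  rw [this, Set.ncard_coe_finset, Finset.card_range]

theorem numVal_castSucc {m : ℕ} (p : Fin (m + 1) → Num A) : numVal A p =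
    numVal A (fun i => p i.castSucc) + p (Fin.last m) * (Nat.card A + 1) ^ m := by
  simp [numVal, Fin.sum_univ_castSucc]

theorem numVal_lt_of_colex {m : ℕ} (p q : Fin m → Num A) (i : Fin m) (h : p i < q i)
    (h' : ∀ k, i < k → p k = q k) : numVal A p < numVal A q := by
  induction m with
  | zero => exact i.elim0
  | succ m ih =>
    rw [numVal_castSucc, numVal_castSucc]
    induction i using Fin.lastCases with
    | last =>
      have h₁ := numVal_lt fun i => p (Fin.castSucc i)
      have h₂ : ((p (Fin.last m) : ℕ) + 1) * (Nat.card A + 1) ^ m ≤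
        q (Fin.last m) * (Nat.card A + 1) ^ m := Nat.mul_le_mul_right _ h
      rw [add_mul] at h₂
      omega
    | cast i =>
      rw [h' _ (Fin.castSucc_lt_last i)]
      exact Nat.add_lt_add_right (ih _ _ i h fun k hk => h' _ hk) _

/-- The components are digits in base `|A| + 1` with the most significant one last, so the last
difference decides. This makes the order of coded numbers first-order definable from `≤`. -/
theorem numVal_lt_iff {m : ℕ} (p q : Fin m → Num A) :
    numVal A p < numVal A q ↔ ∃ i, p i < q i ∧ ∀ k, i < k → p k = q k := by
  constructor
  · intro h
    have hne : (Finset.univ.filter fun i => p i ≠ q i).Nonempty := by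
      by_contra h'
      rw [Finset.not_nonempty_iff_eq_empty, Finset.filter_eq_empty_iff] at h'
      exact h.ne (congrArg _ (funext fun i => not_not.1 (h' (Finset.mem_univ i))))
    obtain ⟨i, hi, hmax⟩ := Finset.exists_max_image _ id hne
    have hmax' : ∀ k, i < k → p k = q k := fun k hk => by
      by_contra hne
      exact absurd (hmax k (by simpa using hne)) (not_le.2 hk)
    rcases lt_trichotomy (p i) (q i) with h₁ | h₁ | h₁
    · exact ⟨i, h₁, hmax'⟩
    · exact absurd h₁ (Finset.mem_filter.1 hi).2
    · exact absurd (numVal_lt_of_colex q p i h₁ fun k hk => (hmax' k hk).symm) h.asymm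
  · rintro ⟨i, h, h'⟩
    exact numVal_lt_of_colex p q i h h'

end NumVal

theorem Def.numVal_lt {Δ : Ctx 𝔅 J} {m : ℕ} {p q : ∀ b, J b → Fin m → Num (𝔅.A b).carrier}
    (hp : Term Δ p) (hq : Term Δ q) : Def Δ (fun b j => numVal _ (p b j) < numVal _ (q b j)) :=
  (Def.finEx fun i => ((Def.lt (hp.proj i) (hq.proj i)).and (Def.finAll fun k =>
    (Def.const (i < k)).imp ((hp.proj k).eq (hq.proj k))))).congr
      fun b j => (numVal_lt_iff _ _).symm

/-! ### Definable numbers -/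

/-- Counting tuples indexed by arbitrary finite types. -/
noncomputable def Formula.countT {S N K L : Type} {R : ℕ → ℕ → Type} [Fintype K] [Fintype L]
    (φ : Formula τ (S ⊕ K) (N ⊕ L) R) {m : ℕ} (p : Fin m → N) : Formula τ S N R :=
  .count (φ.rename (Sum.map id (Fintype.equivFin K)) (Sum.map id (Fintype.equivFin L))
    fun _ _ X => X) p

theorem Formula.realize_countT {A : Type} [τ.Structure A] {S N K L : Type} {R : ℕ → ℕ → Type}
    [Fintype K] [Fintype L] (φ : Formula τ (S ⊕ K) (N ⊕ L) R) {m : ℕ} (p : Fin m → N)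
    (s : S → A) (n : N → Num A) (r : RelAssign A R) :
    (φ.countT p).Realize s n r ↔ Set.ncard {t : (K → A) × (L → Num A) |
      φ.Realize (Sum.elim s t.1) (Sum.elim n t.2) r} = numVal A (fun i => n (p i)) := by
  simp only [Formula.countT, Formula.Realize, Formula.realize_rename, Sum.elim_comp_map,
    Function.comp_id]
  let e : Tup A (Fintype.card K) (Fintype.card L) → (K → A) × (L → Num A) :=
    fun t => (t.1 ∘ Fintype.equivFin K, t.2 ∘ Fintype.equivFin L)
  have he : Function.Bijective e := by
    refine Function.bijective_iff_has_inverse.2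
      ⟨fun t => (t.1 ∘ (Fintype.equivFin K).symm, t.2 ∘ (Fintype.equivFin L).symm), ?_, ?_⟩
    · intro t; simp [e, Function.comp_assoc]
    · intro t; simp [e, Function.comp_assoc]
  rw [← Set.ncard_image_of_injective _ he.1]
  have : e '' {a | φ.Realize (Sum.elim s (a.1 ∘ Fintype.equivFin K))
      (Sum.elim n (a.2 ∘ Fintype.equivFin L)) r} =
      {t | φ.Realize (Sum.elim s t.1) (Sum.elim n t.2) r} := by
    ext t
    constructor
    · rintro ⟨a, ha, rfl⟩
      exact ha
    · intro ht
      obtain ⟨a, rfl⟩ := he.2 t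
      exact ⟨a, ht, rfl⟩
  rw [this]

/-- `f` is the number of tuples which satisfy some formula. -/
def NTerm (Δ : Ctx 𝔅 J) (f : ∀ b, J b → ℕ) : Prop :=
  ∃ (K L : Type) (_ : Fintype K) (_ : Fintype L) (ψ : Formula τ (Δ.S ⊕ K) (Δ.N ⊕ L) Δ.R),
    ∀ b s n r j, Δ.rep b s n r j →
      Set.ncard {t : (K → (𝔅.A b).carrier) × (L → Num (𝔅.A b).carrier) |
        ψ.Realize (Sum.elim s t.1) (Sum.elim n t.2) r} = f b j

/-- The points with a representation. -/
def Ctx.Pt (Δ : Ctx 𝔅 J) (b : 𝔅.I) (j : J b) : Prop := ∃ s n r, Δ.rep b s n r j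

theorem Def.congr' {Δ : Ctx 𝔅 J} {P Q : ∀ b, J b → Prop} (h : Def Δ P)
    (e : ∀ b j, Δ.Pt b j → (P b j ↔ Q b j)) : Def Δ Q := by
  obtain ⟨φ, h⟩ := h
  exact ⟨φ, fun b s n r j hj => (h b s n r j hj).trans (e b j ⟨s, n, r, hj⟩)⟩

section NTerm

variable {Δ : Ctx 𝔅 J} {Γ : Ctx 𝔅 J'} {f g : ∀ b, J b → ℕ} {X Y : 𝔅.I → Type} [Srt 𝔅 X] [Srt 𝔅 Y]

theorem NTerm.congr' (h : NTerm Δ f) (e : ∀ b j, Δ.Pt b j → f b j = g b j) : NTerm Δ g := by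
  obtain ⟨K, L, _, _, ψ, h⟩ := h
  exact ⟨K, L, ‹_›, ‹_›, ψ, fun b s n r j hj => (h b s n r j hj).trans (e b j ⟨s, n, r, hj⟩)⟩

theorem NTerm.congr (h : NTerm Δ f) (e : ∀ b j, f b j = g b j) : NTerm Δ g :=
  h.congr' fun b j _ => e b j

theorem NTerm.comp {f : ∀ b, J' b → ℕ} {g : ∀ b, J b → J' b} (h : NTerm Γ f) (hg : Mor Δ Γ g) :
    NTerm Δ (fun b j => f b (g b j)) := by
  obtain ⟨K, L, _, _, ψ, h⟩ := h
  obtain ⟨σ, ν, ρ, hg⟩ := hg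
  refine ⟨K, L, ‹_›, ‹_›, ψ.rename (Sum.map σ id) (Sum.map ν id) ρ, fun b s n r j hj => ?_⟩
  simp only [Formula.realize_rename, Sum.elim_comp_map, Function.comp_id]
  exact h _ _ _ _ _ (hg _ _ _ _ _ hj)

theorem NTerm.w (h : NTerm Δ f) : NTerm (Δ.ext X) (fun b j => f b j.1) := h.comp (Mor.fst X)

/-- A polynomial bound in `|A|`, so that every definable number can be named by a tuple of numbers
of fixed length. -/
theorem NTerm.exists_bound (h : NTerm Δ f) :
    ∃ m, ∀ b j, Δ.Pt b j → f b j < (Nat.card (𝔅.A b).carrier + 1) ^ m := by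
  obtain ⟨K, L, _, _, ψ, h⟩ := h
  -- One digit for each counted variable, and one more to make the inequality strict.
  refine ⟨Fintype.card K + Fintype.card L + 1, fun b j ⟨s, n, r, hj⟩ => ?_⟩
  rw [← h b s n r j hj]
  have hA : 0 < Nat.card (𝔅.A b).carrier := Nat.card_pos
  calc _ ≤ Nat.card ((K → (𝔅.A b).carrier) × (L → Num (𝔅.A b).carrier)) := by
        rw [← Set.ncard_univ]
        exact Set.ncard_le_ncard (Set.subset_univ _) (Set.toFinite _)
    _ = Nat.card (𝔅.A b).carrier ^ Fintype.card K *
        (Nat.card (𝔅.A b).carrier + 1) ^ Fintype.card L := by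
        rw [Nat.card_prod, Nat.card_fun, Nat.card_fun]
        simp
    _ ≤ (Nat.card (𝔅.A b).carrier + 1) ^ Fintype.card K *
        (Nat.card (𝔅.A b).carrier + 1) ^ Fintype.card L :=
        Nat.mul_le_mul_right _ (Nat.pow_le_pow_left (Nat.le_succ _) _)
    _ = (Nat.card (𝔅.A b).carrier + 1) ^ (Fintype.card K + Fintype.card L) := (pow_add _ _ _).symm
    _ < _ := Nat.pow_lt_pow_right (by omega) (Nat.lt_succ_self _)

theorem NTerm.val (h : NTerm Δ f) (m : ℕ) :
    Def (Δ.ext (fun b => Fin m → Num (𝔅.A b).carrier)) (fun b j => f b j.1 = numVal _ j.2) := by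
  obtain ⟨K, L, _, _, ψ, h⟩ := h
  refine ⟨(ψ.rename (Sum.map Sum.inl id) (Sum.map Sum.inl id) fun _ _ X => X).countT
    (fun i => .inr (i, ())), fun b s n r j hj => ?_⟩
  rw [Formula.realize_countT]
  simp only [Formula.realize_rename, Sum.elim_comp_map, Function.comp_id]
  rw [h b _ _ _ _ hj.1]
  have : (fun i => n (.inr (i, ()))) = j.2 := funext hj.2
  rw [this]

theorem NTerm.lt_aux (hf : NTerm Δ f) (hg : NTerm Δ g) : ∃ m,
    (∀ b j, Δ.Pt b j → f b j < (Nat.card (𝔅.A b).carrier + 1) ^ m) ∧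
    ∀ b j, Δ.Pt b j → g b j < (Nat.card (𝔅.A b).carrier + 1) ^ m := by
  obtain ⟨m₁, h₁⟩ := hf.exists_bound
  obtain ⟨m₂, h₂⟩ := hg.exists_bound
  exact ⟨max m₁ m₂,
    fun b j h => (h₁ b j h).trans_le (Nat.pow_le_pow_right (Nat.succ_pos _) (le_max_left _ _)),
    fun b j h => (h₂ b j h).trans_le (Nat.pow_le_pow_right (Nat.succ_pos _) (le_max_right _ _))⟩

/-- Both numbers are named by tuples of digits through the counting quantifier, and the tuples are
compared. -/
theorem NTerm.lt (hf : NTerm Δ f) (hg : NTerm Δ g) : Def Δ (fun b j => f b j < g b j) := by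
  obtain ⟨m, h₁, h₂⟩ := hf.lt_aux hg
  refine (Def.ex (X := fun b => Fin m → Num (𝔅.A b).carrier)
    (P := fun b j p => f b j = numVal _ p ∧ ∃ q : Fin m → Num (𝔅.A b).carrier,
      g b j = numVal _ q ∧ numVal _ p < numVal _ q)
    ((hf.val m).and (Def.ex (X := fun b => Fin m → Num (𝔅.A b).carrier)
      (P := fun b (j : J b × (Fin m → Num (𝔅.A b).carrier)) q =>
        g b j.1 = FPC.numVal _ q ∧ FPC.numVal _ j.2 < FPC.numVal _ q)
      ((hg.w.val m).and (Def.numVal_lt Term.var1 Term.var0))))).congr' fun b j hj => ?_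
  constructor
  · rintro ⟨p, hp, q, hq, h⟩
    rwa [hp, hq]
  · intro h
    obtain ⟨p, hp⟩ := exists_numVal (h₁ b j hj)
    obtain ⟨q, hq⟩ := exists_numVal (h₂ b j hj)
    exact ⟨p, hp.symm, q, hq.symm, by rwa [hp, hq]⟩

theorem NTerm.le (hf : NTerm Δ f) (hg : NTerm Δ g) : Def Δ (fun b j => f b j ≤ g b j) :=
  (hg.lt hf).not.congr fun _ _ => not_lt

theorem NTerm.eq (hf : NTerm Δ f) (hg : NTerm Δ g) : Def Δ (fun b j => f b j = g b j) :=
  ((hf.le hg).and (hg.le hf)).congr fun _ _ => le_antisymm_iff.symm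

/-- With unique representations, counting elements is counting tuples. The general case,
`NTerm.ncard`, is reduced to this one. -/
theorem NTerm.ncard_raw [RawSrt 𝔅 X] {P : ∀ b, J b → X b → Prop}
    (h : Def (Δ.ext X) (fun b j => P b j.1 j.2)) :
    NTerm Δ (fun b j => Set.ncard {x : X b | P b j x}) := by
  obtain ⟨φ, h⟩ := h
  obtain ⟨δ, hδ⟩ := Def.exists_dom Δ X
  refine ⟨Srt.K (𝔅 := 𝔅) X, Srt.L (𝔅 := 𝔅) X, inferInstance, inferInstance, .and δ φ, fun b s n r j hj => ?_⟩
  choose t u ht using Srt.surj (𝔅 := 𝔅) (X := X) b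
  have hinj : Function.Injective fun x => (t x, u x) := fun x y hxy => by
    simp only [Prod.mk.injEq] at hxy
    have hx := ht x
    rw [hxy.1, hxy.2] at hx
    exact Srt.func hx (ht y)
  change _ = Set.ncard {x | P b j x}
  rw [← Set.ncard_image_of_injective {x | P b j x} hinj]
  congr 1
  ext a
  constructor
  · rintro ⟨h₁, h₂⟩
    obtain ⟨x, hx⟩ := (hδ b s n r j hj _ _).1 h₁
    refine ⟨x, (h b (Sum.elim s a.1) (Sum.elim n a.2) r (j, x) ⟨hj, hx⟩).1 h₂, ?_⟩
    obtain ⟨e₁, e₂⟩ := RawSrt.uniq (ht x) hx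
    exact Prod.ext e₁ e₂
  · rintro ⟨x, hx, rfl⟩
    exact ⟨(hδ b s n r j hj _ _).2 ⟨x, ht x⟩,
      (h b (Sum.elim s (t x)) (Sum.elim n (u x)) r (j, x) ⟨hj, ht x⟩).2 hx⟩

theorem NTerm.num {p : ∀ b, J b → Num (𝔅.A b).carrier} (hp : Term Δ p) :
    NTerm Δ (fun b j => (p b j : ℕ)) :=
  (NTerm.ncard_raw (X := fun b => Num (𝔅.A b).carrier) (P := fun b j q => q < p b j)
    (Def.lt Term.var0 hp.w)).congr fun b j => by
      have : {q | q < p b j} = ↑(Finset.Iio (p b j)) := by ext; simp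
      rw [this, Set.ncard_coe_finset, Fin.card_Iio]

theorem NTerm.numVal {m : ℕ} {p : ∀ b, J b → Fin m → Num (𝔅.A b).carrier} (hp : Term Δ p) :
    NTerm Δ (fun b j => numVal _ (p b j)) :=
  (NTerm.ncard_raw (X := fun b => Fin m → Num (𝔅.A b).carrier)
    (P := fun b j q => FPC.numVal _ q < FPC.numVal _ (p b j))
    (Def.numVal_lt Term.var0 hp.w)).congr fun b j => ncard_numVal_lt (numVal_lt _).le

/-- A product counts the pairs of codes of numbers below the two factors. -/
theorem NTerm.mul (hf : NTerm Δ f) (hg : NTerm Δ g) : NTerm Δ (fun b j => f b j * g b j) := by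
  obtain ⟨m, h₁, h₂⟩ := hf.lt_aux hg
  refine (NTerm.ncard_raw (X := fun b => (Fin m → Num (𝔅.A b).carrier) ×
    (Fin m → Num (𝔅.A b).carrier)) (P := fun b j p => FPC.numVal _ p.1 < f b j ∧
      FPC.numVal _ p.2 < g b j) (((NTerm.numVal Term.var0.fst).lt hf.w).and
        ((NTerm.numVal Term.var0.snd).lt hg.w))).congr' fun b j hj => ?_
  conv_rhs => rw [← ncard_numVal_lt (A := (𝔅.A b).carrier) (h₁ b j hj).le,
    ← ncard_numVal_lt (A := (𝔅.A b).carrier) (h₂ b j hj).le, ← Set.ncard_prod]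
  rfl

/-- A sum counts a disjoint union. The tags are the least and the greatest number, which differ
because the universe is non-empty. -/
theorem NTerm.add (hf : NTerm Δ f) (hg : NTerm Δ g) : NTerm Δ (fun b j => f b j + g b j) := by
  obtain ⟨m, h₁, h₂⟩ := hf.lt_aux hg
  refine (NTerm.ncard_raw (X := fun b => (Fin m → Num (𝔅.A b).carrier) × Num (𝔅.A b).carrier)
    (P := fun b j p => FPC.numVal _ p.1 < f b j ∧ p.2 = 0 ∨
      FPC.numVal _ p.1 < g b j ∧ p.2 = Fin.last _)
    ((((NTerm.numVal Term.var0.fst).lt hf.w).and (Term.var0.snd.eq Term.zero)).or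
      (((NTerm.numVal Term.var0.fst).lt hg.w).and (Term.var0.snd.eq Term.last)))).congr'
        fun b j hj => ?_
  have hA : 0 < Nat.card (𝔅.A b).carrier := Nat.card_pos
  have hne : (0 : Num (𝔅.A b).carrier) ≠ Fin.last _ := fun h => hA.ne (congrArg Fin.val h)
  have e₁ : f b j = Set.ncard ({p : Fin m → Num (𝔅.A b).carrier | FPC.numVal _ p < f b j} ×ˢ
      ({0} : Set (Num (𝔅.A b).carrier))) := by
    rw [Set.ncard_prod, Set.ncard_singleton, mul_one, ncard_numVal_lt (h₁ b j hj).le]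
  have e₂ : g b j = Set.ncard ({p : Fin m → Num (𝔅.A b).carrier | FPC.numVal _ p < g b j} ×ˢ
      ({Fin.last _} : Set (Num (𝔅.A b).carrier))) := by
    rw [Set.ncard_prod, Set.ncard_singleton, mul_one, ncard_numVal_lt (h₂ b j hj).le]
  conv_rhs => rw [e₁, e₂, ← Set.ncard_union_eq (by
    rw [Set.disjoint_left]
    rintro x ⟨-, hx⟩ ⟨-, hx'⟩
    exact hne (hx.symm.trans hx'))]
  rfl

theorem NTerm.zero : NTerm Δ (fun _ _ => 0) :=
  (NTerm.num Term.zero).congr fun _ _ => rfl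

theorem NTerm.card_univ : NTerm Δ (fun b _ => Nat.card (𝔅.A b).carrier) :=
  (NTerm.num Term.last).congr fun _ _ => rfl

theorem NTerm.one : NTerm Δ (fun _ _ => 1) :=
  (NTerm.ncard_raw (X := fun b => Num (𝔅.A b).carrier) (P := fun b _ q => q = 0)
    (Term.var0.eq Term.zero)).congr fun b j => Set.ncard_singleton _

theorem NTerm.pow (hf : NTerm Δ f) (k : ℕ) : NTerm Δ (fun b j => f b j ^ k) := by
  induction k with
  | zero => exact NTerm.one.congr fun _ _ => (pow_zero _).symm
  | succ k ih => exact (ih.mul hf).congr fun _ _ => (pow_succ _ _).symm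

theorem NTerm.sum {ι : Type} (s : Finset ι) {f : ι → ∀ b, J b → ℕ} (hf : ∀ i, NTerm Δ (f i)) :
    NTerm Δ (fun b j => ∑ i ∈ s, f i b j) := by
  classical
  induction s using Finset.induction_on with
  | empty => exact NTerm.zero.congr fun _ _ => rfl
  | insert i s hi ih =>
    exact ((hf i).add ih).congr fun b j => by rw [Finset.sum_insert hi]

end NTerm

end

/-! ### Cardinalities of presented sets, and translation along interpretations. -/

section

variable {τ : FirstOrder.Language.{0, 0}} {𝔅 : Base τ} {J J' J'' : 𝔅.I → Type}

/-! ### Counting the elements of a presented set -/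

theorem ncard_rel {Q X : Type} [Fintype Q] [Finite X] (R : Q → X → Prop) :
    Set.ncard {p : Q × X | R p.1 p.2} = ∑ q, Set.ncard {x | R q x} := by
  classical
  have e : {p : Q × X // R p.1 p.2} ≃ Σ q, {x // R q x} :=
    { toFun := fun p => ⟨p.1.1, p.1.2, p.2⟩
      invFun := fun p => ⟨(p.1, p.2.1), p.2.2⟩
      left_inv := fun _ => rfl
      right_inv := fun _ => rfl }
  exact (Nat.card_congr e).trans Nat.card_sigma

theorem ncard_eq_of_bij {X Y : Type} {P : X → Prop} {Q : Y → Prop} (R : X → Y → Prop)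
    (h₁ : ∀ x, P x → ∃ y, Q y ∧ R x y) (h₂ : ∀ y, Q y → ∃ x, P x ∧ R x y)
    (h₃ : ∀ x y y', P x → Q y → Q y' → R x y → R x y' → y = y')
    (h₄ : ∀ x x' y, P x → P x' → Q y → R x y → R x' y → x = x') :
    Set.ncard {x | P x} = Set.ncard {y | Q y} := by
  choose f hf using h₁
  exact Set.ncard_congr f (fun a ha => (hf a ha).1)
    (fun a a' ha ha' e => h₄ a a' _ ha ha' (hf a ha).1 (hf a ha).2 (e ▸ (hf a' ha').2))
    (fun y hy => by
      obtain ⟨x, hx, hR⟩ := h₂ y hy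
      exact ⟨x, hx, h₃ x _ _ hx (hf x hx).1 hy (hf x hx).2 hR⟩)

/-- The elements are sorted by the size `s` of their fibers. The tuples over elements with fibers of
size `s` number `c * s`, where `c` is the number of such elements; so `c` is obtained by counting
tuples only. The pairs `(s, i)` with `i < c` then count all elements. -/
theorem ncard_eq_ncard_fibers {A T X : Type} [Finite A] [Finite T] [Finite X] (rep : T → X → Prop)
    (func : ∀ t x x', rep t x → rep t x' → x = x') (surj : ∀ x, ∃ t, rep t x) (P : X → Prop)
    {m : ℕ} (hm : Nat.card T < (Nat.card A + 1) ^ m) :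
    Set.ncard {q : (Fin m → Num A) × (Fin m → Num A) | 1 ≤ numVal A q.1 ∧
      ∃ c : Fin m → Num A, numVal A q.2 < numVal A c ∧ numVal A c * numVal A q.1 =
        Set.ncard {t | ∃ x, rep t x ∧ P x ∧ Set.ncard {t' | rep t' x} = numVal A q.1}} =
      Set.ncard {x | P x} := by
  classical
  have := Fintype.ofFinite X
  have hT : ∀ Q : T → Prop, Set.ncard {t | Q t} ≤ Nat.card T := fun Q => by
    rw [← Set.ncard_univ]
    exact Set.ncard_le_ncard (Set.subset_univ _) (Set.toFinite _)
  have fib_pos : ∀ x, 1 ≤ Set.ncard {t | rep t x} := fun x => by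
    obtain ⟨t, ht⟩ := surj x
    exact (Set.ncard_pos (Set.toFinite _)).2 ⟨t, ht⟩
  have hN : ∀ s, Set.ncard {t | ∃ x, rep t x ∧ P x ∧ Set.ncard {t' | rep t' x} = s} =
      Set.ncard {x | P x ∧ Set.ncard {t' | rep t' x} = s} * s := by
    intro s
    have h₁ : Set.ncard {t | ∃ x, rep t x ∧ P x ∧ Set.ncard {t' | rep t' x} = s} =
        Set.ncard {p : X × T | (P p.1 ∧ Set.ncard {t' | rep t' p.1} = s) ∧ rep p.2 p.1} := by
      refine ncard_eq_of_bij (fun t p => p.2 = t) ?_ ?_ ?_ ?_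
      · rintro t ⟨x, h, h', h''⟩
        exact ⟨(x, t), ⟨⟨h', h''⟩, h⟩, rfl⟩
      · rintro ⟨x, t⟩ ⟨⟨h, h'⟩, h''⟩
        exact ⟨t, ⟨x, h'', h, h'⟩, rfl⟩
      · rintro t ⟨x, _⟩ ⟨x', _⟩ - h h' rfl rfl
        exact Prod.ext (func _ _ _ h.2 h'.2) rfl
      · rintro t t' _ - - - rfl rfl
        rfl
    rw [h₁, ncard_rel fun x t => (P x ∧ Set.ncard {t' | rep t' x} = s) ∧ rep t x]
    have h₂ : ∀ x, Set.ncard {t | (P x ∧ Set.ncard {t' | rep t' x} = s) ∧ rep t x} =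
        if P x ∧ Set.ncard {t' | rep t' x} = s then s else 0 := by
      intro x
      split_ifs with h
      · simp only [h, true_and, and_self]
      · simp [h]
    simp only [h₂]
    rw [← Finset.sum_filter, Finset.sum_const, smul_eq_mul, ← Set.ncard_coe_finset]
    simp
  have hF : ∀ q : Fin m → Num A, Set.ncard {i : Fin m → Num A | 1 ≤ numVal A q ∧
      ∃ c : Fin m → Num A, numVal A i < numVal A c ∧ numVal A c * numVal A q =
        Set.ncard {t | ∃ x, rep t x ∧ P x ∧ Set.ncard {t' | rep t' x} = numVal A q}} =
      Set.ncard {x | P x ∧ Set.ncard {t' | rep t' x} = numVal A q} := by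
    intro q
    rcases Nat.eq_zero_or_pos (numVal A q) with h | h
    · have e₁ : {x | P x ∧ Set.ncard {t' | rep t' x} = numVal A q} = ∅ := by
        ext x
        have := fib_pos x
        simp only [Set.mem_ofPred_eq, Set.mem_empty_iff_false, iff_false, h]
        omega
      rw [e₁]
      simp [h]
    · have hle : Set.ncard {x | P x ∧ Set.ncard {t' | rep t' x} = numVal A q} <
          (Nat.card A + 1) ^ m := by
        refine lt_of_le_of_lt ?_ hm
        refine (Nat.le_mul_of_pos_right _ h).trans ?_
        rw [← hN]
        exact hT _
      conv_rhs => rw [← ncard_numVal_lt (A := A) hle.le]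
      congr 1
      ext i
      simp only [Set.mem_ofPred_eq, hN]
      constructor
      · rintro ⟨-, c, hc, hc'⟩
        rwa [← Nat.eq_of_mul_eq_mul_right h hc']
      · intro hi
        obtain ⟨c, hc⟩ := exists_numVal (A := A) hle
        exact ⟨h, c, hc.symm ▸ hi, by rw [hc]⟩
  rw [ncard_rel fun q i : Fin m → Num A => 1 ≤ numVal A q ∧
      ∃ c : Fin m → Num A, numVal A i < numVal A c ∧ numVal A c * numVal A q =
        Set.ncard {t | ∃ x, rep t x ∧ P x ∧ Set.ncard {t' | rep t' x} = numVal A q}]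
  simp only [hF]
  rw [← ncard_rel fun (q : Fin m → Num A) x => P x ∧ Set.ncard {t' | rep t' x} = numVal A q]
  refine ncard_eq_of_bij (fun p x => p.2 = x) ?_ ?_ ?_ ?_
  · rintro p hp
    exact ⟨_, hp.1, rfl⟩
  · intro x hx
    obtain ⟨q, hq⟩ := exists_numVal (A := A) ((hT fun t => rep t x).trans_lt hm)
    exact ⟨(q, x), ⟨hx, hq.symm⟩, rfl⟩
  · rintro p _ _ - - - rfl rfl
    rfl
  · rintro ⟨q, x⟩ ⟨q', _⟩ _ h h' - rfl rfl
    exact Prod.ext (numVal_injective (h.2.symm.trans h'.2)) rfl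

section Relations

variable {X Y Z : 𝔅.I → Type} [Srt 𝔅 X] [Srt 𝔅 Y] [Srt 𝔅 Z] {Δ : Ctx 𝔅 J}

/-- `f` is a definable family of constants. -/
def DConst (f : ∀ b, X b) : Prop := Term (Ctx.nil 𝔅) (fun b _ => f b)

/-- `R` is a definable family of sets. -/
def DRel₁ (R : ∀ b, X b → Prop) : Prop := Def ((Ctx.nil 𝔅).ext X) (fun b j => R b j.2)

/-- `R` is a definable family of relations. -/
def DRel₂ (R : ∀ b, X b → Y b → Prop) : Prop :=
  Def (((Ctx.nil 𝔅).ext X).ext Y) (fun b j => R b j.1.2 j.2)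

/-- `R` is a definable family of relations. -/
def DRel₃ (R : ∀ b, X b → Y b → Z b → Prop) : Prop :=
  Def ((((Ctx.nil 𝔅).ext X).ext Y).ext Z) (fun b j => R b j.1.1.2 j.1.2 j.2)

variable {x : ∀ b, J b → X b} {y : ∀ b, J b → Y b} {z : ∀ b, J b → Z b}

theorem DConst.term {f : ∀ b, X b} (h : DConst f) : Term Δ (fun b _ => f b) := Term.comp h Mor.nil

theorem DRel₁.app {R : ∀ b, X b → Prop} (h : DRel₁ R) (hx : Term Δ x) :
    Def Δ (fun b j => R b (x b j)) :=
  Def.inst (Def.comp h (Mor.nil.lift X)) hx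

theorem DRel₂.app {R : ∀ b, X b → Y b → Prop} (h : DRel₂ R) (hx : Term Δ x) (hy : Term Δ y) :
    Def Δ (fun b j => R b (x b j) (y b j)) :=
  Def.inst₂ (Def.comp h ((Mor.nil.lift X).lift Y)) hx hy

theorem DRel₃.app {R : ∀ b, X b → Y b → Z b → Prop} (h : DRel₃ R) (hx : Term Δ x)
    (hy : Term Δ y) (hz : Term Δ z) : Def Δ (fun b j => R b (x b j) (y b j) (z b j)) :=
  Def.inst₂ (Def.inst (Def.comp h (((Mor.nil.lift X).lift Y).lift Z)) hz.w.w) hx hy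

end Relations

section Count

variable {Δ : Ctx 𝔅 J} {X : 𝔅.I → Type} [Srt 𝔅 X]

theorem Srt.rep_def : DRel₂ (X := X)
    (Y := fun b => (Srt.K (𝔅 := 𝔅) X → (𝔅.A b).carrier) × (Srt.L (𝔅 := 𝔅) X → Num (𝔅.A b).carrier))
    (fun b x t => Srt.rep b t.1 t.2 x) := by
  obtain ⟨κ, h⟩ := Srt.ker (𝔅 := 𝔅) (X := X)
  refine ⟨κ.rename
    (Sum.elim (fun x => .inl (.inl x))
      (Sum.elim (fun k => .inl (.inr k)) fun k => .inr (.inl (k, ()))))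
    (Sum.elim (fun x => .inl (.inl x))
      (Sum.elim (fun k => .inl (.inr k)) fun k => .inr (.inr (k, ()))))
    fun _ _ X => X, fun b s n r j hj => ?_⟩
  obtain ⟨⟨⟨hs, hn, hr⟩, h₁⟩, h₂, h₃⟩ := hj
  have hs' : s ∘ (Sum.elim (fun x => .inl (.inl x))
      (Sum.elim (fun k => .inl (.inr k)) fun k => .inr (.inl (k, ())))) =
      Sum.elim (𝔅.s b) (Sum.elim ((s ∘ Sum.inl) ∘ Sum.inr) j.2.1) := by
    rw [← hs, ← funext h₂]; ext (x | x | x) <;> rfl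
  have hn' : n ∘ (Sum.elim (fun x => .inl (.inl x))
      (Sum.elim (fun k => .inl (.inr k)) fun k => .inr (.inr (k, ())))) =
      Sum.elim (𝔅.n b) (Sum.elim ((n ∘ Sum.inl) ∘ Sum.inr) j.2.2) := by
    rw [← hn, ← funext h₃]; funext x; rcases x with (x | x | x) <;> rfl
  rw [Formula.realize_rename, hs', hn', hr, h]
  constructor
  · rintro ⟨x, hx, hx'⟩
    exact Srt.func hx h₁ ▸ hx'
  · intro hx
    exact ⟨_, h₁, hx⟩

/-- The right side of `ncard_eq_ncard_fibers` is the wanted cardinality; its left side counts pairs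
of digit tuples, and all cardinalities inside it are counts of tuples, so `NTerm.ncard_raw` applies
throughout. -/
theorem NTerm.ncard {P : ∀ b, J b → X b → Prop} (h : Def (Δ.ext X) (fun b j => P b j.1 j.2)) :
    NTerm Δ (fun b j => Set.ncard {x : X b | P b j x}) := by
  let T : 𝔅.I → Type := fun b =>
    (Srt.K (𝔅 := 𝔅) X → (𝔅.A b).carrier) × (Srt.L (𝔅 := 𝔅) X → Num (𝔅.A b).carrier)
  obtain ⟨m, hm⟩ := (NTerm.ncard_raw (Δ := Δ) (X := T) (P := fun _ _ _ => True)
    (Def.const True)).exists_bound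
  have hT : ∀ (b : 𝔅.I) (j : J b), Δ.Pt b j → Nat.card (T b) < (Nat.card (𝔅.A b).carrier + 1) ^ m :=
    fun b j hj => by
      rw [← Set.ncard_univ]
      exact hm b j hj
  refine (NTerm.ncard_raw (X := fun b => (Fin m → Num (𝔅.A b).carrier) ×
    (Fin m → Num (𝔅.A b).carrier)) (P := fun b j q => 1 ≤ FPC.numVal _ q.1 ∧
      ∃ c : Fin m → Num (𝔅.A b).carrier, FPC.numVal _ q.2 < FPC.numVal _ c ∧
      FPC.numVal _ c * FPC.numVal _ q.1 = Set.ncard {t : T b | ∃ x, Srt.rep b t.1 t.2 x ∧ P b j x ∧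
        Set.ncard {t' : T b | Srt.rep b t'.1 t'.2 x} = FPC.numVal _ q.1}) ?_).congr'
    fun b j hj => ?_
  · refine (NTerm.one.le (NTerm.numVal Term.var0.fst)).and (Def.ex
      ((Def.numVal_lt Term.var1.snd Term.var0).and ?_))
    refine ((NTerm.numVal Term.var0).mul (NTerm.numVal Term.var1.fst)).eq ?_
    refine NTerm.ncard_raw (X := T) (Def.ex (((Srt.rep_def.app Term.var0 Term.var1)).and
      (Def.and ?_ ?_)))
    · exact h.comp ((((Mor.fst _).comp (Mor.fst _)).comp (Mor.fst _)).lift X)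
    · refine NTerm.eq ?_ (NTerm.numVal Term.var3.fst)
      exact NTerm.ncard_raw (X := T) (Srt.rep_def.app Term.var1 Term.var0)
  · have := Srt.finite (𝔅 := 𝔅) X b
    exact ncard_eq_ncard_fibers (fun (t : T b) (x : X b) => Srt.rep b t.1 t.2 x)
      (fun t x x' => Srt.func) (fun x => by
        obtain ⟨t, u, h⟩ := Srt.surj (𝔅 := 𝔅) b x
        exact ⟨(t, u), h⟩) _ (hT b j hj)

end Count

/-! ### Images of presented sets -/

/-- A presentation of the image of `X` under a partial function. -/
abbrev Srt.image {X Y : 𝔅.I → Type} [Srt 𝔅 X] (f : ∀ b, X b → Y b → Prop)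
    (func : ∀ b x y y', f b x y → f b x y' → y = y') (surj : ∀ b y, ∃ x, f b x y)
    (hker : DRel₂ (fun b x x' => ∃ y, f b x y ∧ f b x' y)) : Srt 𝔅 Y where
  K := Srt.K (𝔅 := 𝔅) X
  L := Srt.L (𝔅 := 𝔅) X
  rep b t u y := ∃ x, Srt.rep b t u x ∧ f b x y
  func := by
    rintro b t u y y' ⟨x, hx, h⟩ ⟨x', hx', h'⟩
    rw [Srt.func hx' hx] at h'
    exact func b _ _ _ h h'
  surj b y := by
    obtain ⟨x, hx⟩ := surj b y
    obtain ⟨t, u, h⟩ := Srt.surj (𝔅 := 𝔅) b x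
    exact ⟨t, u, x, h, hx⟩
  ker := by
    obtain ⟨φ, h⟩ := hker
    obtain ⟨δ, hδ⟩ := Def.exists_dom (Ctx.nil 𝔅) X
    refine ⟨.and (φ.rename (Sum.elim (Sum.map id Sum.inl) fun k => .inr (.inr k))
      (Sum.elim (Sum.map id Sum.inl) fun k => .inr (.inr k)) fun _ _ X => X)
      (.and (δ.rename (Sum.map id Sum.inl) (Sum.map id Sum.inl) fun _ _ X => X)
        (δ.rename (Sum.map id Sum.inr) (Sum.map id Sum.inr) fun _ _ X => X)),
      fun b t u t' u' => ?_⟩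
    have hs : Sum.elim (𝔅.s b) (Sum.elim t t') ∘
        (Sum.elim (Sum.map id Sum.inl) fun k => .inr (.inr k)) =
        Sum.elim (Sum.elim (𝔅.s b) t) t' := by
      ext ((x | x) | x) <;> rfl
    have hn : Sum.elim (𝔅.n b) (Sum.elim u u') ∘
        (Sum.elim (Sum.map id Sum.inl) fun k => .inr (.inr k)) =
        Sum.elim (Sum.elim (𝔅.n b) u) u' := by
      funext x
      rcases x with ((x | x) | x) <;> rfl
    have hδ' := hδ b (𝔅.s b) (𝔅.n b) (𝔅.r b) () ⟨rfl, rfl, rfl⟩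
    simp only [Formula.Realize, Formula.realize_rename, hs, hn, Sum.elim_comp_map,
      Function.comp_id, Sum.elim_comp_inl, Sum.elim_comp_inr, hδ']
    constructor
    · rintro ⟨h₀, ⟨x, hx⟩, x', hx'⟩
      obtain ⟨y, hy, hy'⟩ := (h b (Sum.elim (Sum.elim (𝔅.s b) t) t') (Sum.elim (Sum.elim (𝔅.n b) u) u') (𝔅.r b)
        (((), x), x') ⟨⟨⟨rfl, rfl, rfl⟩, hx⟩, hx'⟩).1 h₀
      exact ⟨y, ⟨x, hx, hy⟩, x', hx', hy'⟩
    · rintro ⟨y, ⟨x, hx, hy⟩, x', hx', hy'⟩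
      exact ⟨(h b (Sum.elim (Sum.elim (𝔅.s b) t) t') (Sum.elim (Sum.elim (𝔅.n b) u) u') (𝔅.r b)
        (((), x), x') ⟨⟨⟨rfl, rfl, rfl⟩, hx⟩, hx'⟩).2 ⟨y, hy, hy'⟩,
        ⟨x, hx⟩, x', hx'⟩

/-- An element `y` is given by some preimage `x'`, and `f x y` says that `x` and `x'` have a common
image. That is the relation assumed definable. -/
theorem Srt.image_def {X Y : 𝔅.I → Type} [Srt 𝔅 X] (f : ∀ b, X b → Y b → Prop)
    (func : ∀ b x y y', f b x y → f b x y' → y = y') (surj : ∀ b y, ∃ x, f b x y)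
    (hker : DRel₂ (fun b x x' => ∃ y, f b x y ∧ f b x' y)) :
    letI := Srt.image f func surj hker
    DRel₂ f := by
  obtain ⟨φ, h⟩ := id hker
  refine ⟨φ, fun b s n r j hj => ?_⟩
  obtain ⟨hj₁, x', hx', hy⟩ := hj
  rw [h b s n r (((), j.1.2), x') ⟨hj₁, hx'⟩]
  constructor
  · rintro ⟨y, hy₁, hy₂⟩
    rw [func b _ _ _ hy hy₂]
    exact hy₁
  · exact fun h => ⟨_, h, hy⟩

/-! ### Interpretations -/

section Pull

variable {τ₂ : FirstOrder.Language.{0, 0}} (B : 𝔅.I → FinStruct τ₂)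
  [Srt 𝔅 (fun b => (B b).carrier)]

/-- An interpreted structure can be larger than its host; its numbers are therefore coded by tuples
of host numbers, of one length for the whole family. -/
theorem exists_card_bound : ∃ m, ∀ b, Nat.card (B b).carrier < (Nat.card (𝔅.A b).carrier + 1) ^ m := by
  obtain ⟨m, hm⟩ := (NTerm.ncard (Δ := Ctx.nil 𝔅) (X := fun b => (B b).carrier)
    (P := fun _ _ _ => True) (Def.const True)).exists_bound
  refine ⟨m, fun b => ?_⟩
  rw [← Set.ncard_univ]
  exact hm b () ⟨_, _, _, rfl, rfl, rfl⟩

theorem NTerm.card {Δ : Ctx 𝔅 J} : NTerm Δ (fun b _ => Nat.card (B b).carrier) :=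
  (NTerm.ncard (X := fun b => (B b).carrier) (P := fun _ _ _ => True) (Def.const True)).congr
    fun b _ => Set.ncard_univ _

/-- The presentation of the number sort of an interpreted structure. -/
noncomputable abbrev Srt.numOf : Srt 𝔅 (fun b => Num (B b).carrier) :=
  Srt.image (X := fun b => Fin (exists_card_bound B).choose → Num (𝔅.A b).carrier)
    (fun b p x => numVal _ p = (x : ℕ)) (fun b p x x' h h' => Fin.ext (h.symm.trans h'))
    (fun b x => exists_numVal ((Nat.lt_succ_iff.1 x.isLt).trans_lt
      ((exists_card_bound B).choose_spec b)))
    (Def.congr ((NTerm.eq (NTerm.numVal Term.var1) (NTerm.numVal Term.var0)).and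
      (NTerm.le (NTerm.numVal Term.var0) (NTerm.card B))) fun b j =>
      ⟨fun h => ⟨⟨_, Nat.lt_succ_of_le h.2⟩, h.1, rfl⟩,
        fun ⟨x, h, h'⟩ => ⟨h.trans h'.symm, h'.symm ▸ Nat.lt_succ_iff.1 x.isLt⟩⟩)

theorem NTerm.numOf {Δ : Ctx 𝔅 J} {p : ∀ b, J b → Num (B b).carrier}
    (hp : letI := Srt.numOf B; Term Δ p) : NTerm Δ (fun b j => (p b j : ℕ)) := by
  let := Srt.numOf B
  have hR := Srt.image_def (X := fun b => Fin (exists_card_bound B).choose → Num (𝔅.A b).carrier)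
    (fun b p (x : Num (B b).carrier) => FPC.numVal _ p = (x : ℕ))
    (fun b p x x' h h' => Fin.ext (h.symm.trans h'))
    (fun b x => exists_numVal ((Nat.lt_succ_iff.1 x.isLt).trans_lt
      ((exists_card_bound B).choose_spec b)))
  refine (NTerm.ncard_raw (X := fun b => Fin (exists_card_bound B).choose → Num (𝔅.A b).carrier)
    (P := fun b j q => ∃ p' : Fin (exists_card_bound B).choose → Num (𝔅.A b).carrier,
      FPC.numVal _ p' = (p b j : ℕ) ∧ FPC.numVal _ q < FPC.numVal _ p') (Def.ex (Def.and
        ((hR _).app Term.var0 hp.w.w) (Def.numVal_lt Term.var1 Term.var0)))).congr fun b j => ?_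
  have hlt := (Nat.lt_succ_iff.1 (p b j).isLt).trans_lt ((exists_card_bound B).choose_spec b)
  conv_rhs => rw [← ncard_numVal_lt (A := (𝔅.A b).carrier) hlt.le]
  congr 1
  ext q
  constructor
  · rintro ⟨p', h, h'⟩
    exact h ▸ h'
  · intro h
    obtain ⟨p', hp'⟩ := exists_numVal hlt
    exact ⟨p', hp', by rw [hp']; exact h⟩

variable (hrel : ∀ {n : ℕ} (P : τ₂.Relations n),
  DRel₁ (X := fun b => Fin n → (B b).carrier) fun b x => Structure.RelMap P x)

-- FP+C is closed under interpretations. The induction ranges over all contexts, since every binder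
-- extends the context. Binders over tuples of the interpreted structure become binders over
-- presented sets, counting relies on `NTerm.ncard`, and fixed points on `Def.ifp`.
include hrel in
theorem Formula.pull {S N : Type} {R : ℕ → ℕ → Type} (φ : Formula τ₂ S N R) :
    letI := Srt.numOf B
    ∀ {J : 𝔅.I → Type} (Δ : Ctx 𝔅 J) (s : ∀ b, J b → S → (B b).carrier)
      (n : ∀ b, J b → N → Num (B b).carrier) (r : ∀ b, J b → RelAssign (B b).carrier R),
      (∀ x, Term Δ (fun b j => s b j x)) → (∀ x, Term Δ (fun b j => n b j x)) →
      (∀ k l (X : R k l), SetTerm Δ (X := fun b => Tup (B b).carrier k l)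
        (fun b j => r b j k l X)) →
      Def Δ (fun b j => φ.Realize (s b j) (n b j) (r b j)) := by
  let inst := Srt.numOf B
  have hpair : ∀ {S N : Type} {J : 𝔅.I → Type} {Δ : Ctx 𝔅 J} {s : ∀ b, J b → S → (B b).carrier}
      {n : ∀ b, J b → N → Num (B b).carrier} {k l : ℕ} (x : Fin k → S) (p : Fin l → N),
      (∀ x, Term Δ (fun b j => s b j x)) → (∀ x, Term Δ (fun b j => n b j x)) →
      Term Δ (X := fun b => Tup (B b).carrier k l)
        (fun b j => (fun i => s b j (x i), fun i => n b j (p i))) :=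
    fun x p hs hn => Term.pair (Term.pi fun i => hs (x i)) (Term.pi fun i => hn (p i))
  have hS : ∀ {S : Type} {J : 𝔅.I → Type} {Δ : Ctx 𝔅 J} {s : ∀ b, J b → S → (B b).carrier}
      {k l : ℕ}, (∀ x, Term Δ (fun b j => s b j x)) →
      ∀ x, Term (Δ.ext (fun b => Tup (B b).carrier k l)) (fun b j => Sum.elim (s b j.1) j.2.1 x) := by
    rintro S J Δ s k l hs (x | i)
    · exact (hs x).w
    · exact Term.proj (Term.fst Term.var0) i
  have hN : ∀ {N : Type} {J : 𝔅.I → Type} {Δ : Ctx 𝔅 J} {n : ∀ b, J b → N → Num (B b).carrier}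
      {k l : ℕ}, (∀ x, Term Δ (fun b j => n b j x)) →
      ∀ x, Term (Δ.ext (fun b => Tup (B b).carrier k l)) (fun b j => Sum.elim (n b j.1) j.2.2 x) := by
    rintro N J Δ n k l hn (x | i)
    · exact (hn x).w
    · exact Term.proj (Term.snd Term.var0) i
  induction φ with
  | rel P x =>
    intro J Δ s n r hs hn hr
    exact DRel₁.app (hrel P) (Term.pi fun i => hs (x i))
  | eq x y =>
    intro J Δ s n r hs hn hr
    exact Term.eq (hs x) (hs y)
  | le p q =>
    intro J Δ s n r hs hn hr
    exact NTerm.le (NTerm.numOf B (hn p)) (NTerm.numOf B (hn q))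
  | not φ ih =>
    intro J Δ s n r hs hn hr
    exact (ih Δ s n r hs hn hr).not
  | and φ ψ ih₁ ih₂ =>
    intro J Δ s n r hs hn hr
    exact (ih₁ Δ s n r hs hn hr).and (ih₂ Δ s n r hs hn hr)
  | @ex S N R k l φ ih =>
    intro J Δ s n r hs hn hr
    exact Def.ex (ih (Δ.ext (fun b => Tup (B b).carrier k l))
      (fun b j => Sum.elim (s b j.1) j.2.1)
      (fun b j => Sum.elim (n b j.1) j.2.2) (fun b j => r b j.1) (hS hs) (hN hn)
      fun k l X => (hr k l X).w)
  | @count S N R k l m ψ p ih =>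
    intro J Δ s n r hs hn hr
    refine NTerm.eq (NTerm.ncard (X := fun b => Tup (B b).carrier k l)
      (ih (Δ.ext (fun b => Tup (B b).carrier k l))
      (fun b j => Sum.elim (s b j.1) j.2.1)
      (fun b j => Sum.elim (n b j.1) j.2.2) (fun b j => r b j.1) (hS hs) (hN hn)
      fun k l X => (hr k l X).w)) ?_
    -- The digit base is `|B| + 1`, that of the interpreted structure, so the coded number has to be
    -- recomputed arithmetically.
    exact NTerm.sum _ fun i => (NTerm.numOf B (hn (p i))).mul
      (((NTerm.card B).add NTerm.one).pow _)
  | app X x p =>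
    intro J Δ s n r hs hn hr
    exact Def.mem (hr _ _ X) (hpair x p hs hn)
  | @ifp S N R k l ψ x p ih =>
    intro J Δ s n r hs hn hr
    refine Def.mem (Def.ifp (ih ((Δ.extRel (fun b => Tup (B b).carrier k l)).ext
      (fun b => Tup (B b).carrier k l)) (fun b j => Sum.elim (s b j.1.1) j.2.1)
      (fun b j => Sum.elim (n b j.1.1) j.2.2) (fun b j => (r b j.1.1).cons j.1.2)
      (hS fun x => (hs x).wR) (hN fun x => (hn x).wR) ?_)) (hpair x p hs hn)
    intro k l X
    cases X with
    | new => exact SetTerm.var.w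
    | old X => exact (hr _ _ X).wR.w

end Pull

end

/-! ### Definable iteration, comparison of relations, and ranking. -/

section

variable {τ : FirstOrder.Language.{0, 0}} {𝔅 : Base τ} {J J' J'' : 𝔅.I → Type}

section

variable {Δ : Ctx 𝔅 J} {Γ : Ctx 𝔅 J'} {X Y : 𝔅.I → Type} [Srt 𝔅 X] [Srt 𝔅 Y]

theorem Def.app₂ {P : ∀ b, J b → X b → Y b → Prop}
    (h : Def ((Δ.ext X).ext Y) (fun b j => P b j.1.1 j.1.2 j.2))
    {f : ∀ b, J' b → J b} (hf : Mor Γ Δ f) {x : ∀ b, J' b → X b} {y : ∀ b, J' b → Y b}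
    (hx : Term Γ x) (hy : Term Γ y) : Def Γ (fun b j => P b (f b j) (x b j) (y b j)) :=
  Def.inst₂ (h.comp ((hf.lift X).lift Y)) hx hy

end

/-! ### Generated equivalence relations -/

theorem eqvGen_iff_inflFix {X : Type} [Finite X] (r : X → X → Prop) (x y : X) :
    Relation.EqvGen r x y ↔ (x, y) ∈ inflFix fun Q : Set (X × X) => {p | p.1 = p.2 ∨ r p.1 p.2 ∨
      (p.2, p.1) ∈ Q ∨ ∃ w, (p.1, w) ∈ Q ∧ (w, p.2) ∈ Q} := by
  constructor
  · intro h
    induction h with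
    | rel x y h => exact apply_inflFix_subset _ (Or.inr (Or.inl h))
    | refl x => exact apply_inflFix_subset _ (Or.inl rfl)
    | symm x y _ ih => exact apply_inflFix_subset _ (Or.inr (Or.inr (Or.inl ih)))
    | trans x y z _ _ ih ih' =>
      exact apply_inflFix_subset _ (Or.inr (Or.inr (Or.inr ⟨y, ih, ih'⟩)))
  · intro h
    refine inflFix_subset _ {p | Relation.EqvGen r p.1 p.2} ?_ h
    rintro P hP ⟨x, y⟩ (h | h | h | ⟨w, h, h'⟩)
    · obtain rfl : x = y := h
      exact .refl x
    · exact .rel _ _ h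
    · exact .symm _ _ (hP h)
    · exact .trans x w y (hP h) (hP h')

theorem Def.eqvGen {Δ : Ctx 𝔅 J} {X : 𝔅.I → Type} [Srt 𝔅 X] {r : ∀ b, J b → X b → X b → Prop}
    (h : Def ((Δ.ext X).ext X) (fun b j => r b j.1.1 j.1.2 j.2)) {x y : ∀ b, J b → X b}
    (hx : Term Δ x) (hy : Term Δ y) :
    Def Δ (fun b j => Relation.EqvGen (r b j) (x b j) (y b j)) := by
  have key : SetTerm Δ (X := fun b => X b × X b) (fun b j => inflFix fun Q : Set (X b × X b) =>
      {p | p.1 = p.2 ∨ r b j p.1 p.2 ∨ (p.2, p.1) ∈ Q ∨ ∃ w, (p.1, w) ∈ Q ∧ (w, p.2) ∈ Q}) := by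
    refine Def.ifp (Def.or (Term.var0.fst.eq Term.var0.snd) (Def.or ?_ (Def.or ?_ (Def.ex ?_))))
    · exact Def.app₂ h ((Mor.fstRel _).comp (Mor.fst _)) Term.var0.fst Term.var0.snd
    · exact Def.mem SetTerm.var.w (Term.var0.snd.pair Term.var0.fst)
    · exact (Def.mem SetTerm.var.w.w (Term.var1.fst.pair Term.var0)).and
        (Def.mem SetTerm.var.w.w (Term.var0.pair Term.var1.snd))
  refine (Def.mem key (hx.pair hy)).congr fun b j => ?_
  have := Srt.finite (𝔅 := 𝔅) X b
  exact (eqvGen_iff_inflFix _ _ _).symm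

/-! ### Iteration of definable operators -/

/-- An inflationary fixed point never discards tuples, so the iterates are stored side by side with
their index `i`. The flag `Fin.last n` marks the content of iterate `i`. The flag `0` marks that
iterate `i` has been reached, which cannot be seen from the content, as that may be empty. Iterate
`i + 1` is entered once iterate `i` is marked, and its content is computed in that same round. -/
theorem inflStage_iterate {n : ℕ} (hn : 0 < n) {T : Type} (Φ : Set T → Set T) (m : ℕ) :
    inflStage (fun Q : Set (Fin (n + 1) × Fin (n + 1) × T) => {z |
      (z.1 = 0 ∨ ∃ i : Fin (n + 1), (i : ℕ) + 1 = z.1 ∧ ∀ t, (i, 0, t) ∈ Q) ∧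
      (z.2.1 = 0 ∨ z.2.1 = Fin.last n ∧ ∃ i : Fin (n + 1), (i : ℕ) + 1 = z.1 ∧
        z.2.2 ∈ Φ {t | (i, Fin.last n, t) ∈ Q})}) m =
      {z | (z.1 : ℕ) < m ∧ (z.2.1 = 0 ∨ z.2.1 = Fin.last n ∧ z.2.2 ∈ Φ^[z.1] ∅)} := by
  have h0 : Fin.last n ≠ 0 := fun h => hn.ne' (congrArg Fin.val h)
  induction m with
  | zero => ext z; simp [inflStage]
  | succ m ih =>
    rw [inflStage, ih]
    ext ⟨i, f, t⟩
    have hQ : ∀ i' : Fin (n + 1), (i' : ℕ) < m → {t : T | (i', Fin.last n, t) ∈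
        {z : Fin (n + 1) × Fin (n + 1) × T | (z.1 : ℕ) < m ∧
          (z.2.1 = 0 ∨ z.2.1 = Fin.last n ∧ z.2.2 ∈ Φ^[z.1] ∅)}} = Φ^[i'] ∅ := fun i' hi' => by
      ext t
      simp [hi', h0]
    constructor
    · rintro (⟨h, h'⟩ | ⟨h, h'⟩)
      · exact ⟨Nat.lt_succ_of_lt h, h'⟩
      · have hi : (i : ℕ) < m + 1 := by
          rcases h with h | ⟨i', hi', h⟩
          · rw [show i = 0 from h]; exact Nat.succ_pos m
          · have := (h t).1
            change (i' : ℕ) + 1 = i at hi'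
            change (i' : ℕ) < m at this
            omega
        refine ⟨hi, h'.imp_right ?_⟩
        rintro ⟨hf, i', hi', ht⟩
        refine ⟨hf, ?_⟩
        change (i' : ℕ) + 1 = i at hi'
        rw [hQ i' (by omega)] at ht
        change t ∈ Φ^[i] ∅
        rwa [← hi', Function.iterate_succ_apply']
    · rintro ⟨hi, h⟩
      change (i : ℕ) < m + 1 at hi
      rcases Nat.eq_zero_or_pos (i : ℕ) with h₀ | h₀
      · refine Or.inr ⟨Or.inl (Fin.ext h₀), h.imp_right ?_⟩
        rintro ⟨hf, ht⟩
        change t ∈ Φ^[i] ∅ at ht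
        rw [h₀] at ht
        exact ht.elim
      · have hi' : (i : ℕ) - 1 < n + 1 := by omega
        have hi'' : ((⟨(i : ℕ) - 1, hi'⟩ : Fin (n + 1)) : ℕ) < m := by simp; omega
        have e : (i : ℕ) - 1 + 1 = i := by omega
        refine Or.inr ⟨Or.inr ⟨⟨_, hi'⟩, e, fun t => ⟨hi'', Or.inl rfl⟩⟩, h.imp_right ?_⟩
        rintro ⟨hf, ht⟩
        refine ⟨hf, ⟨_, hi'⟩, e, ?_⟩
        rw [hQ _ hi'']
        change t ∈ Φ^[i] ∅ at ht
        rw [← e, Function.iterate_succ_apply'] at ht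
        exact ht

/-- `Φ` need be neither monotone nor inflationary. Its definability is assumed over every base,
because inside the fixed point it is applied to a set that depends on the relation variable and on
an index. -/
theorem DRel₂.iterate {k l : ℕ}
    (Φ : ∀ A : FinStruct τ, Set (Tup A.carrier k l) → Set (Tup A.carrier k l))
    (hΦ : ∀ (𝔅 : Base τ) (Q : ∀ b, Set (Tup (𝔅.A b).carrier k l)),
      DRel₁ (X := fun b => Tup (𝔅.A b).carrier k l) (fun b t => t ∈ Q b) →
      DRel₁ (X := fun b => Tup (𝔅.A b).carrier k l) (fun b t => t ∈ Φ (𝔅.A b) (Q b)))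
    (𝔅 : Base τ) : DRel₂ (X := fun b => Num (𝔅.A b).carrier)
      (Y := fun b => Tup (𝔅.A b).carrier k l) (fun b i t => t ∈ (Φ (𝔅.A b))^[i] ∅) := by
  have succ : ∀ {J : 𝔅.I → Type} {Δ : Ctx 𝔅 J} {i i' : ∀ b, J b → Num (𝔅.A b).carrier},
      Term Δ i → Term Δ i' → Def Δ (fun b j => (i b j : ℕ) + 1 = i' b j) :=
    fun h h' => ((NTerm.num h).add NTerm.one).eq (NTerm.num h')
  have step : ∀ {J : 𝔅.I → Type} {Δ : Ctx 𝔅 J} {Q : ∀ b, J b → Set (Tup (𝔅.A b).carrier k l)}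
      {t : ∀ b, J b → Tup (𝔅.A b).carrier k l}, SetTerm Δ Q → Term Δ t →
      Def Δ (fun b j => t b j ∈ Φ (𝔅.A b) (Q b j)) := by
    intro J Δ Q t hQ ht
    -- All variables on which `Q` depends become part of the base, where the hypothesis on `Φ`
    -- applies.
    have h₁ := hΦ Δ.toBase (fun b => Q b.1 (Δ.pt b)) (hQ.toBase (Ctx.nil _))
    exact Def.of_toBase (DRel₁.app h₁ (ht.toBase (Ctx.nil _)))
  let Z : 𝔅.I → Type := fun b =>
    Num (𝔅.A b).carrier × Num (𝔅.A b).carrier × Tup (𝔅.A b).carrier k l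
  let F : ∀ b, Set (Z b) → Set (Z b) := fun b Q => {z |
      (z.1 = 0 ∨ ∃ i : Num (𝔅.A b).carrier, (i : ℕ) + 1 = z.1 ∧ ∀ t, (i, 0, t) ∈ Q) ∧
      (z.2.1 = 0 ∨ z.2.1 = Fin.last _ ∧ ∃ i : Num (𝔅.A b).carrier, (i : ℕ) + 1 = z.1 ∧
        z.2.2 ∈ Φ (𝔅.A b) {t | (i, Fin.last _, t) ∈ Q})}
  have key : ∀ {J : 𝔅.I → Type} {Δ : Ctx 𝔅 J}, SetTerm Δ (X := Z) (fun b j => inflFix (F b)) := by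
    intro J Δ
    refine Def.ifp (Def.and (Def.or (Term.var0.fst.eq Term.zero) (Def.ex (Def.and
      (succ Term.var0 Term.var1.fst) (Def.all (Def.mem SetTerm.var.w.w.w
        (Term.var1.pair (Term.zero.pair Term.var0))))))) (Def.or (Term.var0.snd.fst.eq Term.zero)
      (Def.and (Term.var0.snd.fst.eq Term.last) (Def.ex (Def.and
        (succ Term.var0 Term.var1.fst) (step ?_ Term.var1.snd.snd))))))
    exact Def.mem (Δ := ((((Δ.extRel Z).ext Z).ext fun b => Num (𝔅.A b).carrier).ext
      fun b => Tup (𝔅.A b).carrier k l)) (X := Z) (SetTerm.var (Δ := Δ) (X := Z)).w.w.w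
      (Term.var1.pair (Term.last.pair Term.var0))
  refine (Def.mem key (Term.var1.pair (Term.last.pair Term.var0))).congr fun b j => ?_
  have hn : 0 < Nat.card (𝔅.A b).carrier := Nat.card_pos
  have h0 : Fin.last (Nat.card (𝔅.A b).carrier) ≠ 0 := fun h => hn.ne' (congrArg Fin.val h)
  have e := inflStage_iterate hn (Φ (𝔅.A b))
  constructor
  · intro h
    obtain ⟨m, hm⟩ := Set.mem_iUnion.1 h
    exact (((e m).le hm).2.resolve_left h0).2
  · intro h
    exact Set.mem_iUnion.2 ⟨_, (e _).ge ⟨Nat.lt_succ_self _, Or.inr ⟨rfl, h⟩⟩⟩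

/-! ### Comparing binary relations -/

/-- The lexicographic order of binary relations on a linear order. -/
def lexLt {α : Type} [LinearOrder α] (K K' : α → α → Prop) : Prop :=
  ∃ a b, (K' a b ∧ ¬ K a b) ∧ ∀ c d, (c < a ∨ c = a ∧ d < b) → (K c d ↔ K' c d)

theorem Def.lexLt {Δ : Ctx 𝔅 J} {K K' : ∀ b, J b → Num (𝔅.A b).carrier → Num (𝔅.A b).carrier → Prop}
    (h : Def ((Δ.ext (fun b => Num (𝔅.A b).carrier)).ext (fun b => Num (𝔅.A b).carrier))
      (fun b j => K b j.1.1 j.1.2 j.2))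
    (h' : Def ((Δ.ext (fun b => Num (𝔅.A b).carrier)).ext (fun b => Num (𝔅.A b).carrier))
      (fun b j => K' b j.1.1 j.1.2 j.2)) : Def Δ (fun b j => lexLt (K b j) (K' b j)) := by
  have m2 := (Mor.fst (Δ := Δ) (fun b => Num (𝔅.A b).carrier)).comp
    (Mor.fst (fun b => Num (𝔅.A b).carrier))
  have m4 := (m2.comp (Mor.fst (fun b => Num (𝔅.A b).carrier))).comp
    (Mor.fst (fun b => Num (𝔅.A b).carrier))
  exact Def.ex (Def.ex (Def.and (Def.and (h'.app₂ m2 Term.var1 Term.var0)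
    (h.app₂ m2 Term.var1 Term.var0).not) (Def.all (Def.all (Def.imp
      (Def.or (Def.lt Term.var1 Term.var3) (Def.and (Term.var1.eq Term.var3)
        (Def.lt Term.var0 Term.var2)))
      ((h.app₂ m4 Term.var1 Term.var0).iff (h'.app₂ m4 Term.var1 Term.var0)))))))

/-- Binary relations as elements of a linear order. -/
def relToLex {α : Type} (K : α → α → Prop) : Lex (α ×ₗ α → Prop) :=
  toLex fun x => K (ofLex x).1 (ofLex x).2

theorem relToLex_injective {α : Type} : Function.Injective (relToLex (α := α)) := by
  intro K K' h
  funext a b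
  exact congrFun (congrArg ofLex h) (toLex (a, b))

/-- `lexLt` is the form suited to formulas; the other side is a comparison in a linear order (with
`False < True`), from which trichotomy and minima are taken. -/
theorem lexLt_iff {α : Type} [LinearOrder α] [Finite α] (K K' : α → α → Prop) :
    lexLt K K' ↔ relToLex K < relToLex K' := by
  constructor
  · rintro ⟨a, b, ⟨h, h'⟩, h''⟩
    refine ⟨toLex (a, b), fun x hx => propext (h'' _ _ ?_), ?_⟩
    · simpa [Prod.Lex.lt_iff] using hx
    · exact lt_of_le_not_ge (fun hk => absurd hk h') (fun H => h' (H h))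
  · rintro ⟨x, hx, hx'⟩
    have : ¬ (K' (ofLex x).1 (ofLex x).2 → K (ofLex x).1 (ofLex x).2) := hx'.not_ge
    rw [Classical.not_imp] at this
    refine ⟨(ofLex x).1, (ofLex x).2, this, fun c d hcd => ?_⟩
    have := hx (toLex (c, d)) (by simpa [Prod.Lex.lt_iff] using hcd)
    exact iff_of_eq this

/-! ### Transferring structures to the numbers -/

/-- The image of `ρ` on `D` under the ranking function of `lt`. -/
def rankRel {Y : Type} (D : Y → Prop) (lt ρ : Y → Y → Prop) (p q : ℕ) : Prop :=
  ∃ y y', (D y ∧ D y') ∧ (Set.ncard {z | D z ∧ lt z y} = p ∧ Set.ncard {z | D z ∧ lt z y'} = q) ∧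
    ρ y y'

/-- The rank of an element is a cardinality, so counting moves a definably ordered structure onto
numbers. -/
theorem DRel₂.rankRel {Y : 𝔅.I → Type} [Srt 𝔅 Y] {D : ∀ b, Y b → Prop}
    {lt ρ : ∀ b, Y b → Y b → Prop} (hD : DRel₁ D) (hlt : DRel₂ lt) (hρ : DRel₂ ρ) :
    DRel₂ (X := fun b => Num (𝔅.A b).carrier) (Y := fun b => Num (𝔅.A b).carrier)
      (fun b p q => rankRel (D b) (lt b) (ρ b) p q) :=
  Def.ex (Def.ex (Def.and (Def.and (hD.app Term.var1) (hD.app Term.var0)) (Def.and (Def.and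
    (NTerm.eq (NTerm.ncard (Def.and (hD.app Term.var0) (hlt.app Term.var0 Term.var2)))
      (NTerm.num Term.var3))
    (NTerm.eq (NTerm.ncard (Def.and (hD.app Term.var0) (hlt.app Term.var0 Term.var1)))
      (NTerm.num Term.var2))) (hρ.app Term.var1 Term.var0))))

end

/-! ### Modular decomposition, and codes composed from codes of the children. -/

section

/-! ### Modular decomposition -/

section Modules

variable {V : Type} (G : SimpleGraph V) (W : Set V)

/-- The equivalence relation whose classes are the components of `G[W]`, and the single vertices
outside `W`. -/
def compRel : V → V → Prop := Relation.EqvGen fun y z => y ∈ W ∧ z ∈ W ∧ G.Adj y z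

/-- `G[W]` is connected. -/
def ConnOn : Prop := ∀ y ∈ W, ∀ z ∈ W, compRel G W y z

/-- `M` is a module of `G[W]`, possibly empty. -/
def IsModOn (M : Set V) : Prop :=
  M ⊆ W ∧ ∀ v ∈ W, v ∉ M → ∀ u ∈ M, ∀ u' ∈ M, (G.Adj v u ↔ G.Adj v u')

/-- The smallest module of `G[W]` which contains `x` and `y`. -/
def moduleSpan (x y : V) : Set V :=
  inflFix fun Q => {z | z = x ∨ z = y ∨ z ∈ W ∧ ∃ u u', (u ∈ Q ∧ u' ∈ Q) ∧ G.Adj z u ∧ ¬ G.Adj z u'}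

/-- The equivalence relation whose classes are the children of `W` in the modular decomposition,
and the single vertices outside `W`. -/
def childRel (x y : V) : Prop :=
  x = y ∨ (x ∈ W ∧ y ∈ W) ∧
    ((¬ ConnOn G W ∧ compRel G W x y) ∨
      (ConnOn G W ∧ ¬ ConnOn Gᶜ W) ∧ compRel Gᶜ W x y ∨
      (ConnOn G W ∧ ConnOn Gᶜ W) ∧ ¬ W ⊆ moduleSpan G W x y)

variable {G W}

theorem ConnOn.exists_cross (h : ConnOn G W) {B : Set V} {a b : V} (hb : b ∈ W) (hbB : b ∈ B)
    (ha : a ∈ W) (haB : a ∉ B) : ∃ u ∈ W, ∃ v ∈ W, u ∈ B ∧ v ∉ B ∧ G.Adj u v := by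
  by_contra! hno
  have : ∀ x y, compRel G W x y → (x ∈ B ↔ y ∈ B) := by
    intro x y hxy
    induction hxy with
    | rel x y h =>
      constructor
      · intro hx
        by_contra hy
        exact hno x h.1 y h.2.1 hx hy h.2.2
      · intro hy
        by_contra hx
        exact hno y h.2.1 x h.1 hy hx h.2.2.symm
    | refl x => rfl
    | symm x y _ ih => exact ih.symm
    | trans x y z _ _ ih ih' => exact ih.trans ih'
  exact haB ((this b a (h b hb a ha)).1 hbB)

/-- Connectedness of `G[W]` puts an edge across every cut of `W`, and that of the complement puts a
non-edge across it. -/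
theorem ConnOn.not_uniform (h : ConnOn G W) (h' : ConnOn Gᶜ W) {B : Set V} {a b : V} (hb : b ∈ W)
    (hbB : b ∈ B) (ha : a ∈ W) (haB : a ∉ B) (ε : Prop)
    (hε : ∀ u ∈ W, ∀ v ∈ W, u ∈ B → v ∉ B → (G.Adj u v ↔ ε)) : False := by
  obtain ⟨u, hu, v, hv, huB, hvB, huv⟩ := h.exists_cross hb hbB ha haB
  obtain ⟨u', hu', v', hv', huB', hvB', huv'⟩ := h'.exists_cross hb hbB ha haB
  exact ((SimpleGraph.compl_adj _ _ _).1 huv').2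
    ((hε u' hu' v' hv' huB' hvB').2 ((hε u hu v hv huB hvB).1 huv))

theorem compRel_equivalence : Equivalence (compRel G W) := Relation.EqvGen.is_equivalence _

section Span

variable {x y z : V}

/-- A vertex of `W` that distinguishes two elements of a module belongs to that module, so the
module absorbs every stage of the closure. -/
theorem moduleSpan_subset {M : Set V} (hM : IsModOn G W M) (hx : x ∈ M) (hy : y ∈ M) :
    moduleSpan G W x y ⊆ M := by
  refine inflFix_subset _ _ ?_
  rintro P hP z (rfl | rfl | ⟨hz, u, u', ⟨hu, hu'⟩, h, h'⟩)
  · exact hx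
  · exact hy
  · by_contra hzM
    exact h' ((hM.2 z hz hzM u (hP hu) u' (hP hu')).1 h)

variable [Finite V]

theorem left_mem_moduleSpan : x ∈ moduleSpan G W x y := apply_inflFix_subset _ (Or.inl rfl)

theorem right_mem_moduleSpan : y ∈ moduleSpan G W x y :=
  apply_inflFix_subset _ (Or.inr (Or.inl rfl))

theorem isModOn_moduleSpan (hx : x ∈ W) (hy : y ∈ W) : IsModOn G W (moduleSpan G W x y) := by
  refine ⟨moduleSpan_subset ⟨subset_rfl, fun v hv hv' => (hv' hv).elim⟩ hx hy, ?_⟩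
  have : ∀ v ∈ W, v ∉ moduleSpan G W x y → ∀ u ∈ moduleSpan G W x y, ∀ u' ∈ moduleSpan G W x y,
      G.Adj v u → G.Adj v u' := by
    intro v hv hv' u hu u' hu' h
    by_contra h'
    exact hv' (apply_inflFix_subset _ (Or.inr (Or.inr ⟨hv, u, u', ⟨hu, hu'⟩, h, h'⟩)))
  exact fun v hv hv' u hu u' hu' => ⟨this v hv hv' u hu u' hu', this v hv hv' u' hu' u hu⟩

theorem IsModOn.union {M M' : Set V} (h : IsModOn G W M) (h' : IsModOn G W M') (hy : y ∈ M)
    (hy' : y ∈ M') : IsModOn G W (M ∪ M') := by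
  refine ⟨Set.union_subset h.1 h'.1, fun v hv hvM => ?_⟩
  have : ∀ u ∈ M ∪ M', (G.Adj v u ↔ G.Adj v y) := by
    rintro u (hu | hu)
    · exact h.2 v hv (fun hm => hvM (Or.inl hm)) u hu y hy
    · exact h'.2 v hv (fun hm => hvM (Or.inr hm)) u hu y hy'
  exact fun u hu u' hu' => (this u hu).trans (this u' hu').symm

/-- Suppose `M ∪ M'` covers `W`, with `b ∉ M` and `a ∉ M'`. For `u ∈ W` outside `M` and `v ∈ M`, the
pair `u, v` behaves like `u, a` since `M` is a module, and hence like `b, a` since `M'` is one. The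
cut between `M` and the rest is then uniform, against `ConnOn.not_uniform`. -/
theorem IsModOn.union_proper {M M' : Set V} (hc : ConnOn G W) (hc' : ConnOn Gᶜ W)
    (h : IsModOn G W M) (h' : IsModOn G W M') (hM : ¬ W ⊆ M) (hM' : ¬ W ⊆ M') : ¬ W ⊆ M ∪ M' := by
  intro hU
  obtain ⟨b, hb, hbM⟩ := Set.not_subset.1 hM
  obtain ⟨a, ha, haM'⟩ := Set.not_subset.1 hM'
  have haM : a ∈ M := (hU ha).resolve_right haM'
  refine hc.not_uniform hc' (B := Mᶜ) hb hbM ha (not_not.2 haM) (G.Adj b a)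
    fun u hu v hv huM hvM => ?_
  have hvM : v ∈ M := not_not.1 hvM
  have huM' : u ∈ M' := (hU hu).resolve_left huM
  rw [h.2 u hu huM v hvM a haM, G.adj_comm, h'.2 a ha haM' u huM' b ((hU hb).resolve_left hbM),
    G.adj_comm]

/-- Only transitivity in the case of two connected graphs has content: the spans of `x, y` and of
`y, z` share `y`, so their union is a proper module containing the span of `x, z`. -/
theorem childRel_equivalence : Equivalence (childRel G W) := by
  refine ⟨fun x => Or.inl rfl, ?_, ?_⟩
  · rintro x y (rfl | ⟨⟨hx, hy⟩, h⟩)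
    · exact Or.inl rfl
    · refine Or.inr ⟨⟨hy, hx⟩, h.imp (And.imp_right compRel_equivalence.symm) (Or.imp
        (And.imp_right compRel_equivalence.symm) (And.imp_right fun h' hs => h' (hs.trans ?_)))⟩
      exact moduleSpan_subset (isModOn_moduleSpan hx hy) right_mem_moduleSpan left_mem_moduleSpan
  · rintro x y z (rfl | ⟨⟨hx, hy⟩, h⟩) (rfl | ⟨⟨hy', hz⟩, h'⟩)
    · exact Or.inl rfl
    · exact Or.inr ⟨⟨hy', hz⟩, h'⟩
    · exact Or.inr ⟨⟨hx, hy⟩, h⟩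
    · refine Or.inr ⟨⟨hx, hz⟩, ?_⟩
      rcases h with ⟨hc, h⟩ | ⟨hc, h⟩ | ⟨hc, h⟩
      · rcases h' with ⟨-, h'⟩ | ⟨hc', -⟩ | ⟨hc', -⟩
        · exact Or.inl ⟨hc, compRel_equivalence.trans h h'⟩
        · exact (hc hc'.1).elim
        · exact (hc hc'.1).elim
      · rcases h' with ⟨hc', -⟩ | ⟨hc', h'⟩ | ⟨hc', -⟩
        · exact (hc' hc.1).elim
        · exact Or.inr (Or.inl ⟨hc, compRel_equivalence.trans h h'⟩)
        · exact (hc.2 hc'.2).elim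
      · rcases h' with ⟨hc', -⟩ | ⟨hc', -⟩ | ⟨hc', h'⟩
        · exact (hc' hc.1).elim
        · exact (hc'.2 hc.2).elim
        · refine Or.inr (Or.inr ⟨hc, fun hs => ?_⟩)
          have m := isModOn_moduleSpan (G := G) hx hy
          have m' := isModOn_moduleSpan (G := G) hy hz
          exact m.union_proper hc.1 hc.2 m' h h' (hs.trans (moduleSpan_subset
            (m.union m' right_mem_moduleSpan left_mem_moduleSpan) (Or.inl left_mem_moduleSpan)
              (Or.inr right_mem_moduleSpan)))

theorem childRel.mem (h : childRel G W x y) (hx : x ∈ W) : y ∈ W := by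
  rcases h with rfl | h
  exacts [hx, h.1.2]

theorem adj_iff_of_flat (hc : ¬ (ConnOn G W ∧ ConnOn Gᶜ W)) (hx : x ∈ W) (hy : y ∈ W)
    (h : ¬ childRel G W x y) : G.Adj x y ↔ ConnOn G W := by
  have hne : x ≠ y := fun e => h (Or.inl e)
  by_cases hG : ConnOn G W
  · refine iff_of_true ?_ hG
    by_contra hxy
    exact h (Or.inr ⟨⟨hx, hy⟩, Or.inr (Or.inl ⟨⟨hG, fun hG' => hc ⟨hG, hG'⟩⟩,
      .rel _ _ ⟨hx, hy, (SimpleGraph.compl_adj _ _ _).2 ⟨hne, hxy⟩⟩⟩)⟩)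
  · exact iff_of_false (fun hxy => h (Or.inr ⟨⟨hx, hy⟩, Or.inl ⟨hG, .rel _ _ ⟨hx, hy, hxy⟩⟩⟩)) hG

theorem childRel_of_mem_module (hc : ConnOn G W ∧ ConnOn Gᶜ W) {M : Set V} (hM : IsModOn G W M)
    (hW : ¬ W ⊆ M) (hx : x ∈ M) (hy : y ∈ M) : childRel G W x y :=
  Or.inr ⟨⟨hM.1 hx, hM.1 hy⟩, Or.inr (Or.inr ⟨hc, fun h => hW (h.trans
    (moduleSpan_subset hM hx hy))⟩)⟩

theorem childRel.adj_iff {x' : V} (h : childRel G W x x') (hx : x ∈ W) (hy : y ∈ W)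
    (hxy : ¬ childRel G W x y) : G.Adj x y ↔ G.Adj x' y := by
  have hx' : x' ∈ W := h.mem hx
  by_cases hc : ConnOn G W ∧ ConnOn Gᶜ W
  · rcases h with rfl | ⟨-, h⟩
    · rfl
    · rcases h with h | h | h
      · exact (h.1 hc.1).elim
      · exact (h.1.2 hc.2).elim
      · have m := isModOn_moduleSpan (G := G) hx hx'
        rw [G.adj_comm, G.adj_comm x']
        exact m.2 y hy (fun hy' => hxy (childRel_of_mem_module hc m h.2 left_mem_moduleSpan hy'))
          x left_mem_moduleSpan x' right_mem_moduleSpan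
  · rw [adj_iff_of_flat hc hx hy hxy, adj_iff_of_flat hc hx' hy
      fun h' => hxy (childRel_equivalence.trans h h')]

/-- Children are modules of `G[W]`. Hence the quotient graph does not depend on the representatives,
and it determines all edges between different children. -/
theorem childRel.adj_congr {x' y' : V} (h : childRel G W x x') (h' : childRel G W y y') (hx : x ∈ W)
    (hy : y ∈ W) (hxy : ¬ childRel G W x y) : G.Adj x y ↔ G.Adj x' y' := by
  rw [h.adj_iff hx hy hxy, G.adj_comm, h'.adj_iff hy (h.mem hx), G.adj_comm]
  exact fun hyx => hxy (childRel_equivalence.trans h (childRel_equivalence.symm hyx))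

/-- The decomposition makes progress. If one child were all of `W` in the case of two connected
graphs, a maximal proper module containing `x` could be enlarged by the span of `x` and a vertex
outside it, and would stay proper. In the other cases the graph in question would be connected after
all. -/
theorem exists_not_childRel (hx : x ∈ W) (hy : y ∈ W) (hxy : x ≠ y) :
    ∃ z ∈ W, ¬ childRel G W x z := by
  by_contra! hall
  by_cases hc : ConnOn G W
  · by_cases hc' : ConnOn Gᶜ W
    · let S : Set (Set V) := {M | IsModOn G W M ∧ x ∈ M ∧ ¬ W ⊆ M}
      have hproper : ∀ z ∈ W, z ≠ x → ¬ W ⊆ moduleSpan G W x z := by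
        intro z hz hzx
        rcases hall z hz with h | ⟨-, h | h | h⟩
        · exact (hzx h.symm).elim
        · exact (h.1 hc).elim
        · exact (h.1.2 hc').elim
        · exact h.2
      have hS : S.Nonempty :=
        ⟨_, isModOn_moduleSpan hx hy, left_mem_moduleSpan, hproper y hy hxy.symm⟩
      obtain ⟨M, hM⟩ := (Set.toFinite S).exists_maximal hS
      obtain ⟨hM₁, hM₂, hM₃⟩ := hM.1
      obtain ⟨z, hz, hzM⟩ := Set.not_subset.1 hM₃
      have hzx : z ≠ x := fun e => hzM (e ▸ hM₂)
      have m := isModOn_moduleSpan (G := G) hx hz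
      have hU : M ∪ moduleSpan G W x z ∈ S :=
        ⟨hM₁.union m hM₂ left_mem_moduleSpan, Or.inl hM₂,
          hM₁.union_proper hc hc' m hM₃ (hproper z hz hzx)⟩
      exact hzM (hM.2 hU Set.subset_union_left (Or.inr right_mem_moduleSpan))
    · refine hc' fun a ha b hb => ?_
      have : ∀ a ∈ W, compRel Gᶜ W x a := by
        intro a ha
        rcases hall a ha with h | ⟨-, h | h | h⟩
        · exact h ▸ .refl _
        · exact (h.1 hc).elim
        · exact h.2
        · exact (hc' h.1.2).elim
      exact compRel_equivalence.trans (compRel_equivalence.symm (this a ha)) (this b hb)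
  · refine hc fun a ha b hb => ?_
    have : ∀ a ∈ W, compRel G W x a := by
      intro a ha
      rcases hall a ha with h | ⟨-, h | h | h⟩
      · exact h ▸ .refl _
      · exact h.2
      · exact (hc h.1.1).elim
      · exact (hc h.1.1).elim
    exact compRel_equivalence.trans (compRel_equivalence.symm (this a ha)) (this b hb)

/-- `T` contains exactly one vertex from every child of `W`. -/
structure IsTransversal (G : SimpleGraph V) (W T : Set V) : Prop where
  subset : T ⊆ W
  eq_of_childRel : ∀ t ∈ T, ∀ t' ∈ T, childRel G W t t' → t = t'
  exists_childRel : ∀ y ∈ W, ∃ t ∈ T, childRel G W y t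

/-- The union `M` of the children with representatives in a module `N` of the quotient is a module
of `G[W]`. If `M` is all of `W`, then `N` contains every representative; otherwise `M` lies in one
child and `N` is a singleton. -/
theorem IsTransversal.isPrime {T : Set V} (hT : IsTransversal G W T)
    (hc : ConnOn G W ∧ ConnOn Gᶜ W) : IsPrime (G.induce T) := by
  intro N hN
  let M : Set V := {y | y ∈ W ∧ ∃ t : T, t ∈ N ∧ childRel G W y t}
  have hM : IsModOn G W M := by
    refine ⟨fun y hy => hy.1, ?_⟩
    rintro v hv hvM
    obtain ⟨w, hw, hvw⟩ := hT.exists_childRel v hv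
    have hwN : (⟨w, hw⟩ : T) ∉ N := fun h => hvM ⟨hv, ⟨w, hw⟩, h, hvw⟩
    have key : ∀ u ∈ W, ∀ t : T, t ∈ N → childRel G W u t → (G.Adj v u ↔ G.Adj w t) := by
      intro u hu t ht hut
      refine hvw.adj_congr hut hv hu fun hvu => hvM ⟨hv, t, ht, childRel_equivalence.trans hvu hut⟩
    rintro u ⟨hu, t, ht, hut⟩ u' ⟨hu', t', ht', hut'⟩
    rw [key u hu t ht hut, key u' hu' t' ht' hut']
    exact hN.2 ⟨w, hw⟩ hwN t ht t' ht'
  by_cases hWM : W ⊆ M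
  · left
    refine Set.eq_univ_of_forall fun t => ?_
    obtain ⟨-, t', ht', h⟩ := hWM (hT.subset t.2)
    rwa [Subtype.ext (hT.eq_of_childRel t t.2 t' t'.2 h)]
  · right
    obtain ⟨t, ht⟩ := hN.1
    refine ⟨t, Set.eq_singleton_iff_unique_mem.2 ⟨ht, fun t' ht' => ?_⟩⟩
    have hm : ∀ t : T, t ∈ N → (t : V) ∈ M := fun t ht =>
      ⟨hT.subset t.2, t, ht, childRel_equivalence.refl _⟩
    exact Subtype.ext (hT.eq_of_childRel t' t'.2 t t.2
      (childRel_of_mem_module hc hM hWM (hm t' ht') (hm t ht)))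

theorem exists_uniform_of_ncard_le_three {T : Set V} (hT : T.Nonempty) (h : T.ncard ≤ 3) :
    ∃ t ∈ T, ∃ ε : Prop, ∀ s ∈ T, s ≠ t → (G.Adj t s ↔ ε) := by
  have hpos : 0 < T.ncard := (Set.ncard_pos (Set.toFinite _)).2 hT
  have : T.ncard = 1 ∨ T.ncard = 2 ∨ T.ncard = 3 := by omega
  rcases this with h | h | h
  · obtain ⟨a, rfl⟩ := Set.ncard_eq_one.1 h
    exact ⟨a, rfl, True, fun s hs hsa => (hsa hs).elim⟩
  · obtain ⟨a, b, -, rfl⟩ := Set.ncard_eq_two.1 h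
    refine ⟨a, Or.inl rfl, G.Adj a b, ?_⟩
    rintro s (rfl | rfl) hs
    · exact (hs rfl).elim
    · rfl
  · obtain ⟨a, b, c, -, -, -, rfl⟩ := Set.ncard_eq_three.1 h
    -- If `a` and `b` both distinguish the two other vertices, then `ac` and `bc` both differ from
    -- `ab`, so they agree and `c` is the uniform vertex.
    by_cases h₁ : G.Adj a b ↔ G.Adj a c
    · refine ⟨a, Or.inl rfl, G.Adj a b, ?_⟩
      rintro s (rfl | rfl | rfl) hs
      · exact (hs rfl).elim
      · rfl
      · exact h₁.symm
    · by_cases h₂ : G.Adj b a ↔ G.Adj b c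
      · refine ⟨b, Or.inr (Or.inl rfl), G.Adj b a, ?_⟩
        rintro s (rfl | rfl | rfl) hs
        · rfl
        · exact (hs rfl).elim
        · exact h₂.symm
      · refine ⟨c, Or.inr (Or.inr rfl), G.Adj c a, ?_⟩
        rw [G.adj_comm b a] at h₂
        rintro s (rfl | rfl | rfl) hs
        · rfl
        · rw [G.adj_comm, G.adj_comm c]; tauto
        · exact (hs rfl).elim

/-- Among at most three children one is joined uniformly to all others, which contradicts
`ConnOn.not_uniform` for the cut around that child. -/
theorem IsTransversal.four_le {T : Set V} (hT : IsTransversal G W T)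
    (hc : ConnOn G W ∧ ConnOn Gᶜ W) (hx : x ∈ W) (hy : y ∈ W) (hxy : x ≠ y) :
    4 ≤ Nat.card T := by
  by_contra! hlt
  obtain ⟨t₀, ht₀, -⟩ := hT.exists_childRel x hx
  obtain ⟨t, ht, ε, hε⟩ := exists_uniform_of_ncard_le_three (G := G) ⟨t₀, ht₀⟩ (Nat.lt_succ_iff.1 hlt)
  have : ∃ y' ∈ W, t ≠ y' := by
    by_contra! h
    exact hxy ((h x hx).symm.trans (h y hy))
  obtain ⟨y', hy', hty⟩ := this
  -- The cut is proper because no child exhausts `W`.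
  obtain ⟨z, hz, htz⟩ := exists_not_childRel (G := G) (hT.subset ht) hy' hty
  refine hc.1.not_uniform hc.2 (B := {v | childRel G W v t}) (hT.subset ht)
    (childRel_equivalence.refl t) hz (fun h => htz (childRel_equivalence.symm h)) ε
      fun u hu v hv huB hvB => ?_
  obtain ⟨s, hs, hvs⟩ := hT.exists_childRel v hv
  have huv : ¬ childRel G W u v := fun h => hvB (childRel_equivalence.trans
    (childRel_equivalence.symm h) huB)
  rw [childRel.adj_congr huB hvs hu hv huv]
  exact hε s hs fun e => hvB (e ▸ hvs)

end Span

end Modules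

/-! ### The levels of the decomposition -/

section Levels

variable {V : Type} (G : SimpleGraph V)

/-- Two vertices are equivalent at level `i` if they belong to the same set at depth `i` of the
modular decomposition tree. -/
def levRel : ℕ → V → V → Prop
  | 0, _, _ => True
  | i + 1, x, y => childRel G {z | levRel i x z} x y

/-- The set at depth `i` of the modular decomposition tree which contains `x`. -/
def levSet (i : ℕ) (x : V) : Set V := {z | levRel G i x z}

variable {G} [Finite V]

theorem levRel_equivalence (i : ℕ) : Equivalence (levRel G i) := by
  induction i with
  | zero => exact ⟨fun _ => trivial, fun _ => trivial, fun _ _ => trivial⟩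
  | succ i ih =>
    have hset : ∀ {x y}, levRel G (i + 1) x y → {z | levRel G i x z} = {z | levRel G i y z} := by
      intro x y h
      have hxy : levRel G i x y := childRel.mem h (ih.refl x)
      ext z
      exact ⟨ih.trans (ih.symm hxy), ih.trans hxy⟩
    refine ⟨fun x => childRel_equivalence.refl x, ?_, ?_⟩
    · intro x y h
      change childRel G {z | levRel G i y z} y x
      rw [← hset h]
      exact childRel_equivalence.symm h
    · intro x y z h h'
      change childRel G {z | levRel G i x z} x z
      refine childRel_equivalence.trans h ?_
      rw [hset h]
      exact h'

theorem mem_levSet_self (i : ℕ) (x : V) : x ∈ levSet G i x := (levRel_equivalence i).refl x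

theorem levSet_eq {i : ℕ} {x y : V} (h : y ∈ levSet G i x) : levSet G i y = levSet G i x := by
  ext z
  exact ⟨(levRel_equivalence i).trans h,
    (levRel_equivalence i).trans ((levRel_equivalence i).symm h)⟩

theorem levSet_succ {i : ℕ} {x y : V} (h : y ∈ levSet G i x) :
    levSet G (i + 1) y = {z | childRel G (levSet G i x) y z} := by
  rw [← levSet_eq h]
  rfl

theorem levSet_succ_ssubset {i : ℕ} {x y : V} (h : y ∈ levSet G i x)
    (hx : (levSet G i x).ncard ≠ 1) : levSet G (i + 1) y ⊂ levSet G i x := by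
  have hsub : levSet G (i + 1) y ⊆ levSet G i x := by
    rw [levSet_succ h]
    exact fun z hz => childRel.mem hz h
  refine ⟨hsub, fun hsup => ?_⟩
  have : ∃ z ∈ levSet G i x, y ≠ z := by
    by_contra! h'
    refine hx (Set.ncard_eq_one.2 ⟨y, Set.eq_singleton_iff_unique_mem.2 ⟨h, fun z hz => ?_⟩⟩)
    exact (h' z hz).symm
  obtain ⟨z, hz, hyz⟩ := this
  obtain ⟨w, hw, hyw⟩ := exists_not_childRel (G := G) h hz hyz
  have := hsup hw
  rw [levSet_succ h] at this
  exact hyw this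

/-- Sizes drop by at least one per level until a single vertex remains. The depth of any larger set
is therefore below `|V|`, and the next depth is still an element of the number sort. -/
theorem ncard_levSet (i : ℕ) (x : V) :
    (levSet G i x).ncard = 1 ∨ (levSet G i x).ncard + i ≤ Nat.card V := by
  induction i with
  | zero =>
    right
    rw [← Set.ncard_univ]
    exact Set.ncard_le_ncard (Set.subset_univ _) (Set.toFinite _)
  | succ i ih =>
    by_cases h : (levSet G i x).ncard = 1
    · left
      obtain ⟨a, ha⟩ := Set.ncard_eq_one.1 h
      have hx : x = a := by simpa [ha] using mem_levSet_self (G := G) i x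
      refine Set.ncard_eq_one.2 ⟨x, Set.eq_singleton_iff_unique_mem.2
        ⟨mem_levSet_self _ _, fun y hy => ?_⟩⟩
      have : y ∈ levSet G i x := by
        rw [levSet_succ (mem_levSet_self i x)] at hy
        exact childRel.mem hy (mem_levSet_self i x)
      rw [ha] at this
      exact this.trans hx.symm
    · right
      have := Set.ncard_lt_ncard (levSet_succ_ssubset (mem_levSet_self i x) h) (Set.toFinite _)
      have := ih.resolve_left h
      omega

end Levels

/-! ### Codes of induced subgraphs by relations between numbers -/

section Codes

theorem exists_rank {Y : Type} [Finite Y] (D : Y → Prop) (lt : Y → Y → Prop)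
    (irrefl : ∀ y, D y → ¬ lt y y) (trans : ∀ x y z, D x → D y → D z → lt x y → lt y z → lt x z)
    (total : ∀ x y, D x → D y → x ≠ y → lt x y ∨ lt y x) :
    (∀ y, D y → Set.ncard {z | D z ∧ lt z y} < Set.ncard {z | D z}) ∧
    (∀ y y', D y → D y' → Set.ncard {z | D z ∧ lt z y} = Set.ncard {z | D z ∧ lt z y'} → y = y') ∧
    ∀ i < Set.ncard {z | D z}, ∃ y, D y ∧ Set.ncard {z | D z ∧ lt z y} = i := by
  have h₁ : ∀ y, D y → Set.ncard {z | D z ∧ lt z y} < Set.ncard {z | D z} := fun y hy =>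
    Set.ncard_lt_ncard ⟨fun z hz => hz.1, fun h => irrefl y hy (h hy).2⟩ (Set.toFinite _)
  have h₀ : ∀ y y', D y → D y' → lt y y' →
      Set.ncard {z | D z ∧ lt z y} < Set.ncard {z | D z ∧ lt z y'} := fun y y' hy hy' h =>
    Set.ncard_lt_ncard ⟨fun z hz => ⟨hz.1, trans _ _ _ hz.1 hy hy' hz.2 h⟩,
      fun h' => irrefl y hy (h' ⟨hy, h⟩).2⟩ (Set.toFinite _)
  have h₂ : ∀ y y', D y → D y' →
      Set.ncard {z | D z ∧ lt z y} = Set.ncard {z | D z ∧ lt z y'} → y = y' := by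
    intro y y' hy hy' e
    by_contra hne
    rcases total y y' hy hy' hne with h | h
    · exact (h₀ y y' hy hy' h).ne e
    · exact (h₀ y' y hy' hy h).ne e.symm
  refine ⟨h₁, h₂, fun i hi => ?_⟩
  have himg : (fun y => Set.ncard {z | D z ∧ lt z y}) '' {z | D z} = Set.Iio (Set.ncard {z | D z}) := by
    refine Set.eq_of_subset_of_ncard_le ?_ ?_ (Set.finite_Iio _)
    · rintro _ ⟨y, hy, rfl⟩
      exact h₁ y hy
    · have hinj : Set.InjOn (fun y => Set.ncard {z | D z ∧ lt z y}) {z | D z} :=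
        fun y hy y' hy' e => h₂ y y' hy hy' e
      rw [hinj.ncard_image, ← Finset.coe_Iio, Set.ncard_coe_finset, Nat.card_Iio]
  have hi' : i ∈ Set.Iio (Set.ncard {z | D z}) := hi
  rw [← himg] at hi'
  exact hi'

variable {V : Type} [Finite V] [Nonempty V] {G : SimpleGraph V}

/-- The reflexive relation `K` on an initial segment of the numbers is isomorphic to `G[W]`. -/
def IsCode (G : SimpleGraph V) (W : Set V) (K : Num V → Num V → Prop) : Prop :=
  ∃ f : ℕ → V, Set.BijOn f (Set.Iio W.ncard) W ∧
    ∀ p q, K p q ↔ ((p : ℕ) < W.ncard ∧ (q : ℕ) < W.ncard) ∧ (f p = f q ∨ G.Adj (f p) (f q))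

theorem IsCode.rankRel {Y : Type} [Finite Y] [Nonempty Y] {W : Set V} {D : Y → Prop} {lt ρ : Y → Y → Prop}
    (irrefl : ∀ y, D y → ¬ lt y y) (trans : ∀ x y z, D x → D y → D z → lt x y → lt y z → lt x z)
    (total : ∀ x y, D x → D y → x ≠ y → lt x y ∨ lt y x) (g : Y → V)
    (hg : Set.BijOn g {y | D y} W)
    (hρ : ∀ y y', D y → D y' → (ρ y y' ↔ g y = g y' ∨ G.Adj (g y) (g y'))) :
    IsCode G W (fun p q => rankRel D lt ρ p q) := by
  obtain ⟨h₁, h₂, h₃⟩ := exists_rank D lt irrefl trans total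
  have hcard : Set.ncard {y | D y} = W.ncard := by
    rw [← hg.image_eq, hg.injOn.ncard_image]
  rw [hcard] at h₁ h₃
  choose! f hf using h₃
  refine ⟨fun i => g (f i), ⟨fun i hi => hg.mapsTo (hf i hi).1, fun i hi j hj e => ?_, ?_⟩, ?_⟩
  · have e' := hg.injOn (hf i hi).1 (hf j hj).1 e
    rw [← (hf i hi).2, e', (hf j hj).2]
  · intro w hw
    obtain ⟨y, hy, rfl⟩ := hg.surjOn hw
    have := hf _ (h₁ y hy)
    exact ⟨_, h₁ y hy, congrArg g (h₂ _ _ this.1 hy this.2)⟩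
  · intro p q
    constructor
    · rintro ⟨y, y', ⟨hy, hy'⟩, ⟨hp, hq⟩, h⟩
      have hp' : (p : ℕ) < W.ncard := hp ▸ h₁ y hy
      have hq' : (q : ℕ) < W.ncard := hq ▸ h₁ y' hy'
      refine ⟨⟨hp', hq'⟩, ?_⟩
      beta_reduce
      rw [h₂ _ y (hf _ hp').1 hy ((hf _ hp').2.trans hp.symm),
        h₂ _ y' (hf _ hq').1 hy' ((hf _ hq').2.trans hq.symm)]
      exact (hρ y y' hy hy').1 h
    · rintro ⟨⟨hp, hq⟩, h⟩
      exact ⟨f p, f q, ⟨(hf p hp).1, (hf q hq).1⟩, ⟨(hf p hp).2, (hf q hq).2⟩,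
        (hρ _ _ (hf p hp).1 (hf q hq).1).2 h⟩

/-- The set `W` is composed from codes of its children, indexed by the elements of `I` which
satisfy `P`. -/
theorem IsCode.compose {I M : Type} [Finite I] [Finite M] [Nonempty I] [Nonempty M] {W T : Set V} (hT : IsTransversal G W T)
    {Kc : V → Num V → Num V → Prop}
    (hKc : ∀ t ∈ T, IsCode G {y | childRel G W t y} (Kc t)) (P : I → Prop) (e : I → V)
    (he : Set.BijOn e {v | P v} T) (PM : M → Prop) (eM : M → Num V)
    (heM : Set.BijOn eM {c | PM c} Set.univ) (L : I → M → M → Prop)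
    (hL : ∀ v c c', P v → (L v c c' ↔ (PM c ∧ PM c') ∧ Kc (e v) (eM c) (eM c')))
    (E : I → I → Prop) (hE : ∀ v v', P v → P v' → v ≠ v' → (E v v' ↔ G.Adj (e v) (e v')))
    (lt : I → I → Prop) (ltM : M → M → Prop)
    (irrefl : ∀ y, P y → ¬ lt y y) (trans : ∀ x y z, P x → P y → P z → lt x y → lt y z → lt x z)
    (total : ∀ x y, P x → P y → x ≠ y → lt x y ∨ lt y x)
    (irreflM : ∀ y, PM y → ¬ ltM y y)
    (transM : ∀ x y z, PM x → PM y → PM z → ltM x y → ltM y z → ltM x z)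
    (totalM : ∀ x y, PM x → PM y → x ≠ y → ltM x y ∨ ltM y x) :
    IsCode G W (fun p q => FPC.rankRel (fun y : I × M => P y.1 ∧ L y.1 y.2 y.2)
      (fun y y' => lt y.1 y'.1 ∨ y.1 = y'.1 ∧ ltM y.2 y'.2)
      (fun y y' => y.1 = y'.1 ∧ L y.1 y.2 y'.2 ∨ y.1 ≠ y'.1 ∧ E y.1 y'.1) p q) := by
  have hKc' : ∀ v, P v → _ := fun v hv => hKc (e v) (he.mapsTo hv)
  choose! f hf hfK using hKc'
  -- The diagonal of a code is its initial segment, so each child receives exactly as many pairs as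
  -- it has vertices.
  have hD : ∀ y : I × M, P y.1 ∧ L y.1 y.2 y.2 ↔
      P y.1 ∧ PM y.2 ∧ (eM y.2 : ℕ) < Set.ncard {z | childRel G W (e y.1) z} := by
    intro y
    refine and_congr_right fun hy => ?_
    rw [hL _ _ _ hy, hfK _ hy]
    simp
  have hmem : ∀ y : I × M, P y.1 ∧ L y.1 y.2 y.2 → childRel G W (e y.1) (f y.1 (eM y.2)) := by
    intro y hy
    obtain ⟨hy, -, hy'⟩ := (hD y).1 hy
    exact (hf _ hy).mapsTo hy'
  have hne : ∀ y y' : I × M, P y.1 ∧ L y.1 y.2 y.2 → P y'.1 ∧ L y'.1 y'.2 y'.2 → y.1 ≠ y'.1 →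
      ¬ childRel G W (f y.1 (eM y.2)) (f y'.1 (eM y'.2)) := by
    intro y y' hy hy' hne h
    refine hne (he.injOn hy.1 hy'.1 (hT.eq_of_childRel _ (he.mapsTo hy.1) _ (he.mapsTo hy'.1) ?_))
    exact childRel_equivalence.trans (hmem y hy) (childRel_equivalence.trans h
      (childRel_equivalence.symm (hmem y' hy')))
  -- The pair of a child and a position in its code stands for a vertex; the pairs are ordered
  -- lexicographically and ranked.
  refine IsCode.rankRel ?_ ?_ ?_ (fun y : I × M => f y.1 (eM y.2)) ⟨?_, ?_, ?_⟩ ?_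
  · rintro y hy (h | h)
    · exact irrefl _ hy.1 h
    · exact irreflM _ ((hD y).1 hy).2.1 h.2
  · rintro x y z hx hy hz (h | ⟨h, h'⟩) (k | ⟨k, k'⟩)
    · exact Or.inl (trans _ _ _ hx.1 hy.1 hz.1 h k)
    · exact Or.inl (k ▸ h)
    · exact Or.inl (h ▸ k)
    · exact Or.inr ⟨h.trans k, transM _ _ _ ((hD x).1 hx).2.1 ((hD y).1 hy).2.1
        ((hD z).1 hz).2.1 h' k'⟩
  · rintro x y hx hy hxy
    by_cases h : x.1 = y.1
    · rcases totalM x.2 y.2 ((hD x).1 hx).2.1 ((hD y).1 hy).2.1 fun e => hxy (Prod.ext h e) with k | k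
      · exact Or.inl (Or.inr ⟨h, k⟩)
      · exact Or.inr (Or.inr ⟨h.symm, k⟩)
    · exact (total _ _ hx.1 hy.1 h).imp Or.inl Or.inl
  · intro y hy
    exact (hmem y hy).mem (hT.subset (he.mapsTo hy.1))
  · intro y hy y' hy' h
    have h₁ : y.1 = y'.1 := by
      by_contra h'
      exact hne y y' hy hy' h' (Or.inl h)
    refine Prod.ext h₁ ?_
    obtain ⟨k₁, k₂, k₃⟩ := (hD y).1 hy
    obtain ⟨k₁', k₂', k₃'⟩ := (hD y').1 hy'
    rw [← h₁] at k₃'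
    change f y.1 (eM y.2) = f y'.1 (eM y'.2) at h
    rw [← h₁] at h
    exact heM.injOn k₂ k₂' (Fin.ext ((hf _ k₁).injOn k₃ k₃' h))
  · intro w hw
    obtain ⟨t, ht, hwt⟩ := hT.exists_childRel w hw
    obtain ⟨v, hv, rfl⟩ := he.surjOn ht
    obtain ⟨i, hi, rfl⟩ := (hf v hv).surjOn (childRel_equivalence.symm hwt)
    have hi' : i < Nat.card V + 1 := by
      refine Nat.lt_succ_of_le (le_trans (le_of_lt hi) ?_)
      rw [← Set.ncard_univ]
      exact Set.ncard_le_ncard (Set.subset_univ _) (Set.toFinite _)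
    obtain ⟨c, hc, hc'⟩ := heM.surjOn (Set.mem_univ (⟨i, hi'⟩ : Num V))
    have : (eM c : ℕ) = i := congrArg Fin.val hc'
    refine ⟨(v, c), (hD (v, c)).2 ⟨hv, hc, ?_⟩, ?_⟩
    · change (eM c : ℕ) < _
      rw [this]
      exact hi
    · change f v (eM c) = f v i
      rw [this]
  · intro y y' hy hy'
    by_cases h : y.1 = y'.1
    · obtain ⟨k₁, k₂, k₃⟩ := (hD y).1 hy
      obtain ⟨k₁', k₂', k₃'⟩ := (hD y').1 hy'
      have k₄ := k₃'
      rw [← h] at k₄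
      simp only [h, true_and, ne_eq, not_true_eq_false, false_and, or_false]
      rw [hL _ _ _ k₁', hfK _ k₁']
      rw [h] at k₃
      simp [k₂, k₂', k₃, k₃']
    · simp only [h, false_and, false_or, ne_eq, not_false_eq_true, true_and]
      rw [hE _ _ hy.1 hy'.1 h]
      have hn : ¬ childRel G W (e y.1) (e y'.1) := fun h' => h (he.injOn hy.1 hy'.1
        (hT.eq_of_childRel _ (he.mapsTo hy.1) _ (he.mapsTo hy'.1) h'))
      rw [(hmem y hy).adj_congr (hmem y' hy') (hT.subset (he.mapsTo hy.1))
        (hT.subset (he.mapsTo hy'.1)) hn]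
      refine ⟨Or.inr, fun h' => h'.resolve_left fun e' => ?_⟩
      exact hne y y' hy hy' h (Or.inl e')

end Codes

end

/-! ### Formulas for the levels of the decomposition tree. -/

section

/-! ### Definability of the decomposition -/

section Decomposition

variable {τ : FirstOrder.Language.{0, 0}} {𝔅 : Base τ} {J : 𝔅.I → Type} {Δ : Ctx 𝔅 J}
  {V : 𝔅.I → Type} [Srt 𝔅 V] {G : ∀ b, SimpleGraph (V b)} {W : ∀ b, Set (V b)}

theorem DRel₂.compl (hG : DRel₂ (X := V) (Y := V) fun b x y => (G b).Adj x y) :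
    DRel₂ (X := V) (Y := V) fun b x y => (G b)ᶜ.Adj x y :=
  Def.and (Def.not (Term.var1.eq Term.var0)) (Def.not hG)

theorem DRel₂.compRel (hG : DRel₂ (X := V) (Y := V) fun b x y => (G b).Adj x y)
    (hW : DRel₁ (X := V) fun b x => x ∈ W b) :
    DRel₂ (X := V) (Y := V) fun b x y => FPC.compRel (G b) (W b) x y :=
  Def.eqvGen (r := fun b _ y z => y ∈ W b ∧ z ∈ W b ∧ (G b).Adj y z)
    ((hW.app Term.var1).and ((hW.app Term.var0).and (hG.app Term.var1 Term.var0)))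
    Term.var1 Term.var0

theorem Def.connOn (hG : DRel₂ (X := V) (Y := V) fun b x y => (G b).Adj x y)
    (hW : DRel₁ (X := V) fun b x => x ∈ W b) : Def Δ fun b _ => ConnOn (G b) (W b) :=
  Def.all (X := V) ((hW.app Term.var0).imp (Def.all (X := V) ((hW.app Term.var0).imp
    ((DRel₂.compRel hG hW).app Term.var1 Term.var0))))

theorem DRel₃.moduleSpan (hG : DRel₂ (X := V) (Y := V) fun b x y => (G b).Adj x y)
    (hW : DRel₁ (X := V) fun b x => x ∈ W b) :
    DRel₃ (X := V) (Y := V) (Z := V) fun b x y z => z ∈ FPC.moduleSpan (G b) (W b) x y := by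
  have key : SetTerm (((Ctx.nil 𝔅).ext V).ext V) (X := V)
      fun b j => FPC.moduleSpan (G b) (W b) j.1.2 j.2 := by
    refine Def.ifp (Def.or (Term.var0.eq Term.var1.wR.w) (Def.or (Term.var0.eq Term.var0.wR.w)
      (Def.and (hW.app Term.var0) (Def.ex (Def.ex (Def.and (Def.and
        (Def.mem SetTerm.var.w.w.w Term.var1) (Def.mem SetTerm.var.w.w.w Term.var0))
        (Def.and (hG.app Term.var2 Term.var1) (hG.app Term.var2 Term.var0).not)))))))
  exact Def.mem key.w Term.var0

theorem DRel₂.childRel (hG : DRel₂ (X := V) (Y := V) fun b x y => (G b).Adj x y)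
    (hW : DRel₁ (X := V) fun b x => x ∈ W b) :
    DRel₂ (X := V) (Y := V) fun b x y => FPC.childRel (G b) (W b) x y := by
  have h₁ : ∀ {J : 𝔅.I → Type} {Δ : Ctx 𝔅 J}, Def Δ fun b _ => ConnOn (G b) (W b) := Def.connOn hG hW
  have h₂ : ∀ {J : 𝔅.I → Type} {Δ : Ctx 𝔅 J}, Def Δ fun b _ => ConnOn (G b)ᶜ (W b) :=
    Def.connOn hG.compl hW
  exact Def.or (Term.var1.eq Term.var0) (Def.and ((hW.app Term.var1).and (hW.app Term.var0))
    (Def.or (h₁.not.and ((DRel₂.compRel hG hW).app Term.var1 Term.var0))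
      (Def.or ((h₁.and h₂.not).and ((DRel₂.compRel hG.compl hW).app Term.var1 Term.var0))
        ((h₁.and h₂).and (Def.not (Def.all (X := V) ((hW.app Term.var0).imp
          ((DRel₃.moduleSpan hG hW).app Term.var2 Term.var1 Term.var0))))))))

end Decomposition

/-- The graph encoded by a structure. -/
def structGraph (A : FinStruct FirstOrder.Language.graph) : SimpleGraph A.carrier :=
  SimpleGraph.fromRel fun a b => Structure.RelMap FirstOrder.Language.adj ![a, b]

/-- Formulas are evaluated in arbitrary structures, so `structGraph` symmetrizes and drops loops; on
genuine graphs this changes nothing. -/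
theorem structGraph_toStruct (G : FinGraph) : structGraph G.toStruct = G.graph := by
  ext a b
  refine Iff.trans (SimpleGraph.fromRel_adj _ _ _) ?_
  change a ≠ b ∧ (G.graph.Adj a b ∨ G.graph.Adj b a) ↔ _
  constructor
  · rintro ⟨-, h | h⟩
    · exact h
    · exact h.symm
  · exact fun h => ⟨h.ne, Or.inl h⟩

section Levels

variable (𝔅 : Base FirstOrder.Language.graph)

theorem DRel₂.adj : DRel₂ (X := fun b => (𝔅.A b).carrier) (Y := fun b => (𝔅.A b).carrier)
    fun b x y => (structGraph (𝔅.A b)).Adj x y := by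
  have h : ∀ {J : 𝔅.I → Type} {Δ : Ctx 𝔅 J} {x y : ∀ b, J b → (𝔅.A b).carrier}, Term Δ x → Term Δ y →
      Def Δ fun b j => Structure.RelMap FirstOrder.Language.adj ![x b j, y b j] := by
    intro J Δ x y hx hy
    refine Def.rel _ fun i => ?_
    match i with
    | 0 => exact hx
    | 1 => exact hy
  exact Def.and (Def.not (Term.var1.eq Term.var0))
    (Def.or (h Term.var1 Term.var0) (h Term.var0 Term.var1))

theorem DRel₃.levRel : DRel₃ (X := fun b => Num (𝔅.A b).carrier) (Y := fun b => (𝔅.A b).carrier)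
    (Z := fun b => (𝔅.A b).carrier) fun b i x y => FPC.levRel (structGraph (𝔅.A b)) i x y := by
  -- The iteration starts with the empty set whereas level `0` is the full relation; hence `Φ`
  -- iterates the complement.
  let Φ : ∀ A : FinStruct FirstOrder.Language.graph, Set (Tup A.carrier 2 0) →
      Set (Tup A.carrier 2 0) := fun A Q =>
    {t | ¬ FPC.childRel (structGraph A) {z | (![t.1 0, z], ![]) ∉ Q} (t.1 0) (t.1 1)}
  have hpair : ∀ {𝔅 : Base FirstOrder.Language.graph} {J : 𝔅.I → Type} {Δ : Ctx 𝔅 J}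
      {x y : ∀ b, J b → (𝔅.A b).carrier}, Term Δ x → Term Δ y →
      Term Δ (X := fun b => Tup (𝔅.A b).carrier 2 0) fun b j => (![x b j, y b j], ![]) := by
    intro 𝔅 J Δ x y hx hy
    refine Term.pair (Term.pi fun i => ?_) (Term.pi fun i => i.elim0)
    match i with
    | 0 => exact hx
    | 1 => exact hy
  have hΦ : ∀ (𝔅 : Base FirstOrder.Language.graph) (Q : ∀ b, Set (Tup (𝔅.A b).carrier 2 0)),
      DRel₁ (X := fun b => Tup (𝔅.A b).carrier 2 0) (fun b t => t ∈ Q b) →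
      DRel₁ (X := fun b => Tup (𝔅.A b).carrier 2 0) (fun b t => t ∈ Φ (𝔅.A b) (Q b)) := by
    intro 𝔅 Q hQ
    let Δ := (Ctx.nil 𝔅).ext fun b => Tup (𝔅.A b).carrier 2 0
    have hW : DRel₁ (𝔅 := Δ.toBase) (X := fun b => (𝔅.A b.1).carrier)
        fun b z => z ∈ {z | (![(Δ.pt b).2.1 0, z], ![]) ∉ Q b.1} :=
      Def.toBase_ext (Δ := Δ) (X := fun b => (𝔅.A b).carrier)
        (P := fun b j => (![j.1.2.1 0, j.2], ![]) ∉ Q b)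
        (Def.not (hQ.app (hpair (Term.proj (Term.fst Term.var1) 0) Term.var0))) (Ctx.nil _)
    refine Def.not (Def.of_toBase (Δ := Δ) (P := fun b j => FPC.childRel (structGraph (𝔅.A b))
      {z | (![j.2.1 0, z], ![]) ∉ Q b} (j.2.1 0) (j.2.1 1)) ?_)
    exact DRel₂.app (DRel₂.childRel (DRel₂.adj Δ.toBase) hW)
      (Term.toBase (Δ := Δ) (X := fun b => (𝔅.A b).carrier)
        (a := fun b j => j.2.1 0) (Term.proj (Term.fst Term.var0) 0) _)
      (Term.toBase (Δ := Δ) (X := fun b => (𝔅.A b).carrier)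
        (a := fun b j => j.2.1 1) (Term.proj (Term.fst Term.var0) 1) _)
  have key : ∀ (A : FinStruct FirstOrder.Language.graph) (i : ℕ) (x y : A.carrier),
      (![x, y], ![]) ∉ (Φ A)^[i] ∅ ↔ FPC.levRel (structGraph A) i x y := by
    intro A i
    induction i with
    | zero => exact fun x y => iff_of_true (fun h => h) trivial
    | succ i ih =>
      intro x y
      rw [Function.iterate_succ_apply']
      refine not_not.trans ?_
      change FPC.childRel _ {z | (![x, z], ![]) ∉ (Φ A)^[i] ∅} x y ↔ FPC.childRel _ _ x y
      simp only [ih]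
  exact (Def.not ((DRel₂.iterate Φ hΦ 𝔅).app Term.var2 (hpair Term.var1 Term.var0))).congr
    fun b j => key _ _ _ _

end Levels

end

/-! ### Correctness of the code of a set built from the codes of its children. -/

section

/-! ### Codes of sets of vertices from codes of their children -/

section Sorting

/-- Ties are broken by an arbitrary well-order, which is not definable. The color at position `i`
does not depend on it: it is the one with at most `i` elements strictly below it and more than `i`
at or below it, and counting finds it. -/
theorem exists_sorting {T α : Type} [Finite T] [Nonempty T] [LinearOrder α] (c : T → α) :
    ∃ e : ℕ → T, Set.BijOn e (Set.Iio (Nat.card T)) Set.univ ∧ ∀ i < Nat.card T, ∀ y,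
      (Set.ncard {t | c t < c y} ≤ i ∧ i < Set.ncard {t | ¬ c y < c t}) ↔ c y = c (e i) := by
  let lt : T → T → Prop := fun t t' => c t < c t' ∨ c t = c t' ∧ WellOrderingRel t t'
  have irrefl : ∀ t, ¬ lt t t := by
    rintro t (h | ⟨-, h⟩)
    · exact lt_irrefl _ h
    · exact irrefl_of _ t h
  have trans : ∀ x y z, lt x y → lt y z → lt x z := by
    rintro x y z (h | ⟨h, k⟩) (h' | ⟨h', k'⟩)
    · exact Or.inl (h.trans h')
    · exact Or.inl (h'.symm ▸ h)
    · exact Or.inl (h.symm ▸ h')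
    · exact Or.inr ⟨h.trans h', trans_of _ k k'⟩
  have total : ∀ x y, x ≠ y → lt x y ∨ lt y x := by
    intro x y hxy
    rcases lt_trichotomy (c x) (c y) with h | h | h
    · exact Or.inl (Or.inl h)
    · rcases trichotomous_of WellOrderingRel x y with k | k | k
      · exact Or.inl (Or.inr ⟨h, k⟩)
      · exact (hxy k).elim
      · exact Or.inr (Or.inr ⟨h.symm, k⟩)
    · exact Or.inr (Or.inl h)
  obtain ⟨h₁, h₂, h₃⟩ := exists_rank (fun _ : T => True) lt (fun y _ => irrefl y)
    (fun x y z _ _ _ => trans x y z) (fun x y _ _ => total x y)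
  simp only [true_and, forall_const, Set.ofPred_true, Set.ncard_univ] at h₁ h₂ h₃
  choose! e he using h₃
  refine ⟨e, ⟨fun _ _ => trivial, fun i hi j hj h => ?_, fun y _ => ?_⟩, fun i hi y => ?_⟩
  · rw [← he i hi, h, he j hj]
  · exact ⟨_, h₁ y, h₂ _ _ (he _ (h₁ y))⟩
  · have hlt : ∀ y, Set.ncard {t | c t < c y} ≤ Set.ncard {t | lt t y} := fun y =>
      Set.ncard_le_ncard (fun t ht => Or.inl ht) (Set.toFinite _)
    have hle : ∀ y, Set.ncard {t | lt t y} < Set.ncard {t | ¬ c y < c t} := fun y => by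
      refine Set.ncard_lt_ncard ⟨?_, fun h => irrefl y (h (lt_irrefl (c y)))⟩ (Set.toFinite _)
      rintro t (ht | ht)
      · exact ht.asymm
      · exact fun h => h.ne ht.1.symm
    constructor
    · rintro ⟨h, h'⟩
      rcases lt_trichotomy (c y) (c (e i)) with k | k | k
      · refine absurd h' (not_lt.2 ?_)
        conv_rhs => rw [← he i hi]
        exact Set.ncard_le_ncard (fun t ht => Or.inl ((not_lt.1 ht).trans_lt k)) (Set.toFinite _)
      · exact k
      · refine absurd h (not_le.2 ?_)
        conv_lhs => rw [← he i hi]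
        refine (hle (e i)).trans_le (Set.ncard_le_ncard (fun t ht => ?_) (Set.toFinite _))
        exact (not_lt.1 ht).trans_lt k
    · intro h
      rw [h]
      have h₄ := hlt (e i)
      have h₅ := hle (e i)
      rw [he i hi] at h₄ h₅
      exact ⟨h₄, h₅⟩

end Sorting

section Children

variable {V : Type} [Finite V] (G : SimpleGraph V) (W : Set V)

/-- The choice is arbitrary; no formula refers to it, since a child is presented by any of its
vertices (`exists_srt_childReps`). -/
theorem exists_isTransversal : ∃ T, IsTransversal G W T := by
  let s : Setoid V := ⟨childRel G W, childRel_equivalence⟩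
  have h : ∀ v, childRel G W (Quotient.mk s v).out v := fun v => Quotient.mk_out v
  refine ⟨{t | t ∈ W ∧ (Quotient.mk s t).out = t}, fun t ht => ht.1, ?_, ?_⟩
  · rintro t ⟨-, ht⟩ t' ⟨-, ht'⟩ htt'
    rw [← ht, ← ht', show Quotient.mk s t = Quotient.mk s t' from Quotient.sound htt']
  · intro y hy
    have h' := childRel_equivalence.symm (h y)
    exact ⟨_, ⟨h'.mem hy, by rw [Quotient.out_eq]⟩, h'⟩

/-- A set of representatives of the children of `W`. -/
def childReps : Set V := (exists_isTransversal G W).choose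

theorem isTransversal_childReps : IsTransversal G W (childReps G W) :=
  (exists_isTransversal G W).choose_spec

variable {G W} in
theorem nonempty_childReps (hW : W.Nonempty) : (childReps G W).Nonempty := by
  obtain ⟨y, hy⟩ := hW
  obtain ⟨t, ht, -⟩ := (isTransversal_childReps G W).exists_childRel y hy
  exact ⟨t, ht⟩

variable (Kc : V → Num V → Num V → Prop)

/-- The relation associated with the child which contains `y`. -/
def childColor (y : V) (a b : Num V) : Prop := ∃ z, childRel G W y z ∧ Kc z a b

variable {G W Kc} in
theorem childColor_eq (h : ∀ y z, childRel G W y z → Kc y = Kc z) (y : V) :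
    childColor G W Kc y = Kc y := by
  funext a b
  refine propext ⟨?_, fun hK => ⟨y, Or.inl rfl, hK⟩⟩
  rintro ⟨z, hz, hK⟩
  rwa [h y z hz]

/-- The color of the child at position `i`, if the children are sorted by their colors. -/
def sortedColor (i a b : Num V) : Prop :=
  ∃ y : childReps G W, (Set.ncard {t : childReps G W |
      lexLt (childColor G W Kc t) (childColor G W Kc y)} ≤ (i : ℕ) ∧
    (i : ℕ) < Set.ncard {t : childReps G W |
      ¬ lexLt (childColor G W Kc y) (childColor G W Kc t)}) ∧ childColor G W Kc y a b

/-- The code of a set whose children are pairwise adjacent or pairwise non-adjacent. -/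
def flatCode (p q : ℕ) : Prop :=
  rankRel (fun y : Num V × Num V => (y.1 : ℕ) < Nat.card (childReps G W) ∧
      sortedColor G W Kc y.1 y.2 y.2)
    (fun y y' => y.1 < y'.1 ∨ y.1 = y'.1 ∧ y.2 < y'.2)
    (fun y y' => y.1 = y'.1 ∧ sortedColor G W Kc y.1 y.2 y'.2 ∨ y.1 ≠ y'.1 ∧ ConnOn G W) p q

variable {G W Kc}

/-- Adjacency between different children is constant, so children with equal codes are
interchangeable and the sorted list of codes suffices. -/
theorem isCode_flatCode [Nonempty V] (hW : W.Nonempty) (hc : ¬ (ConnOn G W ∧ ConnOn Gᶜ W))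
    (hK : ∀ t ∈ childReps G W, IsCode G {y | childRel G W t y} (childColor G W Kc t)) :
    IsCode G W (fun p q => flatCode G W Kc p q) := by
  have : Nonempty (childReps G W) := (nonempty_childReps hW).to_subtype
  obtain ⟨e, he, hec⟩ := exists_sorting
    (fun t : childReps G W => relToLex (childColor G W Kc t))
  have hcard : Nat.card (childReps G W) < Nat.card V + 1 :=
    Nat.lt_succ_of_le (Nat.card_le_card_of_injective _ Subtype.val_injective)
  refine IsCode.compose (isTransversal_childReps G W) hK
    (fun i : Num V => (i : ℕ) < Nat.card (childReps G W)) (fun i => e i) ⟨?_, ?_, ?_⟩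
    (fun _ => True) id ⟨fun _ _ => trivial, fun _ _ _ _ h => h, fun c _ => ⟨c, trivial, rfl⟩⟩
    (sortedColor G W Kc) ?_ (fun _ _ => ConnOn G W) ?_ (· < ·) (· < ·) ?_ ?_ ?_ ?_ ?_ ?_
  · exact fun i _ => (e i).2
  · exact fun i hi j hj h => Fin.ext (he.injOn hi hj (Subtype.ext h))
  · intro t ht
    obtain ⟨i, hi, h⟩ := he.surjOn (Set.mem_univ (⟨t, ht⟩ : childReps G W))
    exact ⟨⟨i, (Set.mem_Iio.1 hi).trans hcard⟩, hi, congrArg Subtype.val h⟩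
  · intro i a b hi
    rw [true_and, true_and]
    constructor
    · rintro ⟨y, hy, hK⟩
      simp only [lexLt_iff] at hy
      have := relToLex_injective ((hec i hi y).1 hy)
      exact this ▸ hK
    · intro hK
      refine ⟨e i, ?_, hK⟩
      simp only [lexLt_iff]
      exact (hec i hi (e i)).2 rfl
  · intro i j hi hj hij
    have hne : ¬ childRel G W (e i) (e j) := fun h => hij (Fin.ext (he.injOn hi hj (Subtype.ext
      ((isTransversal_childReps G W).eq_of_childRel _ (e i).2 _ (e j).2 h))))
    have hT := (isTransversal_childReps G W).subset
    exact (adj_iff_of_flat hc (hT (e i).2) (hT (e j).2) hne).symm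
  · exact fun y _ => lt_irrefl y
  · exact fun x y z _ _ _ => lt_trans
  · exact fun x y _ _ => lt_or_gt_of_ne
  · exact fun y _ => lt_irrefl y
  · exact fun x y z _ _ _ => lt_trans
  · exact fun x y _ _ => lt_or_gt_of_ne

theorem isCode_singleton [Nonempty V] (hW : W.ncard = 1) :
    IsCode G W (fun p q => p = 0 ∧ q = 0) := by
  obtain ⟨x, rfl⟩ := Set.ncard_eq_one.1 hW
  refine ⟨fun _ => x, ⟨fun _ _ => rfl, ?_, ?_⟩, fun p q => ?_⟩
  · intro i hi j hj _
    rw [hW, Set.mem_Iio] at hi hj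
    omega
  · rintro _ rfl
    exact ⟨0, by simp, rfl⟩
  · have h : ∀ p : Num V, p = 0 ↔ (p : ℕ) < 1 := fun p => by
      rw [Nat.lt_one_iff, Fin.ext_iff]
      rfl
    change p = 0 ∧ q = 0 ↔ _
    rw [hW, h p, h q]
    exact ⟨fun h => ⟨h, Or.inl rfl⟩, fun h => h.1⟩

end Children

/-! ### The code of a set with a prime quotient -/

section OrderedCode

/-- The code extracted from an ordered copy of the quotient graph. -/
def orderedCode (U : Type) [(withOrder loLang).Structure U] (p q : ℕ) : Prop :=
  let isV : U → Prop := fun v =>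
    Structure.RelMap (L := withOrder loLang) (n := 1) (Sum.inl LORel.V) ![v]
  let adj : U → U → Prop := fun v w =>
    Structure.RelMap (L := withOrder loLang) (n := 2) (Sum.inl LORel.E) ![v, w]
  let col : U → U → U → Prop := fun v c d =>
    Structure.RelMap (L := withOrder loLang) (n := 3) (Sum.inl LORel.L) ![v, c, d]
  let lt : U → U → Prop := fun v w =>
    Structure.RelMap (leSymb : (withOrder loLang).Relations 2) ![v, w] ∧ v ≠ w
  rankRel (fun y : U × U => isV y.1 ∧ col y.1 y.2 y.2)
    (fun y y' => lt y.1 y'.1 ∨ y.1 = y'.1 ∧ lt y.2 y'.2)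
    (fun y y' => y.1 = y'.1 ∧ col y.1 y.2 y'.2 ∨ y.1 ≠ y'.1 ∧ adj y.1 y'.1) p q

/-- The quotient of `G[W]` by its children, colored by codes of the children. -/
noncomputable def quotientLO (G : FinGraph) (W : Set G.V) (hW : W.Nonempty)
    (Kc : G.V → Num G.V → Num G.V → Prop) : LOColoredGraph where
  underlying := G.induce (childReps G.graph W) (nonempty_childReps hW)
  M := Num G.V
  L t := childColor G.graph W Kc t.1

variable {G : FinGraph} {W : Set G.V} {hW : W.Nonempty} {Kc : G.V → Num G.V → Num G.V → Prop}

/-- Closure under induced subgraphs enters here: the quotient is the subgraph induced on the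
representatives. -/
theorem quotientLO_mem {C : Set FinGraph} (hC : ClosedUnderInducedSubgraphs C) (hG : G ∈ C)
    (hc : ConnOn G.graph W ∧ ConnOn G.graphᶜ W) (hcard : W.ncard ≠ 1) :
    (quotientLO G W hW Kc).toStruct ∈ primeLOClass C := by
  refine ⟨_, ⟨hC G hG _ (nonempty_childReps hW), (isTransversal_childReps G.graph W).isPrime hc, ?_⟩, rfl⟩
  obtain ⟨x, hx⟩ := hW
  have : ∃ y ∈ W, x ≠ y := by
    by_contra! h
    exact hcard (Set.ncard_eq_one.2 ⟨x, Set.eq_singleton_iff_unique_mem.2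
      ⟨hx, fun y hy => (h y hy).symm⟩⟩)
  obtain ⟨y, hy, hxy⟩ := this
  exact (isTransversal_childReps G.graph W).four_le hc hx hy hxy

theorem isCode_orderedCode
    (hK : ∀ t ∈ childReps G.graph W,
      IsCode G.graph {y | childRel G.graph W t y} (childColor G.graph W Kc t))
    (B : FinStruct (withOrder loLang)) (hB : IsOrderedCopy B (quotientLO G W hW Kc).toStruct) :
    IsCode G.graph W (fun p q => orderedCode B.carrier p q) := by
  obtain ⟨hlin, hiso⟩ := hB
  let inst := (LHom.sumInl : loLang →ᴸ withOrder loLang).reduct B.carrier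
  obtain ⟨φ⟩ : Nonempty (B.carrier ≃[loLang] (quotientLO G W hW Kc).toStruct.carrier) := hiso
  have hrel : ∀ {n : ℕ} (P : loLang.Relations n) (x : Fin n → B.carrier),
      Structure.RelMap (L := withOrder loLang) (Sum.inl P) x ↔
        Structure.RelMap (M := (quotientLO G W hW Kc).toStruct.carrier) P (φ ∘ x) :=
    fun P x => (φ.map_rel P x).symm
  -- Elements of the wrong sort get arbitrary values under `e` and `eM`; only vertices, respectively
  -- color elements, are ever used.
  let e : B.carrier → G.V := fun v => Sum.elim (fun t : childReps G.graph W => t.1)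
    (fun _ => Classical.arbitrary _) (φ v)
  let eM : B.carrier → Num G.V := fun v => Sum.elim (fun _ => 0) id (φ v)
  have hV : ∀ v, Structure.RelMap (L := withOrder loLang) (n := 1) (Sum.inl LORel.V) ![v] ↔
      ∃ t : childReps G.graph W, φ v = Sum.inl t := fun v => hrel LORel.V ![v]
  have hE : ∀ v w, Structure.RelMap (L := withOrder loLang) (n := 2) (Sum.inl LORel.E) ![v, w] ↔
      ∃ t t' : childReps G.graph W, φ v = Sum.inl t ∧ φ w = Sum.inl t' ∧ G.graph.Adj t t' :=
    fun v w => hrel LORel.E ![v, w]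
  have hL : ∀ v c d, Structure.RelMap (L := withOrder loLang) (n := 3) (Sum.inl LORel.L) ![v, c, d] ↔
      ∃ (t : childReps G.graph W) (a b : Num G.V), φ v = Sum.inl t ∧ φ c = Sum.inr a ∧
        φ d = Sum.inr b ∧ childColor G.graph W Kc t a b :=
    fun v c d => hrel LORel.L ![v, c, d]
  have irrefl : ∀ v : B.carrier, ¬ (Structure.RelMap (leSymb : (withOrder loLang).Relations 2)
      ![v, v] ∧ v ≠ v) := fun v h => h.2 rfl
  have trans : ∀ u v w : B.carrier,
      Structure.RelMap (leSymb : (withOrder loLang).Relations 2) ![u, v] ∧ u ≠ v →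
      Structure.RelMap (leSymb : (withOrder loLang).Relations 2) ![v, w] ∧ v ≠ w →
      Structure.RelMap (leSymb : (withOrder loLang).Relations 2) ![u, w] ∧ u ≠ w := by
    rintro u v w ⟨h, hne⟩ ⟨h', hne'⟩
    refine ⟨hlin.trans u v w h h', ?_⟩
    rintro rfl
    exact hne (hlin.antisymm _ _ h h')
  have total : ∀ u v : B.carrier, u ≠ v →
      (Structure.RelMap (leSymb : (withOrder loLang).Relations 2) ![u, v] ∧ u ≠ v) ∨
      (Structure.RelMap (leSymb : (withOrder loLang).Relations 2) ![v, u] ∧ v ≠ u) :=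
    fun u v hne => (hlin.total u v).imp (fun h => ⟨h, hne⟩) fun h => ⟨h, hne.symm⟩
  refine IsCode.compose (isTransversal_childReps G.graph W) hK
    (fun v => Structure.RelMap (L := withOrder loLang) (n := 1) (Sum.inl LORel.V) ![v]) e ⟨?_, ?_, ?_⟩
    (fun c => ∃ d : Num G.V, φ c = Sum.inr d) eM ⟨fun _ _ => trivial, ?_, ?_⟩
    (fun v c d => Structure.RelMap (L := withOrder loLang) (n := 3) (Sum.inl LORel.L) ![v, c, d]) ?_
    (fun v w => Structure.RelMap (L := withOrder loLang) (n := 2) (Sum.inl LORel.E) ![v, w]) ?_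
    (fun v w => Structure.RelMap (leSymb : (withOrder loLang).Relations 2) ![v, w] ∧ v ≠ w)
    (fun v w => Structure.RelMap (leSymb : (withOrder loLang).Relations 2) ![v, w] ∧ v ≠ w) (fun v _ => irrefl v) (fun u v w _ _ _ => trans u v w)
    (fun u v _ _ => total u v) (fun v _ => irrefl v) (fun u v w _ _ _ => trans u v w)
    (fun u v _ _ => total u v)
  · intro v hv
    obtain ⟨t, ht⟩ := (hV v).1 hv
    simp only [e, ht, Sum.elim_inl]
    exact t.2
  · intro v hv v' hv' h
    obtain ⟨t, ht⟩ := (hV v).1 hv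
    obtain ⟨t', ht'⟩ := (hV v').1 hv'
    simp only [e, ht, ht', Sum.elim_inl] at h
    exact φ.injective (ht.trans (ht'.trans (by rw [Subtype.ext h])).symm)
  · intro t ht
    obtain ⟨v, hv⟩ := φ.surjective (Sum.inl ⟨t, ht⟩)
    refine ⟨v, (hV v).2 ⟨_, hv⟩, ?_⟩
    simp only [e, hv]
    rfl
  · rintro c ⟨d, hd⟩ c' ⟨d', hd'⟩ h
    simp only [eM, hd, hd', Sum.elim_inr, id] at h
    exact φ.injective (hd.trans (hd'.trans (by rw [h])).symm)
  · intro d _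
    obtain ⟨c, hc⟩ := φ.surjective (Sum.inr d)
    refine ⟨c, ⟨d, hc⟩, ?_⟩
    simp only [eM, hc]
    rfl
  · intro v c c' hv
    obtain ⟨t, ht⟩ := (hV v).1 hv
    rw [hL]
    constructor
    · rintro ⟨t', a, b, h, ha, hb, hK⟩
      refine ⟨⟨⟨a, ha⟩, b, hb⟩, ?_⟩
      simp only [e, eM, h, ha, hb, Sum.elim_inl, Sum.elim_inr, id]
      exact hK
    · rintro ⟨⟨⟨a, ha⟩, b, hb⟩, hK⟩
      simp only [e, eM, ht, ha, hb, Sum.elim_inl, Sum.elim_inr, id] at hK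
      exact ⟨t, a, b, ht, ha, hb, hK⟩
  · intro v v' hv hv' hne
    obtain ⟨t, ht⟩ := (hV v).1 hv
    obtain ⟨t', ht'⟩ := (hV v').1 hv'
    rw [hE]
    simp only [e, ht, ht', Sum.elim_inl]
    constructor
    · rintro ⟨s, s', h, h', hadj⟩
      cases Sum.inl_injective h
      cases Sum.inl_injective h'
      exact hadj
    · exact fun h => ⟨t, t', rfl, rfl, h⟩

theorem not_lexLt_iff {α : Type} [LinearOrder α] [Finite α] (K K' : α → α → Prop) :
    ¬ lexLt K K' ↔ relToLex K' ≤ relToLex K :=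
  (lexLt_iff K K').not.trans not_lt

/-- The code of a set with a prime quotient: the smallest among the codes for all parameters. -/
def primeCode {a b : ℕ} (Θ : OrdTransduction loLang a b) (G : FinGraph) (W : Set G.V)
    (hW : W.Nonempty) (Kc : G.V → Num G.V → Num G.V → Prop) (p q : Num G.V) : Prop :=
  let A := (quotientLO G W hW Kc).toStruct
  let K : Tup A.carrier a b → Num G.V → Num G.V → Prop :=
    fun t p q => orderedCode (Θ.Universe A t.1 t.2 (RelAssign.none _)) p q
  ∃ t : Tup A.carrier a b, (Θ.InDom A t.1 t.2 (RelAssign.none _) ∧ K t p q) ∧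
    ∀ t' : Tup A.carrier a b, Θ.InDom A t'.1 t'.2 (RelAssign.none _) → ¬ lexLt (K t') (K t)

/-- A least code exists because the finite set of admissible parameters is non-empty. All minimal
parameters give the same code, so the existential quantifier in `primeCode` merges nothing and the
choice of parameters disappears. -/
theorem isCode_primeCode {a b : ℕ} {Θ : OrdTransduction loLang a b}
    (hΘ : Canonizes Θ (quotientLO G W hW Kc).toStruct)
    (hK : ∀ t ∈ childReps G.graph W,
      IsCode G.graph {y | childRel G.graph W t y} (childColor G.graph W Kc t)) :
    IsCode G.graph W (primeCode Θ G W hW Kc) := by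
  obtain ⟨⟨t₀, ht₀⟩, hΘ⟩ := hΘ
  let A := (quotientLO G W hW Kc).toStruct
  let K : Tup A.carrier a b → Num G.V → Num G.V → Prop :=
    fun t p q => orderedCode (Θ.Universe A t.1 t.2 (RelAssign.none _)) p q
  have hfin : Finite (Tup A.carrier a b) := inferInstance
  obtain ⟨t, ht, hmin⟩ := Set.exists_min_image {t : Tup A.carrier a b |
    Θ.InDom A t.1 t.2 (RelAssign.none _)} (fun t => relToLex (K t)) (Set.toFinite _) ⟨t₀, ht₀⟩
  have e : primeCode Θ G W hW Kc = K t := by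
    funext p q
    refine propext ⟨?_, fun h => ⟨t, ⟨ht, h⟩, fun t' ht' => ?_⟩⟩
    · rintro ⟨t', ⟨ht', h⟩, h'⟩
      have h₁ := (not_lexLt_iff (K t) (K t')).1 (h' t ht)
      rw [relToLex_injective (le_antisymm (hmin t' ht') h₁)]
      exact h
    · exact (not_lexLt_iff (K t') (K t)).2 (hmin t' ht')
  rw [e]
  exact isCode_orderedCode hK _ (hΘ t ht)

/-- The code of a set of vertices from the codes of its children. -/
def stepCode {a b : ℕ} (Θ : OrdTransduction loLang a b) (G : FinGraph) (W : Set G.V)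
    (hW : W.Nonempty) (Kc : G.V → Num G.V → Num G.V → Prop) (p q : Num G.V) : Prop :=
  (W.ncard = 1 ∧ p = 0 ∧ q = 0) ∨ W.ncard ≠ 1 ∧
    ((¬ (ConnOn G.graph W ∧ ConnOn G.graphᶜ W) ∧ flatCode G.graph W Kc p q) ∨
      (ConnOn G.graph W ∧ ConnOn G.graphᶜ W) ∧ primeCode Θ G W hW Kc p q)

theorem isCode_stepCode {C : Set FinGraph} (hC : ClosedUnderInducedSubgraphs C) (hG : G ∈ C)
    {a b : ℕ} {Θ : OrdTransduction loLang a b} (hΘ : ∀ A ∈ primeLOClass C, Canonizes Θ A)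
    (hK : W.ncard ≠ 1 → ∀ t ∈ W, IsCode G.graph {y | childRel G.graph W t y} (Kc t))
    (hKc : ∀ y z, childRel G.graph W y z → Kc y = Kc z) :
    IsCode G.graph W (stepCode Θ G W hW Kc) := by
  by_cases h₁ : W.ncard = 1
  · have : stepCode Θ G W hW Kc = fun p q => p = 0 ∧ q = 0 := by
      funext p q
      simp [stepCode, h₁]
    rw [this]
    exact isCode_singleton h₁
  have hK' : ∀ t ∈ childReps G.graph W,
      IsCode G.graph {y | childRel G.graph W t y} (childColor G.graph W Kc t) := fun t ht => by
    rw [childColor_eq hKc]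
    exact hK h₁ t ((isTransversal_childReps G.graph W).subset ht)
  by_cases h₂ : ConnOn G.graph W ∧ ConnOn G.graphᶜ W
  · have : stepCode Θ G W hW Kc = primeCode Θ G W hW Kc := by
      funext p q
      simp [stepCode, h₁, h₂]
    rw [this]
    exact isCode_primeCode (hΘ _ (quotientLO_mem hC hG h₂ h₁)) hK'
  · have : stepCode Θ G W hW Kc = fun p q : Num G.V => flatCode G.graph W Kc p q := by
      funext p q
      simp only [stepCode, h₁, h₂, ne_eq, not_false_eq_true, false_and, true_and, false_or,
        or_false]
    rw [this]
    exact isCode_flatCode hW h₂ hK'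

end OrderedCode

end

/-! ### Definability of one coding step. -/

section

/-! ### Definability of the results of transductions -/

section

variable {τ : FirstOrder.Language.{0, 0}} {𝔅 : Base τ} {J : 𝔅.I → Type} {Δ : Ctx 𝔅 J}

theorem NTerm.toBase {f : ∀ b, J b → ℕ} (h : NTerm Δ f) {J' : Δ.toBase.I → Type}
    (Γ : Ctx Δ.toBase J') : NTerm Γ (fun b _ => f b.1 (Δ.pt b)) := by
  have : NTerm (Ctx.nil Δ.toBase) (fun b _ => f b.1 (Δ.pt b)) := by
    obtain ⟨K, L, _, _, ψ, h⟩ := h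
    refine ⟨K, L, ‹_›, ‹_›, ψ, fun b s n r j hj => ?_⟩
    obtain ⟨rfl, rfl, rfl⟩ := hj
    exact h _ _ _ _ _ (Δ.pt_rep b)
  exact this.comp Mor.nil

variable {τ₂ : FirstOrder.Language.{0, 0}} (B : 𝔅.I → FinStruct τ₂)
  [Srt 𝔅 (fun b => (B b).carrier)]

theorem Term.numOf {p : ∀ b, J b → Num (B b).carrier} (h : NTerm Δ (fun b j => (p b j : ℕ))) :
    letI := Srt.numOf B
    Term Δ p := by
  let := Srt.numOf B
  exact (NTerm.eq (NTerm.numOf B (Term.var0 (Δ := Δ) (X := fun b => Num (B b).carrier))) h.w).congr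
    fun b j => Fin.ext_iff.symm

variable (hrel : ∀ {n : ℕ} (P : τ₂.Relations n),
  DRel₁ (X := fun b => Fin n → (B b).carrier) fun b x => Structure.RelMap P x)

variable {τ₃ : FirstOrder.Language.{0, 0}} [τ₃.IsRelational] {S N : Type}
  (Θ : Transduction τ₂ τ₃ S N noRel) {s : ∀ b, S → (B b).carrier} {n : ∀ b, N → Num (B b).carrier}

include hrel in
theorem Def.holds {m : ℕ}
    (φ : Formula τ₂ (S ⊕ Fin m × Fin Θ.k) (N ⊕ Fin m × Fin Θ.l) noRel) :
    letI := Srt.numOf B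
    ∀ {s : ∀ b, J b → S → (B b).carrier} {n : ∀ b, J b → N → Num (B b).carrier}
      {t : ∀ b, J b → Fin m → Tup (B b).carrier Θ.k Θ.l},
      (∀ x, Term Δ fun b j => s b j x) → (∀ x, Term Δ fun b j => n b j x) →
      (∀ i, Term Δ (X := fun b => Tup (B b).carrier Θ.k Θ.l) fun b j => t b j i) →
      Def Δ fun b j => Θ.holds (B b) (s b j) (n b j) (RelAssign.none _) φ (t b j) := by
  let := Srt.numOf B
  intro s n t hs hn ht
  refine Formula.pull B hrel φ Δ _ _ _ ?_ ?_ (fun k l X => X.elim)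
  · rintro (x | ⟨i, k⟩)
    · exact hs x
    · exact (ht i).fst.proj k
  · rintro (x | ⟨i, k⟩)
    · exact hn x
    · exact (ht i).snd.proj k

include hrel in
theorem Def.mem_univSet :
    letI := Srt.numOf B
    ∀ {s : ∀ b, J b → S → (B b).carrier} {n : ∀ b, J b → N → Num (B b).carrier}
      {t : ∀ b, J b → Tup (B b).carrier Θ.k Θ.l},
      (∀ x, Term Δ fun b j => s b j x) → (∀ x, Term Δ fun b j => n b j x) →
      Term Δ (X := fun b => Tup (B b).carrier Θ.k Θ.l) t →
      Def Δ fun b j => t b j ∈ Θ.univSet (B b) (s b j) (n b j) (RelAssign.none _) := by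
  let := Srt.numOf B
  intro s n t hs hn ht
  refine Formula.pull B hrel Θ.univ Δ _ _ _ ?_ ?_ (fun k l X => X.elim)
  · rintro (x | k)
    · exact hs x
    · exact ht.fst.proj k
  · rintro (x | k)
    · exact hn x
    · exact ht.snd.proj k

include hrel in
theorem Def.inDom :
    letI := Srt.numOf B
    ∀ {s : ∀ b, J b → S → (B b).carrier} {n : ∀ b, J b → N → Num (B b).carrier},
      (∀ x, Term Δ fun b j => s b j x) → (∀ x, Term Δ fun b j => n b j x) →
      Def Δ fun b j => Θ.InDom (B b) (s b j) (n b j) (RelAssign.none _) := by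
  let := Srt.numOf B
  intro s n hs hn
  refine Def.and (Formula.pull B hrel Θ.dom Δ _ _ _ hs hn fun k l X => X.elim)
    (Def.ex (X := fun b => Tup (B b).carrier Θ.k Θ.l) (Def.mem_univSet B hrel Θ
      (fun x => (hs x).w) (fun x => (hn x).w) Term.var0))

-- The universe is a quotient of a definable set of tuples by a generated equivalence relation,
-- which is a fixed point. The parameters must be constants of the base, because the presented set
-- depends on them.
include hrel in
theorem exists_srt_universe :
    letI := Srt.numOf B
    (∀ x, DConst fun b => s b x) → (∀ x, DConst fun b => n b x) →
    ∃ _ : Srt 𝔅 (fun b => Θ.Universe (B b) (s b) (n b) (RelAssign.none _)),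
      ∀ {m : ℕ} (P : τ₃.Relations m),
        DRel₁ (X := fun b => Fin m → Θ.Universe (B b) (s b) (n b) (RelAssign.none _))
          fun b x => Structure.RelMap P x := by
  let := Srt.numOf B
  intro hs hn
  have hs' : ∀ {J : 𝔅.I → Type} {Δ : Ctx 𝔅 J} x, Term Δ fun b _ => s b x := fun x => (hs x).term
  have hn' : ∀ {J : 𝔅.I → Type} {Δ : Ctx 𝔅 J} x, Term Δ fun b _ => n b x := fun x => (hn x).term
  let f : ∀ b, Tup (B b).carrier Θ.k Θ.l →
      Θ.Universe (B b) (s b) (n b) (RelAssign.none _) → Prop := fun b t u =>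
    ∃ h : t ∈ Θ.univSet (B b) (s b) (n b) (RelAssign.none _), Θ.cls _ _ _ _ ⟨t, h⟩ = u
  have func : ∀ b x y y', f b x y → f b x y' → y = y' := by
    rintro b x y y' ⟨h, rfl⟩ ⟨h', rfl⟩
    rfl
  have surj : ∀ b y, ∃ x, f b x y := by
    intro b y
    obtain ⟨⟨t, ht⟩, rfl⟩ := Quotient.exists_rep y
    exact ⟨t, ht, rfl⟩
  have hker : DRel₂ (X := fun b => Tup (B b).carrier Θ.k Θ.l)
      (Y := fun b => Tup (B b).carrier Θ.k Θ.l) (fun b x x' => ∃ y, f b x y ∧ f b x' y) := by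
    refine Def.congr (Def.and (Def.and (Def.mem_univSet B hrel Θ hs' hn' Term.var1)
      (Def.mem_univSet B hrel Θ hs' hn' Term.var0)) (Def.eqvGen
        (X := fun b => Tup (B b).carrier Θ.k Θ.l)
        (r := fun b j t t' => Θ.holds (B b) (s b) (n b) (RelAssign.none _) Θ.equiv ![t, t'])
        (Def.holds B hrel Θ Θ.equiv hs' hn' ?_) Term.var1 Term.var0)) ?_
    · intro i
      match i with
      | 0 => exact Term.var1
      | 1 => exact Term.var0
    · intro b j
      constructor
      · rintro ⟨⟨h, h'⟩, h''⟩
        exact ⟨_, ⟨h, rfl⟩, h', (Quotient.sound h'').symm⟩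
      · rintro ⟨y, ⟨h, rfl⟩, h', h''⟩
        exact ⟨⟨h, h'⟩, Quotient.exact h''.symm⟩
  have hf := Srt.image_def f func surj hker
  let inst := Srt.image f func surj hker
  refine ⟨inst, fun {m} P => ?_⟩
  refine Def.congr (Def.ex (X := fun b => Fin m → Tup (B b).carrier Θ.k Θ.l)
    (P := fun b j t => (∀ i, f b (t i) (j.2 i)) ∧ Θ.holds (B b) (s b) (n b) (RelAssign.none _) (Θ.rel P) t)
    (Def.and (Def.finAll fun i => hf.app (Term.proj Term.var0 i) (Term.proj Term.var1 i))
      (Def.holds B hrel Θ (Θ.rel P) hs' hn' fun i => Term.proj Term.var0 i))) fun b j => ?_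
  constructor
  · rintro ⟨t, ht, h⟩
    choose h' ht using ht
    exact ⟨fun i => ⟨t i, h' i⟩, ht, h⟩
  · rintro ⟨t, ht, h⟩
    exact ⟨fun i => (t i).1, fun i => ⟨(t i).2, ht i⟩, h⟩

end

section OrderedCode

variable {τ : FirstOrder.Language.{0, 0}} {𝔅 : Base τ}

theorem DRel₂.orderedCode {U : 𝔅.I → Type} [Srt 𝔅 U] [∀ b, (withOrder loLang).Structure (U b)]
    (hrel : ∀ {n : ℕ} (P : (withOrder loLang).Relations n),
      DRel₁ (X := fun b => Fin n → U b) fun b x => Structure.RelMap P x) :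
    DRel₂ (X := fun b => Num (𝔅.A b).carrier) (Y := fun b => Num (𝔅.A b).carrier)
      fun b p q => FPC.orderedCode (U b) p q := by
  have h₁ : ∀ {J : 𝔅.I → Type} {Δ : Ctx 𝔅 J} {v : ∀ b, J b → U b} (P : (withOrder loLang).Relations 1),
      Term Δ v → Def Δ fun b j => Structure.RelMap P ![v b j] := by
    intro J Δ v P hv
    refine (hrel P).app (Term.pi fun i => ?_)
    match i with
    | 0 => exact hv
  have h₂ : ∀ {J : 𝔅.I → Type} {Δ : Ctx 𝔅 J} {v w : ∀ b, J b → U b}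
      (P : (withOrder loLang).Relations 2),
      Term Δ v → Term Δ w → Def Δ fun b j => Structure.RelMap P ![v b j, w b j] := by
    intro J Δ v w P hv hw
    refine (hrel P).app (Term.pi fun i => ?_)
    match i with
    | 0 => exact hv
    | 1 => exact hw
  have h₃ : ∀ {J : 𝔅.I → Type} {Δ : Ctx 𝔅 J} {u v w : ∀ b, J b → U b}
      (P : (withOrder loLang).Relations 3),
      Term Δ u → Term Δ v → Term Δ w → Def Δ fun b j => Structure.RelMap P ![u b j, v b j, w b j] := by
    intro J Δ u v w P hu hv hw
    refine (hrel P).app (Term.pi fun i => ?_)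
    match i with
    | 0 => exact hu
    | 1 => exact hv
    | 2 => exact hw
  have hlt : ∀ {J : 𝔅.I → Type} {Δ : Ctx 𝔅 J} {v w : ∀ b, J b → U b}, Term Δ v → Term Δ w →
      Def Δ fun b j => Structure.RelMap (leSymb : (withOrder loLang).Relations 2) ![v b j, w b j] ∧
        v b j ≠ w b j := fun hv hw => (h₂ _ hv hw).and (hv.eq hw).not
  refine DRel₂.rankRel (Y := fun b => U b × U b) (Def.and (h₁ _ Term.var0.fst)
      (h₃ _ Term.var0.fst Term.var0.snd Term.var0.snd))
    (Def.or (hlt Term.var1.fst Term.var0.fst) (Def.and (Term.var1.fst.eq Term.var0.fst)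
      (hlt Term.var1.snd Term.var0.snd)))
    (Def.or (Def.and (Term.var1.fst.eq Term.var0.fst) (h₃ _ Term.var1.fst Term.var1.snd Term.var0.snd))
      (Def.and (Def.not (Term.var1.fst.eq Term.var0.fst)) (h₂ _ Term.var1.fst Term.var0.fst)))

/-- The codes from the results of a transduction are definable from the parameters. -/
theorem DRel₃.orderedCode (B : 𝔅.I → FinStruct loLang) [Srt 𝔅 (fun b => (B b).carrier)]
    (hrel : ∀ {n : ℕ} (P : loLang.Relations n),
      DRel₁ (X := fun b => Fin n → (B b).carrier) fun b x => Structure.RelMap P x)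
    {k l : ℕ} (Θ : OrdTransduction loLang k l) :
    letI := Srt.numOf B
    DRel₃ (X := fun b => Tup (B b).carrier k l) (Y := fun b => Num (𝔅.A b).carrier)
      (Z := fun b => Num (𝔅.A b).carrier)
      fun b t p q => FPC.orderedCode (Θ.Universe (B b) t.1 t.2 (RelAssign.none _)) p q := by
  let := Srt.numOf B
  let Δ := (((Ctx.nil 𝔅).ext fun b => Tup (B b).carrier k l).ext
    fun b => Num (𝔅.A b).carrier).ext fun b => Num (𝔅.A b).carrier
  let i₁ : Srt Δ.toBase (fun b => (B b.1).carrier) := Srt.toBase Δ fun b => (B b).carrier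
  have hrel' : ∀ {n : ℕ} (P : loLang.Relations n),
      DRel₁ (𝔅 := Δ.toBase) (X := fun b => Fin n → (B b.1).carrier)
        fun b x => Structure.RelMap P x := fun {n} P =>
    Def.toBase_ext (Δ := Δ) (X := fun b => Fin n → (B b).carrier)
      (P := fun b j => Structure.RelMap P j.2) ((hrel P).app Term.var0) (Ctx.nil _)
  have ht : Term Δ (X := fun b => Tup (B b).carrier k l) fun b j => j.1.1.2 := Term.var2
  let t : ∀ b : Δ.toBase.I, Tup (B b.1).carrier k l := fun b => (Δ.pt b).1.1.2
  -- The structure produced varies with the parameters `t`, so they are made constants by passing to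
  -- `Δ.toBase`.
  obtain ⟨i₂, hU⟩ := exists_srt_universe (𝔅 := Δ.toBase) (fun b => B b.1) hrel' Θ
    (s := fun b => (t b).1) (n := fun b => (t b).2)
    (fun x => Term.toBase (Δ := Δ) (X := fun b => (B b).carrier) (a := fun b j => j.1.1.2.1 x)
      (ht.fst.proj x) _)
    -- The new base chooses its own tuple length for coding the numbers of `B`; number parameters
    -- are therefore transferred through their values.
    (fun x => Term.numOf (𝔅 := Δ.toBase) (fun b => B b.1)
      (NTerm.toBase (Δ := Δ) (f := fun b j => (j.1.1.2.2 x : ℕ)) (NTerm.numOf B (ht.snd.proj x)) _))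
  exact Def.of_toBase (Δ := Δ) (P := fun b j => FPC.orderedCode
    (Θ.Universe (B b) j.1.1.2.1 j.1.1.2.2 (RelAssign.none _)) j.1.2 j.2)
    ((DRel₂.orderedCode hU).app (Term.toBase (Δ := Δ) (X := fun b => Num (𝔅.A b).carrier)
        (a := fun b j => j.1.2) Term.var1 _)
      (Term.toBase (Δ := Δ) (X := fun b => Num (𝔅.A b).carrier)
        (a := fun b j => j.2) Term.var0 _))

end OrderedCode

end

section

/-! ### Definability of the codes -/

/-- The graph encoded by a structure, as a finite graph. -/
abbrev FinStruct.toFinGraph (A : FinStruct FirstOrder.Language.graph) : FinGraph where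
  V := A.carrier
  graph := structGraph A

theorem toFinGraph_toStruct (G : FinGraph) : G.toStruct.toFinGraph = G := by
  have h := structGraph_toStruct G
  cases G
  simp only [FinStruct.toFinGraph, h]
  rfl

section Step

variable {𝔅 : Base FirstOrder.Language.graph} {W : ∀ b, Set (𝔅.A b).carrier}
  {Kc : ∀ b, (𝔅.A b).carrier → Num (𝔅.A b).carrier → Num (𝔅.A b).carrier → Prop}
  (hW : DRel₁ (X := fun b => (𝔅.A b).carrier) fun b x => x ∈ W b)
  (hK : DRel₃ (X := fun b => (𝔅.A b).carrier) (Y := fun b => Num (𝔅.A b).carrier)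
    (Z := fun b => Num (𝔅.A b).carrier) Kc)

include hW in
theorem DRel₂.structChildRel : DRel₂ (X := fun b => (𝔅.A b).carrier)
    (Y := fun b => (𝔅.A b).carrier) fun b x y => FPC.childRel (structGraph (𝔅.A b)) (W b) x y :=
  DRel₂.childRel (DRel₂.adj 𝔅) hW

include hW hK in
theorem DRel₃.childColor : DRel₃ (X := fun b => (𝔅.A b).carrier)
    (Y := fun b => Num (𝔅.A b).carrier) (Z := fun b => Num (𝔅.A b).carrier)
    fun b y p q => FPC.childColor (structGraph (𝔅.A b)) (W b) (Kc b) y p q :=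
  Def.ex (X := fun b => (𝔅.A b).carrier) (Def.and
    ((DRel₂.structChildRel hW).app Term.var3 Term.var0) (hK.app Term.var0 Term.var2 Term.var1))

-- A representative is presented by all vertices of its child; two vertices present the same one iff
-- they lie in `W` and are equivalent.
include hW in
theorem exists_srt_childReps :
    ∃ _ : Srt 𝔅 (fun b => childReps (structGraph (𝔅.A b)) (W b)),
      DRel₂ (X := fun b => (𝔅.A b).carrier) (Y := fun b => childReps (structGraph (𝔅.A b)) (W b))
        fun b v t => FPC.childRel (structGraph (𝔅.A b)) (W b) v t := by
  have hT := fun b => isTransversal_childReps (structGraph (𝔅.A b)) (W b)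
  have func : ∀ b v (t t' : childReps (structGraph (𝔅.A b)) (W b)),
      FPC.childRel (structGraph (𝔅.A b)) (W b) v t →
      FPC.childRel (structGraph (𝔅.A b)) (W b) v t' → t = t' := fun b v t t' h h' =>
    Subtype.ext ((hT b).eq_of_childRel _ t.2 _ t'.2
      (childRel_equivalence.trans (childRel_equivalence.symm h) h'))
  have hker : DRel₂ (X := fun b => (𝔅.A b).carrier) (Y := fun b => (𝔅.A b).carrier)
      fun b v v' => ∃ t : childReps (structGraph (𝔅.A b)) (W b),
        FPC.childRel (structGraph (𝔅.A b)) (W b) v t ∧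
        FPC.childRel (structGraph (𝔅.A b)) (W b) v' t := by
    refine (Def.and (hW.app Term.var1) (DRel₂.structChildRel hW)).congr fun b j => ?_
    constructor
    · rintro ⟨hv, h⟩
      obtain ⟨t, ht, hvt⟩ := (hT b).exists_childRel _ hv
      exact ⟨⟨t, ht⟩, hvt, childRel_equivalence.trans (childRel_equivalence.symm h) hvt⟩
    · rintro ⟨t, h, h'⟩
      exact ⟨(childRel_equivalence.symm h).mem ((hT b).subset t.2),
        childRel_equivalence.trans h (childRel_equivalence.symm h')⟩
  exact ⟨Srt.image (X := fun b => (𝔅.A b).carrier)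
      (fun b v (t : childReps (structGraph (𝔅.A b)) (W b)) =>
        FPC.childRel (structGraph (𝔅.A b)) (W b) v t)
      func (fun b t => ⟨t, Or.inl rfl⟩) hker, Srt.image_def _ _ _ _⟩

include hW hK in
theorem DRel₂.flatCode : DRel₂ (X := fun b => Num (𝔅.A b).carrier)
    (Y := fun b => Num (𝔅.A b).carrier)
    fun b p q => FPC.flatCode (structGraph (𝔅.A b)) (W b) (Kc b) p q := by
  obtain ⟨inst, hT⟩ := exists_srt_childReps hW
  let T : 𝔅.I → Type := fun b => childReps (structGraph (𝔅.A b)) (W b)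
  have hc : ∀ {J : 𝔅.I → Type} {Δ : Ctx 𝔅 J} {t : ∀ b, J b → T b}
      {p q : ∀ b, J b → Num (𝔅.A b).carrier}, Term Δ t → Term Δ p → Term Δ q →
      Def Δ fun b j =>
        FPC.childColor (structGraph (𝔅.A b)) (W b) (Kc b) (t b j).1 (p b j) (q b j) := by
    intro J Δ t p q ht hp hq
    refine Def.congr (Def.ex (X := fun b => (𝔅.A b).carrier)
      (P := fun b j v => FPC.childRel (structGraph (𝔅.A b)) (W b) v (t b j).1 ∧
        Kc b v (p b j) (q b j))
      (Def.and (hT.app Term.var0 ht.w) (hK.app Term.var0 hp.w hq.w))) fun b j => ?_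
    exact exists_congr fun v => and_congr_left fun _ =>
      ⟨childRel_equivalence.symm, childRel_equivalence.symm⟩
  have hlex : ∀ {J : 𝔅.I → Type} {Δ : Ctx 𝔅 J} {t t' : ∀ b, J b → T b}, Term Δ t → Term Δ t' →
      Def Δ fun b j => FPC.lexLt
        (FPC.childColor (structGraph (𝔅.A b)) (W b) (Kc b) (t b j).1)
        (FPC.childColor (structGraph (𝔅.A b)) (W b) (Kc b) (t' b j).1) := fun ht ht' =>
    Def.lexLt (hc ht.w.w Term.var1 Term.var0) (hc ht'.w.w Term.var1 Term.var0)
  have hs : DRel₃ (X := fun b => Num (𝔅.A b).carrier) (Y := fun b => Num (𝔅.A b).carrier)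
      (Z := fun b => Num (𝔅.A b).carrier)
      fun b i p q => sortedColor (structGraph (𝔅.A b)) (W b) (Kc b) i p q := by
    refine Def.ex (X := T) (Def.and (Def.and (NTerm.le (NTerm.ncard (X := T) ?_)
      (NTerm.num Term.var3)) (NTerm.lt (NTerm.num Term.var3) (NTerm.ncard (X := T) ?_))) ?_)
    · exact hlex Term.var0 Term.var1
    · exact (hlex Term.var1 Term.var0).not
    · exact hc Term.var0 Term.var2 Term.var1
  have hcard : ∀ {J : 𝔅.I → Type} {Δ : Ctx 𝔅 J},
      NTerm Δ fun b _ => Nat.card (childReps (structGraph (𝔅.A b)) (W b)) := fun {J Δ} =>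
    (NTerm.ncard (X := T) (P := fun _ _ _ => True) (Def.const True)).congr fun b _ => Set.ncard_univ _
  have hconn : ∀ {J : 𝔅.I → Type} {Δ : Ctx 𝔅 J},
      Def Δ fun b _ => ConnOn (structGraph (𝔅.A b)) (W b) := Def.connOn (DRel₂.adj 𝔅) hW
  exact DRel₂.rankRel (Y := fun b => Num (𝔅.A b).carrier × Num (𝔅.A b).carrier)
    (Def.and (NTerm.lt (NTerm.num Term.var0.fst) hcard)
      (hs.app Term.var0.fst Term.var0.snd Term.var0.snd))
    (Def.or (Def.lt Term.var1.fst Term.var0.fst) (Def.and (Term.var1.fst.eq Term.var0.fst)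
      (Def.lt Term.var1.snd Term.var0.snd)))
    (Def.or (Def.and (Term.var1.fst.eq Term.var0.fst)
        (hs.app Term.var1.fst Term.var1.snd Term.var0.snd))
      (Def.and (Def.not (Term.var1.fst.eq Term.var0.fst)) hconn))

variable (hne : ∀ b, (W b).Nonempty)

-- The disjoint union of children and numbers is presented by triples `(v, tag, d)`: with tag `0`
-- the child of `v` is meant, with any other tag the color element `d`. Relations on children are
-- evaluated at arbitrary members, which is harmless as adjacency and colors are invariant.
include hW hK in
theorem exists_srt_quotientLO :
    ∃ _ : Srt 𝔅 (fun b => (quotientLO (𝔅.A b).toFinGraph (W b) (hne b) (Kc b)).toStruct.carrier),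
      ∀ {n : ℕ} (P : loLang.Relations n),
        DRel₁ (X := fun b => Fin n →
            (quotientLO (𝔅.A b).toFinGraph (W b) (hne b) (Kc b)).toStruct.carrier)
          fun b x => Structure.RelMap P x := by
  have hT := fun b => isTransversal_childReps (structGraph (𝔅.A b)) (W b)
  let V : 𝔅.I → Type := fun b => (𝔅.A b).carrier
  let N : 𝔅.I → Type := fun b => Num (𝔅.A b).carrier
  let Y : 𝔅.I → Type := fun b => childReps (structGraph (𝔅.A b)) (W b) ⊕ N b
  let f : ∀ b, V b × N b × N b → Y b → Prop := fun b x y =>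
    (x.2.1 = 0 ∧ ∃ t, y = Sum.inl t ∧ FPC.childRel (structGraph (𝔅.A b)) (W b) x.1 t) ∨
      x.2.1 ≠ 0 ∧ y = Sum.inr x.2.2
  have func : ∀ b x y y', f b x y → f b x y' → y = y' := by
    rintro b x y y' (⟨h, t, rfl, ht⟩ | ⟨h, rfl⟩) (⟨h', t', rfl, ht'⟩ | ⟨h', rfl⟩)
    · rw [Subtype.ext ((hT b).eq_of_childRel _ t.2 _ t'.2
        (childRel_equivalence.trans (childRel_equivalence.symm ht) ht'))]
    · exact (h' h).elim
    · exact (h h').elim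
    · rfl
  -- A non-empty universe provides a second tag.
  have hlast : ∀ b, Fin.last (Nat.card (𝔅.A b).carrier) ≠ 0 := fun b h =>
    (Nat.card_pos (α := (𝔅.A b).carrier)).ne' (congrArg Fin.val h)
  have surj : ∀ b y, ∃ x, f b x y := by
    rintro b (t | d)
    · exact ⟨(t, 0, 0), Or.inl ⟨rfl, t, rfl, Or.inl rfl⟩⟩
    · exact ⟨(Classical.arbitrary _, Fin.last _, d), Or.inr ⟨hlast b, rfl⟩⟩
  have hker : DRel₂ (X := fun b => V b × N b × N b) (Y := fun b => V b × N b × N b)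
      fun b x x' => ∃ y, f b x y ∧ f b x' y := by
    refine (Def.or (Def.and (Def.and (Term.var1.snd.fst.eq Term.zero)
        (Term.var0.snd.fst.eq Term.zero)) (Def.and (hW.app Term.var1.fst)
          ((DRel₂.structChildRel hW).app Term.var1.fst Term.var0.fst)))
      (Def.and (Def.and (Def.not (Term.var1.snd.fst.eq Term.zero))
        (Def.not (Term.var0.snd.fst.eq Term.zero))) (Term.var1.snd.snd.eq Term.var0.snd.snd))).congr
        fun b j => ?_
    constructor
    · rintro (⟨⟨h, h'⟩, hv, hvv'⟩ | ⟨⟨h, h'⟩, hd⟩)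
      · obtain ⟨t, ht, hvt⟩ := (hT b).exists_childRel _ hv
        exact ⟨Sum.inl ⟨t, ht⟩, Or.inl ⟨h, _, rfl, hvt⟩, Or.inl ⟨h', _, rfl,
          childRel_equivalence.trans (childRel_equivalence.symm hvv') hvt⟩⟩
      · exact ⟨_, Or.inr ⟨h, rfl⟩, Or.inr ⟨h', congrArg _ hd⟩⟩
    · rintro ⟨y, ⟨h, t, rfl, ht⟩ | ⟨h, rfl⟩, ⟨h', t', e, ht'⟩ | ⟨h', e⟩⟩
      · cases Sum.inl_injective e
        exact Or.inl ⟨⟨h, h'⟩, (childRel_equivalence.symm ht).mem ((hT b).subset t.2),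
          childRel_equivalence.trans ht (childRel_equivalence.symm ht')⟩
      · cases e
      · cases e
      · exact Or.inr ⟨⟨h, h'⟩, Sum.inr_injective e⟩
  let inst : Srt 𝔅 Y := Srt.image f func surj hker
  have hf : DRel₂ (X := fun b => V b × N b × N b) (Y := Y) f := Srt.image_def f func surj hker
  have hinl : ∀ {J : 𝔅.I → Type} {Δ : Ctx 𝔅 J} {v : ∀ b, J b → V b} {y : ∀ b, J b → Y b},
      Term Δ v → Term Δ y → Def Δ fun b j => ∃ t, y b j = Sum.inl t ∧
        FPC.childRel (structGraph (𝔅.A b)) (W b) (v b j) t := by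
    intro J Δ v y hv hy
    refine (hf.app (hv.pair (Term.zero.pair Term.zero)) hy).congr fun b j => ⟨?_, ?_⟩
    · rintro (⟨-, h⟩ | ⟨h, -⟩)
      · exact h
      · exact (h rfl).elim
    · exact fun h => Or.inl ⟨rfl, h⟩
  have hinr : ∀ {J : 𝔅.I → Type} {Δ : Ctx 𝔅 J} {d : ∀ b, J b → N b} {y : ∀ b, J b → Y b},
      Term Δ d → Term Δ y → Def Δ fun b j => y b j = Sum.inr (d b j) := by
    intro J Δ d y hd hy
    refine (Def.ex (X := V) (P := fun b j v => f b (v, Fin.last _, d b j) (y b j))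
      (hf.app (Term.var0.pair (Term.last.pair hd.w)) hy.w)).congr fun b j => ⟨?_, ?_⟩
    · rintro ⟨v, ⟨h, -⟩ | ⟨-, h⟩⟩
      · exact (hlast b h).elim
      · exact h
    · exact fun h => ⟨Classical.arbitrary _, Or.inr ⟨hlast b, h⟩⟩
  refine ⟨inst, fun {n} P => ?_⟩
  cases P with
  | V =>
    have h : DRel₁ (X := fun b => Fin 1 → Y b) fun b x => ∃ v : V b, (∃ t : childReps (structGraph (𝔅.A b)) (W b), x 0 = Sum.inl t ∧
          FPC.childRel (structGraph (𝔅.A b)) (W b) v t) :=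
      Def.ex (hinl Term.var0 (Term.var1.proj (0 : Fin 1)))
    refine Def.congr h fun b j => ⟨?_, ?_⟩
    · rintro ⟨v, t, h, -⟩
      exact ⟨t, h⟩
    · rintro ⟨t, h⟩
      exact ⟨t.1, t, h, Or.inl rfl⟩
  | E =>
    -- Inequivalence of `v` and `w` is required because vertices of the same child may be adjacent,
    -- while the quotient has no loops.
    have h : DRel₁ (X := fun b => Fin 2 → Y b) fun b x => ∃ v w : V b, ((∃ t : childReps (structGraph (𝔅.A b)) (W b), x 0 = Sum.inl t ∧
          FPC.childRel (structGraph (𝔅.A b)) (W b) v t) ∧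
        (∃ t : childReps (structGraph (𝔅.A b)) (W b), x 1 = Sum.inl t ∧
          FPC.childRel (structGraph (𝔅.A b)) (W b) w t)) ∧
        ¬ FPC.childRel (structGraph (𝔅.A b)) (W b) v w ∧ (structGraph (𝔅.A b)).Adj v w :=
      Def.ex (Def.ex (Def.and (Def.and (hinl Term.var1 (Term.var2.proj (0 : Fin 2)))
        (hinl Term.var0 (Term.var2.proj (1 : Fin 2))))
        (Def.and (Def.not ((DRel₂.structChildRel hW).app Term.var1 Term.var0))
          ((DRel₂.adj 𝔅).app Term.var1 Term.var0))))
    refine Def.congr h fun b j => ⟨?_, ?_⟩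
    · rintro ⟨v, w, ⟨⟨t, h, hvt⟩, t', h', hwt'⟩, hvw, hadj⟩
      refine ⟨t, t', h, h', (hvt.adj_congr hwt' ?_ ?_ hvw).1 hadj⟩
      · exact (childRel_equivalence.symm hvt).mem ((hT b).subset t.2)
      · exact (childRel_equivalence.symm hwt').mem ((hT b).subset t'.2)
    · rintro ⟨t, t', h, h', hadj⟩
      exact ⟨t.1, t'.1, ⟨⟨t, h, Or.inl rfl⟩, t', h', Or.inl rfl⟩, fun h =>
        hadj.ne (Subtype.ext ((hT b).eq_of_childRel _ t.2 _ t'.2 h)), hadj⟩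
  | M =>
    refine (Def.ex (X := N) (hinr Term.var0 (Term.var1.proj (0 : Fin 1)))).congr fun b j => Iff.rfl
  | le =>
    refine (Def.ex (X := N) (Def.ex (X := N) (Def.and (hinr Term.var1 (Term.var2.proj (0 : Fin 2)))
      (Def.and (hinr Term.var0 (Term.var2.proj (1 : Fin 2))) (Def.le Term.var1 Term.var0))))).congr
        fun b j => Iff.rfl
  | L =>
    have h : DRel₁ (X := fun b => Fin 3 → Y b) fun b x => ∃ (v : V b) (d d' : N b),
        (∃ t : childReps (structGraph (𝔅.A b)) (W b), x 0 = Sum.inl t ∧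
          FPC.childRel (structGraph (𝔅.A b)) (W b) v t) ∧
        x 1 = Sum.inr d ∧ x 2 = Sum.inr d' ∧
        FPC.childColor (structGraph (𝔅.A b)) (W b) (Kc b) v d d' :=
      Def.ex (Def.ex (Def.ex (Def.and (hinl Term.var2 (Term.var3.proj (0 : Fin 3)))
        (Def.and (hinr Term.var1 (Term.var3.proj (1 : Fin 3)))
        (Def.and (hinr Term.var0 (Term.var3.proj (2 : Fin 3)))
          ((DRel₃.childColor hW hK).app Term.var2 Term.var1 Term.var0))))))
    refine Def.congr h fun b j => ⟨?_, ?_⟩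
    · rintro ⟨v, d, d', ⟨t, h, hvt⟩, h₁, h₂, z, hz, hK⟩
      exact ⟨t, d, d', h, h₁, h₂, z,
        childRel_equivalence.trans (childRel_equivalence.symm hvt) hz, hK⟩
    · rintro ⟨t, d, d', h, h₁, h₂, hK⟩
      exact ⟨t.1, d, d', ⟨t, h, Or.inl rfl⟩, h₁, h₂, hK⟩

include hW hK in
theorem DRel₂.primeCode {k l : ℕ} (Θ : OrdTransduction loLang k l) :
    DRel₂ (X := fun b => Num (𝔅.A b).carrier) (Y := fun b => Num (𝔅.A b).carrier)
      fun b p q => FPC.primeCode Θ (𝔅.A b).toFinGraph (W b) (hne b) (Kc b) p q := by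
  let B : 𝔅.I → FinStruct loLang := fun b =>
    (quotientLO (𝔅.A b).toFinGraph (W b) (hne b) (Kc b)).toStruct
  obtain ⟨inst, hrel⟩ := exists_srt_quotientLO hW hK hne
  let inst' : Srt 𝔅 (fun b => (B b).carrier) := inst
  let := Srt.numOf B
  let T : 𝔅.I → Type := fun b => Tup (B b).carrier k l
  have hcode : DRel₃ (X := T) (Y := fun b => Num (𝔅.A b).carrier)
      (Z := fun b => Num (𝔅.A b).carrier)
      fun b t p q => FPC.orderedCode (Θ.Universe (B b) t.1 t.2 (RelAssign.none _)) p q :=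
    DRel₃.orderedCode B hrel Θ
  have hdom : ∀ {J : 𝔅.I → Type} {Δ : Ctx 𝔅 J} {t : ∀ b, J b → T b}, Term Δ t →
      Def Δ fun b j => Θ.InDom (B b) (t b j).1 (t b j).2 (RelAssign.none _) := fun ht =>
    Def.inDom B hrel Θ (fun x => ht.fst.proj x) fun x => ht.snd.proj x
  refine Def.ex (X := T) (Def.and (Def.and (hdom Term.var0)
    (hcode.app Term.var0 Term.var2 Term.var1)) (Def.all (X := T) (Def.imp (hdom Term.var0)
      (Def.not (Def.lexLt (hcode.app Term.var2 Term.var1 Term.var0)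
        (hcode.app Term.var3 Term.var1 Term.var0))))))

include hW hK in
theorem DRel₂.stepCode {k l : ℕ} (Θ : OrdTransduction loLang k l) :
    DRel₂ (X := fun b => Num (𝔅.A b).carrier) (Y := fun b => Num (𝔅.A b).carrier)
      fun b p q => FPC.stepCode Θ (𝔅.A b).toFinGraph (W b) (hne b) (Kc b) p q := by
  have h₁ : ∀ {J : 𝔅.I → Type} {Δ : Ctx 𝔅 J}, Def Δ fun b _ => (W b).ncard = 1 := fun {J Δ} =>
    NTerm.eq (NTerm.ncard (X := fun b => (𝔅.A b).carrier) (P := fun b _ x => x ∈ W b)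
      (hW.app Term.var0)) NTerm.one
  have h₂ : ∀ {J : 𝔅.I → Type} {Δ : Ctx 𝔅 J}, Def Δ fun b _ =>
      ConnOn (structGraph (𝔅.A b)) (W b) ∧ ConnOn (structGraph (𝔅.A b))ᶜ (W b) := fun {J Δ} =>
    (Def.connOn (DRel₂.adj 𝔅) hW).and (Def.connOn (DRel₂.adj 𝔅).compl hW)
  exact Def.or (Def.and h₁ (Def.and (Term.var1.eq Term.zero) (Term.var0.eq Term.zero)))
    (Def.and h₁.not (Def.or (Def.and h₂.not (DRel₂.flatCode hW hK))
      (Def.and h₂ (DRel₂.primeCode hW hK hne Θ))))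

end Step

end

/-! ### Iteration up the decomposition tree. -/

section

/-! ### The code of a graph -/

section Iteration

variable {k l : ℕ} (Θ : OrdTransduction loLang k l)

/-- The codes of the sets of the decomposition tree, from those of their children. -/
def codeStep (A : FinStruct FirstOrder.Language.graph) (Y : Set (Tup A.carrier 1 3)) :
    Set (Tup A.carrier 1 3) :=
  {t | stepCode Θ A.toFinGraph (levSet (structGraph A) (t.2 0) (t.1 0)) ⟨_, mem_levSet_self _ _⟩
    (fun y p q => ∃ d : Num A.carrier, (d : ℕ) = t.2 0 + 1 ∧ (![y], ![d, p, q]) ∈ Y) (t.2 1) (t.2 2)}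

/-- The code of the graph encoded by a structure. -/
def graphCode (A : FinStruct FirstOrder.Language.graph) (p q : Num A.carrier) : Prop :=
  ∃ x : A.carrier, (![x], ![0, p, q]) ∈ (codeStep Θ A)^[Fin.last (Nat.card A.carrier)] ∅

/-- A tuple `(x; d, p, q)` says that `(p, q)` is in the code of the set at depth `d` around `x`. One
step uses `x` only through that set, so no induction is needed. -/
theorem iterate_codeStep_congr (A : FinStruct FirstOrder.Language.graph) (i : ℕ) {x y : A.carrier}
    {d : Num A.carrier} (h : levSet (structGraph A) d x = levSet (structGraph A) d y)
    (p q : Num A.carrier) :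
    (![x], ![d, p, q]) ∈ (codeStep Θ A)^[i] ∅ ↔ (![y], ![d, p, q]) ∈ (codeStep Θ A)^[i] ∅ := by
  cases i with
  | zero => exact Iff.rfl
  | succ i =>
    rw [Function.iterate_succ_apply']
    change stepCode Θ A.toFinGraph (levSet (structGraph A) d x) _ _ p q ↔
      stepCode Θ A.toFinGraph (levSet (structGraph A) d y) _ _ p q
    simp only [h]

/-- The children of a set with more than one vertex are strictly smaller, so their codes are correct
one round earlier. -/
theorem isCode_iterate_codeStep {C : Set FinGraph} (hC : ClosedUnderInducedSubgraphs C)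
    (hΘ : ∀ A ∈ primeLOClass C, Canonizes Θ A) {A : FinStruct FirstOrder.Language.graph}
    (hA : A.toFinGraph ∈ C) (i : ℕ) (d : Num A.carrier) (x : A.carrier)
    (hi : (levSet (structGraph A) d x).ncard ≤ i) :
    IsCode (structGraph A) (levSet (structGraph A) d x)
      fun p q => (![x], ![d, p, q]) ∈ (codeStep Θ A)^[i] ∅ := by
  induction i generalizing d x with
  | zero =>
    have := (Set.ncard_pos (Set.toFinite _)).2 ⟨x, mem_levSet_self (G := structGraph A) d x⟩
    omega
  | succ i ih =>
    rw [Function.iterate_succ_apply']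
    refine isCode_stepCode (G := A.toFinGraph) (W := levSet (structGraph A) d x)
      (hW := ⟨x, mem_levSet_self d x⟩) (Kc := fun y p q => ∃ d' : Num A.carrier,
        (d' : ℕ) = d + 1 ∧ (![y], ![d', p, q]) ∈ (codeStep Θ A)^[i] ∅) hC hA hΘ ?_ ?_
    · intro hcard t ht
      have hlt := Set.ncard_lt_ncard (levSet_succ_ssubset ht hcard) (Set.toFinite _)
      -- By `ncard_levSet` the depth of the children is still a number of the structure.
      have hd : (d : ℕ) + 1 < Nat.card A.carrier + 1 := by
        have h₁ := (ncard_levSet (G := structGraph A) d x).resolve_left hcard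
        have h₂ := (Set.ncard_pos (Set.toFinite _)).2 ⟨x, mem_levSet_self (G := structGraph A) d x⟩
        omega
      have := ih ⟨d + 1, hd⟩ t (by change (levSet (structGraph A) (d + 1) t).ncard ≤ i; omega)
      change IsCode _ (levSet (structGraph A) (d + 1) t) _ at this
      rw [levSet_succ ht] at this
      refine (congrArg (IsCode _ _) ?_).mp this
      funext p q
      refine propext ⟨fun h => ⟨_, rfl, h⟩, ?_⟩
      rintro ⟨d', hd', h⟩
      rwa [show d' = ⟨d + 1, hd⟩ from Fin.ext hd'] at h
    · intro y z hyz
      funext p q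
      refine propext (exists_congr fun d' => and_congr_right fun hd' => ?_)
      refine iterate_codeStep_congr Θ A i ?_ p q
      rcases hyz with rfl | ⟨⟨hy, hz⟩, h⟩
      · rfl
      · refine (levSet_eq ?_).symm
        change z ∈ levSet (structGraph A) d' y
        have hd'' : (d' : ℕ) = d + 1 := hd'
        rw [hd'', levSet_succ hy]
        exact Or.inr ⟨⟨hy, hz⟩, h⟩

theorem isCode_graphCode {C : Set FinGraph} (hC : ClosedUnderInducedSubgraphs C)
    (hΘ : ∀ A ∈ primeLOClass C, Canonizes Θ A) {A : FinStruct FirstOrder.Language.graph}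
    (hA : A.toFinGraph ∈ C) : IsCode (structGraph A) Set.univ (graphCode Θ A) := by
  have x₀ : A.carrier := Classical.arbitrary _
  have huniv : ∀ x, levSet (structGraph A) (0 : Num A.carrier) x = Set.univ := fun x =>
    Set.eq_univ_of_forall fun _ => trivial
  have h := isCode_iterate_codeStep Θ hC hΘ hA (Fin.last (Nat.card A.carrier)) 0 x₀
    (by rw [huniv, Set.ncard_univ]; exact le_refl _)
  rw [huniv] at h
  refine (congrArg (IsCode _ _) ?_).mp h
  funext p q
  refine propext ⟨fun h => ⟨_, h⟩, ?_⟩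
  rintro ⟨x, h⟩
  exact (iterate_codeStep_congr Θ A _ ((huniv x).trans (huniv x₀).symm) p q).1 h

theorem Term.codeTup {𝔅 : Base FirstOrder.Language.graph} {J : 𝔅.I → Type} {Δ : Ctx 𝔅 J}
    {x : ∀ b, J b → (𝔅.A b).carrier} {d p q : ∀ b, J b → Num (𝔅.A b).carrier} (hx : Term Δ x)
    (hd : Term Δ d) (hp : Term Δ p) (hq : Term Δ q) :
    Term Δ (X := fun b => Tup (𝔅.A b).carrier 1 3)
      fun b j => (![x b j], ![d b j, p b j, q b j]) := by
  refine Term.pair (Term.pi fun i => ?_) (Term.pi fun i => ?_)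
  · match i with
    | 0 => exact hx
  · match i with
    | 0 => exact hd
    | 1 => exact hp
    | 2 => exact hq

/-- The decomposed set depends on the tuple under consideration, so the step is defined over the
base in which that tuple is constant. -/
theorem DRel₁.codeStep {𝔅 : Base FirstOrder.Language.graph}
    {Y : ∀ b, Set (Tup (𝔅.A b).carrier 1 3)}
    (hY : DRel₁ (X := fun b => Tup (𝔅.A b).carrier 1 3) fun b t => t ∈ Y b) :
    DRel₁ (X := fun b => Tup (𝔅.A b).carrier 1 3) fun b t => t ∈ FPC.codeStep Θ (𝔅.A b) (Y b) := by
  let V : 𝔅.I → Type := fun b => (𝔅.A b).carrier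
  let N : 𝔅.I → Type := fun b => Num (𝔅.A b).carrier
  let Δ := (Ctx.nil 𝔅).ext fun b => Tup (𝔅.A b).carrier 1 3
  have hW : DRel₁ (𝔅 := Δ.toBase) (X := fun b => (𝔅.A b.1).carrier)
      fun b z => z ∈ levSet (structGraph (𝔅.A b.1)) ((Δ.pt b).2.2 0) ((Δ.pt b).2.1 0) :=
    Def.toBase_ext (Δ := Δ) (X := V)
      (P := fun b j => levRel (structGraph (𝔅.A b)) (j.1.2.2 0) (j.1.2.1 0) j.2)
      ((DRel₃.levRel 𝔅).app (Term.proj (Term.snd Term.var1) 0) (Term.proj (Term.fst Term.var1) 0)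
        Term.var0) (Ctx.nil _)
  -- `Def.toBase_ext` carries over a single variable; the three arguments are therefore packed into
  -- a triple.
  have hK₀ : DRel₁ (𝔅 := Δ.toBase) (X := fun b => (𝔅.A b.1).carrier ×
      Num (𝔅.A b.1).carrier × Num (𝔅.A b.1).carrier) fun b z => ∃ d : Num (𝔅.A b.1).carrier,
        (d : ℕ) = (Δ.pt b).2.2 0 + 1 ∧ (![z.1], ![d, z.2.1, z.2.2]) ∈ Y b.1 :=
    Def.toBase_ext (Δ := Δ) (X := fun b => V b × N b × N b)
      (P := fun b j => ∃ d : N b, (d : ℕ) = j.1.2.2 0 + 1 ∧ (![j.2.1], ![d, j.2.2.1, j.2.2.2]) ∈ Y b)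
      (Def.ex (X := N) (Def.and (NTerm.eq (NTerm.num Term.var0)
        ((NTerm.num (Term.proj (Term.snd Term.var2) 0)).add NTerm.one))
        (hY.app (Term.codeTup Term.var1.fst Term.var0 Term.var1.snd.fst Term.var1.snd.snd))))
      (Ctx.nil _)
  have hK : DRel₃ (𝔅 := Δ.toBase) (X := fun b => (𝔅.A b.1).carrier)
      (Y := fun b => Num (𝔅.A b.1).carrier) (Z := fun b => Num (𝔅.A b.1).carrier)
      fun b y p q => ∃ d : Num (𝔅.A b.1).carrier,
        (d : ℕ) = (Δ.pt b).2.2 0 + 1 ∧ (![y], ![d, p, q]) ∈ Y b.1 :=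
    hK₀.app (Term.var2.pair (Term.var1.pair Term.var0))
  refine Def.of_toBase (Δ := Δ) (P := fun b j => j.2 ∈ FPC.codeStep Θ (𝔅.A b) (Y b)) ?_
  exact (DRel₂.stepCode hW hK (fun b => ⟨_, mem_levSet_self _ _⟩) Θ).app
    (Term.toBase (Δ := Δ) (X := N) (a := fun b j => j.2.2 1) (Term.proj (Term.snd Term.var0) 1) _)
    (Term.toBase (Δ := Δ) (X := N) (a := fun b j => j.2.2 2) (Term.proj (Term.snd Term.var0) 2) _)

theorem DRel₂.graphCode (𝔅 : Base FirstOrder.Language.graph) :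
    DRel₂ (X := fun b => Num (𝔅.A b).carrier) (Y := fun b => Num (𝔅.A b).carrier)
      fun b p q => FPC.graphCode Θ (𝔅.A b) p q :=
  Def.ex (X := fun b => (𝔅.A b).carrier)
    ((DRel₂.iterate (codeStep Θ) (fun 𝔅 Y hY => DRel₁.codeStep Θ hY) 𝔅).app Term.last
      (Term.codeTup Term.var0 Term.zero Term.var2 Term.var1))

end Iteration

end

/-! ### From the code of a graph to a transduction without parameters. -/

section

/-! ### The canonization of the graphs in the class -/

section Canonization

/-- All structures, without variables. -/
abbrev Base.all (τ : FirstOrder.Language.{0, 0}) : Base τ where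
  I := FinStruct τ
  A A := A
  S := Fin 0
  N := Fin 0
  R := noRel
  s _ := Fin.elim0
  n _ := Fin.elim0
  r _ := RelAssign.none _

/-- The context with a family of variables for numbers. -/
abbrev numCtx (τ : FirstOrder.Language.{0, 0}) (K L : Type) :
    Ctx (Base.all τ) (fun A => L → Num ((Base.all τ).A A).carrier) where
  S := Fin 0 ⊕ K
  N := Fin 0 ⊕ L
  R := noRel
  rep _ _ n r j := n ∘ Sum.inr = j
  inS := Sum.inl
  inN := Sum.inl
  inR _ _ X := X
  compat _ _ _ _ _ _ := ⟨funext fun i => i.elim0, funext fun i => i.elim0,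
    funext fun _ => funext fun _ => funext fun X => X.elim⟩

variable {τ : FirstOrder.Language.{0, 0}} {K L : Type}

theorem Term.numCtx (i : L) : Term (numCtx τ K L) (X := fun A => Num ((Base.all τ).A A).carrier) fun A j => j i :=
  Term.comp (Δ := FPC.numCtx τ K L) (Γ := (Ctx.nil (Base.all τ)).ext fun A => Num ((Base.all τ).A A).carrier)
    (f := fun A j => ((), j i)) Term.var0
    ⟨fun x => Sum.elim Sum.inl Empty.elim x, fun x => Sum.elim Sum.inl (fun _ => Sum.inr i) x,
      fun _ _ X => X, fun A s n r j hj => ⟨⟨funext fun i => i.elim0, funext fun i => i.elim0,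
        funext fun _ => funext fun _ => funext fun X => X.elim⟩, congrFun hj i⟩⟩

variable {k l : ℕ} (Θ : OrdTransduction loLang k l)

/-- The ordered graph on an initial segment of the numbers with a given code. -/
def codeRel (A : FinStruct FirstOrder.Language.graph) :
    ∀ {n : ℕ}, (withOrder FirstOrder.Language.graph).Relations n → (Fin n → Num A.carrier) → Prop
  | _, Sum.inl .adj, x => x 0 ≠ x 1 ∧ graphCode Θ A (x 0) (x 1)
  | _, Sum.inr .le, x => x 0 ≤ x 1

theorem Def.codeRel {n : ℕ} (P : (withOrder FirstOrder.Language.graph).Relations n) :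
    Def (numCtx FirstOrder.Language.graph (Fin n × Fin 0) (Fin n × Fin 1))
      fun A j => FPC.codeRel Θ A P fun i => j (i, 0) := by
  match n, P with
  | _, Sum.inl .adj =>
    exact Def.and (Def.not (Term.eq (Term.numCtx (0, 0)) (Term.numCtx (1, 0))))
      ((DRel₂.graphCode Θ _).app (Term.numCtx (0, 0)) (Term.numCtx (1, 0)))
  | _, Sum.inr .le => exact Def.le (Term.numCtx (0, 0)) (Term.numCtx (1, 0))

theorem eqvGen_eq_of_false {X : Type} {r : X → X → Prop} (hr : ∀ x y, ¬ r x y) {x y : X}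
    (h : Relation.EqvGen r x y) : x = y := by
  induction h with
  | rel x y h => exact (hr x y h).elim
  | refl x => rfl
  | symm x y _ ih => exact ih.symm
  | trans x y z _ _ ih ih' => exact ih.trans ih'

/-- The transduction lives on numbers, with their natural order and with the code, freed of loops,
as edge relation. The bijection belonging to the code is the isomorphism. -/
theorem admitsCanonization_of_isCode {C : Set FinGraph}
    (h : ∀ G ∈ C, IsCode (structGraph G.toStruct) Set.univ (graphCode Θ G.toStruct)) :
    AdmitsCanonization (graphClass C) := by
  obtain ⟨dom, hdom⟩ := Def.const (Δ := Ctx.nil (Base.all FirstOrder.Language.graph)) True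
  -- The number sort has one element more than the graph; the largest number is left out.
  obtain ⟨univ, huniv⟩ : Def (numCtx FirstOrder.Language.graph (Fin 0) (Fin 1))
      fun A j => (j 0 : ℕ) < Nat.card A.carrier :=
    NTerm.lt (NTerm.num (Term.numCtx 0)) NTerm.card_univ
  -- The empty relation generates equality, so no numbers are identified.
  obtain ⟨equiv, hequiv⟩ := Def.const
    (Δ := numCtx FirstOrder.Language.graph (Fin 2 × Fin 0) (Fin 2 × Fin 1)) False
  choose rel hrel using fun (n : ℕ) P => Def.codeRel Θ (n := n) P
  let Θ' : OrdTransduction FirstOrder.Language.graph 0 0 := ⟨0, 1, dom, univ, equiv, fun {n} P => rel n P⟩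
  refine ⟨Θ', ?_⟩
  rintro _ ⟨G, hG, rfl⟩
  let A := G.toStruct
  obtain ⟨f, hf, hK⟩ : IsCode (structGraph A) Set.univ (graphCode Θ A) := h G hG
  rw [Set.ncard_univ] at hf hK
  have hmem : ∀ (p : Tup A.carrier 0 0) (t : Tup A.carrier 0 1),
      t ∈ Θ'.univSet A p.1 p.2 (RelAssign.none _) ↔ (t.2 0 : ℕ) < Nat.card A.carrier :=
    fun p t => huniv A _ _ _ t.2 rfl
  refine ⟨⟨(Fin.elim0, Fin.elim0), ?_, (Fin.elim0, fun _ => 0), ?_⟩, fun p hp => ?_⟩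
  · exact (hdom A _ _ _ () ⟨rfl, rfl, rfl⟩).2 trivial
  · exact (hmem _ _).2 Nat.card_pos
  have hcls : ∀ t t', Θ'.cls A p.1 p.2 (RelAssign.none _) t = Θ'.cls A p.1 p.2 (RelAssign.none _) t' →
      t = t' := fun t t' h =>
    Subtype.ext (eqvGen_eq_of_false (fun x y h' => (hequiv A _ _ _ _ rfl).1 h') (Quotient.exact h))
  let val : Θ'.Universe A p.1 p.2 (RelAssign.none _) → Num A.carrier :=
    Quotient.lift (fun t => t.1.2 0) fun t t' h => by rw [hcls t t' (Quotient.sound h)]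
  have val_lt : ∀ u, (val u : ℕ) < Nat.card A.carrier := by
    intro u
    obtain ⟨t, rfl⟩ := Quotient.exists_rep u
    exact (hmem p t.1).1 t.2
  have val_inj : Function.Injective val := by
    intro u u' h
    obtain ⟨t, rfl⟩ := Quotient.exists_rep u
    obtain ⟨t', rfl⟩ := Quotient.exists_rep u'
    change t.1.2 0 = t'.1.2 0 at h
    refine congrArg _ (Subtype.ext (Prod.ext (funext fun i => i.elim0) (funext fun i => ?_)))
    rwa [Subsingleton.elim i 0]
  have hR : ∀ {n : ℕ} (P : (withOrder FirstOrder.Language.graph).Relations n)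
      (q : Fin n → Θ'.Universe A p.1 p.2 (RelAssign.none _)),
      Structure.RelMap P q ↔ codeRel Θ A P fun i => val (q i) := by
    intro n P q
    have hholds : ∀ t : Fin n → Tup A.carrier 0 1,
        Θ'.holds A p.1 p.2 (RelAssign.none _) (Θ'.rel P) t ↔ codeRel Θ A P fun i => (t i).2 0 :=
      fun t => hrel n P A _ _ _ (fun ij => (t ij.1).2 ij.2) rfl
    constructor
    · rintro ⟨t, ht, h⟩
      obtain rfl : (fun i => Θ'.cls A p.1 p.2 (RelAssign.none _) (t i)) = q := funext ht
      exact (hholds _).1 h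
    · intro h
      choose t ht using fun i => Quotient.exists_rep (q i)
      obtain rfl : (fun i => Θ'.cls A p.1 p.2 (RelAssign.none _) (t i)) = q := funext ht
      exact ⟨t, fun i => rfl, (hholds _).2 h⟩
  refine ⟨?_, ?_⟩
  · have hle : ∀ u v : Θ'.Universe A p.1 p.2 (RelAssign.none _), Structure.RelMap
        (leSymb : (withOrder FirstOrder.Language.graph).Relations 2) ![u, v] ↔ val u ≤ val v :=
      fun u v => hR (Sum.inr .le) ![u, v]
    exact
      { refl := fun u => (hle u u).2 le_rfl
        trans := fun u v w h h' => (hle u w).2 (((hle u v).1 h).trans ((hle v w).1 h'))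
        antisymm := fun u v h h' => val_inj (le_antisymm ((hle u v).1 h) ((hle v u).1 h'))
        total := fun u v => (le_total (val u) (val v)).imp (hle u v).2 (hle v u).2 }
  · let e : Θ'.Universe A p.1 p.2 (RelAssign.none _) → A.carrier := fun u => f (val u)
    have he : Function.Bijective e := by
      refine ⟨fun u v h => val_inj (Fin.ext (hf.injOn (val_lt u) (val_lt v) h)), fun x => ?_⟩
      obtain ⟨i, hi, rfl⟩ := hf.surjOn (Set.mem_univ x)
      let t : Tup A.carrier 0 1 := (Fin.elim0, fun _ => ⟨i, Nat.lt_succ_of_lt hi⟩)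
      exact ⟨Θ'.cls A p.1 p.2 (RelAssign.none _) ⟨t, (hmem p t).2 hi⟩, rfl⟩
    let := (LHom.sumInl : FirstOrder.Language.graph →ᴸ withOrder FirstOrder.Language.graph).reduct
      (Θ'.apply A p.1 p.2 (RelAssign.none _) hp).carrier
    refine ⟨{ toEquiv := Equiv.ofBijective e he, map_fun' := fun g => isEmptyElim g, map_rel' := ?_ }⟩
    intro n P x
    cases P with
    | adj =>
      refine Iff.trans ?_ (hR (Sum.inl .adj) x).symm
      change G.graph.Adj (f (val (x 0))) (f (val (x 1))) ↔
        val (x 0) ≠ val (x 1) ∧ graphCode Θ A (val (x 0)) (val (x 1))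
      rw [hK, structGraph_toStruct]
      constructor
      · intro h
        exact ⟨fun h' => h.ne (by rw [h']), ⟨val_lt _, val_lt _⟩, Or.inr h⟩
      · rintro ⟨hne, -, h⟩
        exact h.resolve_left fun h' => hne (Fin.ext (hf.injOn (val_lt _) (val_lt _) h'))

end Canonization

end

end FPC

theorem mainTheorem1 (C : Set FPC.FinGraph) (hC : FPC.ClosedUnderInducedSubgraphs C)
    (h : FPC.AdmitsParameterizedCanonization (FPC.primeLOClass C)) :
    FPC.AdmitsCanonization (FPC.graphClass C) := by
  obtain ⟨k, l, Θ, hΘ⟩ := h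
  refine FPC.admitsCanonization_of_isCode Θ fun G hG => ?_
  refine FPC.isCode_graphCode Θ hC hΘ ?_
  rwa [FPC.toFinGraph_toStruct]
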